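/- Let $d\ge 1$, let $s\in\{\tfrac12,1,\tfrac32,\dots\}$ be fixed, and let $I=\{+,z,-\}$ with the conjugation $\bar{\cdot}$ exchanging $+$ and $-$ and fixing $z$. For $v\in\mathbb R^3$ put $v_\pm=(v_1\pm iv_2)/\sqrt2$, $v_z=v_3$. Let $\tilde\epsilon_{\pm\mp z}=\pm1$, $\tilde\epsilon_{\pm z\pm}=\mp1$, $\tilde\epsilon_{z\pm\pm}=\pm1$, and $\tilde\epsilon_{ijk}=0$ otherwise. **Kernels.** $\mathscr B^{(p)}$ is the space of continuous $f=(f_{i_1\dots i_p})_{i\in I^p}:\mathbb R^{pd}\to\mathbb C^{3^p}$ that are invariant under simultaneous permutations of the indices $i_k$ and the arguments $x_k$; $\mathscr B^{(p)}_c$ is the subspace of compactly supported ones. **Interaction.** Let $V=(V^{(n)})_{n\ge1}$, $V^{(n)}\in\mathscr B^{(n)}$, satisfy (i) $\overline{V^{(n)}_{i_1\dots i_n}}=V^{(n)}_{\bar i_1\dots\bar i_n}$; (ii) there are $R_n>0$ such that $V^{(n)}(x_1,\dots,x_n)=0$ whenever $|x_k-x_l|>R_n$ for some $k,l$; (iii)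 $\limsup_{h\downarrow0}\|V\|^{(h)}<\infty$, where $\|V\|^{(h)}=\sum_{n\ge1}ne^n\,\sup_{x_1\in h\mathbb Z^d}\sum_{i_1,\dots,i_n}h^{(n-1)d}\sum_{x_2,\dots,x_n\in h\mathbb Z^d}|V^{(n)}_{i_1\dots i_n}(x_1,\dots,x_n)|$. **Classical side.** Let $\Xi$ be the closed unit ball of $L^\infty(\mathbb R^d;\mathbb R^3)$. For $f\in\mathscr B_c^{(p)}$ and $M\in\Xi$ put $M(f)=\sum_{i_1,\dots,i_p}\int f_{i_1\dots i_p}(x_1,\dots,x_p)\,M_{i_1}(x_1)\cdots M_{i_p}(x_p)\,dx_1\cdots dx_p$, and let $\mathfrak P$ be the algebra of functions on $\Xi$ generated by the functions $M\mapsto M(f)$ with $f\in\mathscr B_c^{(p)}$, $p\ge0$ (the kernels with $p=0$ give the constants). The continuum Landau–Lifshitz equation for $M\in C^1(\mathbb R,\Xi)$ (in the $L^\infty$-norm) is $$\frac{d}{dt}M_i(t,x)=i\sum_{n\ge1}n\sum_{i_1,\dots,i_n,j}\int dx_2\cdots dx_n\,V^{(n)}_{i_1\dots i_n}(x,x_2,\dots,x_n)\,\tilde\epsilon_{i_1ij}\,M_j(t,x)\,M_{i_2}(t,x_2)\cdots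 M_{i_n}(t,x_n).$$ **Quantum side.** For $h>0$ put a spin $\mathbb C^{2s+1}$ at each point of $h\mathbb Z^d$. Let $\widehat{\mathfrak A}^{(h)}$ be the quasi-local C*-algebra (the norm closure of the union of the algebras of operators on $\bigotimes_{x\in\Lambda}\mathbb C^{2s+1}$, $\Lambda\subset h\mathbb Z^d$ finite, with $\mathcal A$ identified with $\mathcal A\otimes1$), and let $\widehat S_i(x)$, $i\in I$, be the generators of the spin-$s$ representation of $su(2)$ at $x$ (with $\widehat S_\pm=(\widehat S_1\pm i\widehat S_2)/\sqrt2$, $\widehat S_z=\widehat S_3$), multiplied by $h^d/s$. Normal ordering $:\cdot:$ puts all factors with index $+$ first, then those with index $z$, then those with index $-$. Put $:\!\widehat S_\Lambda(f)\!:\,=\sum_{i_1,\dots,i_p}\sum_{x_1,\dots,x_p\in\Lambda}f_{i_1\dots i_p}(x_1,\dots,x_p):\!\widehat S_{i_1}(x_1)\cdots\widehat S_{i_p}(x_p)\!:$, and define $:\!\widehat S(f)\!:$ for $f\in\mathscr B_c^{(p)}$ by the same formula with $\Lambda$ replaced by $h\mathbb Z^d$. The quantization $A\mapsto\widehat A$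 is linear on $\mathfrak P$ and sends $M\mapsto M(f)$ to $:\!\widehat S(f)\!:$. Let $\widehat H_\Lambda=\sum_{n\ge1}:\!\widehat S_\Lambda(V^{(n)})\!:$, $U_\Lambda(t)=\exp(-ish^{-d}t\widehat H_\Lambda)$, $\widehat\alpha^t_\Lambda\mathcal A=U_\Lambda(t)^*\mathcal A\,U_\Lambda(t)$, and $\widehat\alpha^t\mathcal A=\lim_{\Lambda\to\infty}\widehat\alpha^t_\Lambda\mathcal A$ (norm limit along the finite subsets of $h\mathbb Z^d$ directed by inclusion). **Coherent states.** For a unit vector $m$ with polar angles $(\theta,\varphi)$ let $|m\rangle=\exp\big(\tfrac{\theta}{\sqrt2}(e^{i\varphi}S_--e^{-i\varphi}S_+)\big)|s\rangle\in\mathbb C^{2s+1}$, with unscaled generators $S_\pm$ and highest-weight unit vector $|s\rangle$. For $M:\mathbb R^d\to\mathbb S^2$ let $\rho_M$ be the state on $\widehat{\mathfrak A}^{(h)}$ with $\rho_M(\mathcal A)=\langle M_\Lambda,\mathcal A\,M_\Lambda\rangle$ for operators $\mathcal A$ on $\bigotimes_{x\in\Lambda}\mathbb C^{2s+1}$, where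 $|M_\Lambda\rangle=\bigotimes_{x\in\Lambda}|M(x)\rangle$, extended by continuity. **Theorem.** Let $M:\mathbb R^d\to\mathbb S^2$ be a function whose points of discontinuity form a null set, let $M(t)$ be the solution in $C^1(\mathbb R,\Xi)$ of the continuum Landau–Lifshitz equation with $M(0)=M$ almost everywhere, and let $A\in\mathfrak P$. Then $A$ has a quantization $\widehat A$; for all sufficiently small $h>0$ the series defining $\widehat H_\Lambda$ converges in norm for every finite $\Lambda\subset h\mathbb Z^d$ and the limit defining $\widehat\alpha^t\widehat A$ exists in norm for every $t\in\mathbb R$; and $$\lim_{h\downarrow0}\rho_M\big(\widehat\alpha^t\widehat A\big)=A(M(t)),$$ uniformly for $t$ in compact subsets of $\mathbb R$. -/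

import Mathlib

open Filter Topology MeasureTheory
open scoped ENNReal Matrix

noncomputable section

namespace SpinLattice

/-! ### Lattice sites, configurations and the quasi-local algebra -/

/-- Euclidean space `ℝ^d`. -/
abbrev E (d : ℕ) : Type := EuclideanSpace ℝ (Fin d)

/-- Labels of the lattice sites; the label `k ∈ ℤ^d` stands for the point `h k` of `h ℤ^d`. -/
abbrev Site (d : ℕ) : Type := Fin d → ℤ

/-- The point `h k ∈ h ℤ^d ⊂ ℝ^d`. -/
def latticePoint {d : ℕ} (h : ℝ) (k : Site d) : E d :=
  WithLp.toLp 2 (fun j => h * (k j : ℝ))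

/-- Labels of the product basis: every site carries a basis label of `ℂ^(N+1)`, where `N = 2s`. -/
abbrev Config (d N : ℕ) : Type := Site d → Fin (N + 1)

/-- Basis labels of `⨂_{x ∈ Λ} ℂ^(N+1)`. -/
abbrev LocalConfig {d : ℕ} (N : ℕ) (Λ : Finset (Site d)) : Type := Λ → Fin (N + 1)

/-- The restriction of a configuration to `Λ`. -/
def Config.restrict {d N : ℕ} (c : Config d N) (Λ : Finset (Site d)) : LocalConfig N Λ :=
  fun x => c x

/-- The configuration `c`, overwritten by `b` on `Λ`. -/
def Config.override {d N : ℕ} (c : Config d N) (Λ : Finset (Site d)) (b : LocalConfig N Λ) :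
    Config d N :=
  fun x => if hx : x ∈ Λ then b ⟨x, hx⟩ else c x

/-- The Hilbert space `ℓ²` over all configurations. The matrix algebras of all finite sets of
sites act on it faithfully, compatibly with the identifications `𝒜 = 𝒜 ⊗ 1`. -/
abbrev SpinSpace (d N : ℕ) : Type := lp (fun _ : Config d N => ℂ) 2

/-- The values of the matrix unit `E_{ab}` of `Λ`, tensored with the identity outside `Λ`. -/
def matrixUnitFun {d N : ℕ} (Λ : Finset (Site d)) (a b : LocalConfig N Λ)
    (ψ : Config d N → ℂ) : Config d N → ℂ :=
  open Classical in fun c => if c.restrict Λ = a then ψ (c.override Λ b) else 0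

theorem override_injOn {d N : ℕ} (Λ : Finset (Site d)) (a b : LocalConfig N Λ) :
    Function.Injective
      (fun c : {c : Config d N | c.restrict Λ = a} => (c : Config d N).override Λ b) := by
  rintro ⟨c, hc⟩ ⟨c', hc'⟩ hcc
  apply Subtype.ext
  funext x
  by_cases hx : x ∈ Λ
  · have h1 := congrFun hc ⟨x, hx⟩
    have h2 := congrFun hc' ⟨x, hx⟩
    simp only [Config.restrict] at h1 h2
    exact h1.trans h2.symm
  · have h1 := congrFun hcc x
    simpa [Config.override, hx] using h1

theorem matrixUnitFun_sq {d N : ℕ} (Λ : Finset (Site d)) (a b : LocalConfig N Λ)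
    (ψ : SpinSpace d N) :
    (fun c => ‖matrixUnitFun Λ a b ψ c‖ ^ (2 : ℝ)) =
      Set.indicator {c : Config d N | c.restrict Λ = a}
        (fun c => ‖ψ (c.override Λ b)‖ ^ (2 : ℝ)) := by
  classical
  funext c
  by_cases hc : c.restrict Λ = a
  · simp [matrixUnitFun, Set.indicator, hc]
  · simp [matrixUnitFun, Set.indicator, hc]

theorem spinSpace_summable {d N : ℕ} (ψ : SpinSpace d N) :
    Summable (fun c => ‖ψ c‖ ^ (2 : ℝ)) := by
  have := (lp.memℓp ψ).summable (by norm_num)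
  simpa using this

theorem matrixUnitFun_summable {d N : ℕ} (Λ : Finset (Site d)) (a b : LocalConfig N Λ)
    (ψ : SpinSpace d N) :
    Summable (fun c => ‖matrixUnitFun Λ a b ψ c‖ ^ (2 : ℝ)) := by
  rw [matrixUnitFun_sq, ← summable_subtype_iff_indicator]
  exact (spinSpace_summable ψ).comp_injective (override_injOn Λ a b)

theorem matrixUnitFun_mem {d N : ℕ} (Λ : Finset (Site d)) (a b : LocalConfig N Λ)
    (ψ : SpinSpace d N) :
    Memℓp (E := fun _ : Config d N => ℂ) (matrixUnitFun Λ a b ψ) 2 := by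
  apply memℓp_gen
  simpa using matrixUnitFun_summable Λ a b ψ

/-- The matrix unit `E_{ab} ⊗ 1` as a bounded operator. -/
def matrixUnitOp {d N : ℕ} (Λ : Finset (Site d)) (a b : LocalConfig N Λ) :
    SpinSpace d N →L[ℂ] SpinSpace d N :=
  LinearMap.mkContinuous
    { toFun := fun ψ => ⟨matrixUnitFun Λ a b ψ, matrixUnitFun_mem Λ a b ψ⟩
      map_add' := by
        intro ψ φ
        apply Subtype.ext
        funext c
        change matrixUnitFun Λ a b (ψ + φ : SpinSpace d N) c =
          matrixUnitFun Λ a b ψ c + matrixUnitFun Λ a b φ c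
        by_cases hc : c.restrict Λ = a <;> simp [matrixUnitFun, hc]
      map_smul' := by
        intro z ψ
        apply Subtype.ext
        funext c
        by_cases hc : c.restrict Λ = a <;> simp [matrixUnitFun, hc] }
    1 (by
      intro ψ
      rw [one_mul]
      have h2 : (0 : ℝ) < (2 : ℝ≥0∞).toReal := by norm_num
      refine (Real.rpow_le_rpow_iff (norm_nonneg _) (norm_nonneg _) h2).1 ?_
      rw [lp.norm_rpow_eq_tsum h2, lp.norm_rpow_eq_tsum h2]
      have e : (2 : ℝ≥0∞).toReal = (2 : ℝ) := by norm_num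
      rw [e]
      change ∑' c, ‖matrixUnitFun Λ a b ψ c‖ ^ (2 : ℝ) ≤ _
      rw [matrixUnitFun_sq, ← tsum_subtype]
      exact tsum_comp_le_tsum_of_inj (spinSpace_summable ψ)
        (fun c => by positivity) (override_injOn Λ a b))

/-- The operator `T ⊗ 1` for an operator `T` on `⨂_{x ∈ Λ} ℂ^(N+1)`, given by its matrix in the
product basis. -/
def localOp {d N : ℕ} (Λ : Finset (Site d))
    (T : Matrix (LocalConfig N Λ) (LocalConfig N Λ) ℂ) :
    SpinSpace d N →L[ℂ] SpinSpace d N :=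
  ∑ a, ∑ b, T a b • matrixUnitOp Λ a b

theorem localOp_apply {d N : ℕ} (Λ : Finset (Site d))
    (T : Matrix (LocalConfig N Λ) (LocalConfig N Λ) ℂ) (ψ : SpinSpace d N) (c : Config d N) :
    localOp Λ T ψ c = ∑ b, T (c.restrict Λ) b * ψ (c.override Λ b) := by
  classical
  have h1 : localOp Λ T ψ = ∑ a, ∑ b, T a b • matrixUnitOp Λ a b ψ := by
    simp [localOp]
  have h2 : ∀ a b, (matrixUnitOp Λ a b ψ : SpinSpace d N) c
      = if c.restrict Λ = a then ψ (c.override Λ b) else 0 := by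
    intro a b
    change matrixUnitFun Λ a b ψ c = _
    by_cases hc : c.restrict Λ = a <;> simp [matrixUnitFun, hc]
  rw [h1]
  simp only [lp.coeFn_sum, Finset.sum_apply, lp.coeFn_smul, Pi.smul_apply, h2, smul_eq_mul]
  rw [Finset.sum_eq_single (c.restrict Λ)]
  · simp
  · intro a _ ha
    simp [ha.symm]
  · simp

/-- The quasi-local C*-algebra: the norm closure of the algebra generated by all the matrix
algebras of finite sets of sites. -/
def quasiLocalAlgebra (d N : ℕ) :
    StarSubalgebra ℂ (SpinSpace d N →L[ℂ] SpinSpace d N) :=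
  (StarAlgebra.adjoin ℂ
    {a | ∃ (Λ : Finset (Site d)) (T : Matrix (LocalConfig N Λ) (LocalConfig N Λ) ℂ),
      a = localOp Λ T}).topologicalClosure

/-- A local operator as an element of the quasi-local algebra. -/
def localObs {d N : ℕ} (Λ : Finset (Site d))
    (T : Matrix (LocalConfig N Λ) (LocalConfig N Λ) ℂ) : quasiLocalAlgebra d N :=
  ⟨localOp Λ T, StarSubalgebra.le_topologicalClosure _
    (StarAlgebra.subset_adjoin ℂ _ ⟨Λ, T, rfl⟩)⟩

/-! ### Spin operators; the indices `0, 1, 2 : Fin 3` stand for `+, z, -` -/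

/-- The symbol `ε̃_{ijk}`. -/
def epsT : Fin 3 → Fin 3 → Fin 3 → ℂ
  | 0, 2, 1 => 1
  | 2, 0, 1 => -1
  | 0, 1, 0 => -1
  | 2, 1, 2 => 1
  | 1, 0, 0 => 1
  | 1, 2, 2 => -1
  | _, _, _ => 0

/-- The unscaled spin matrices `S_+ = (S₁ + i S₂)/√2`, `S_z = S₃`, `S_- = (S₁ - i S₂)/√2` of the
spin-`s` representation, `s = N/2`, in the basis of eigenvectors of `S_z` with eigenvalues
`s, s - 1, …, -s`. -/
def spinMatrix (N : ℕ) : Fin 3 → Matrix (Fin (N + 1)) (Fin (N + 1)) ℂ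
  | 0 => Matrix.of fun a b => if (a : ℕ) + 1 = (b : ℕ)
      then ((Real.sqrt ((b : ℝ) * ((N : ℝ) + 1 - (b : ℝ)) / 2) : ℝ) : ℂ) else 0
  | 1 => Matrix.diagonal fun a => (N : ℂ) / 2 - ((a : ℕ) : ℂ)
  | 2 => Matrix.of fun a b => if (a : ℕ) = (b : ℕ) + 1
      then ((Real.sqrt ((a : ℝ) * ((N : ℝ) + 1 - (a : ℝ)) / 2) : ℝ) : ℂ) else 0

/-- The rescaled spin `Ŝ_i(x)`: the generator at the site `x`, multiplied by `h^d / s`. -/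
def spin {d N : ℕ} (h : ℝ) (i : Fin 3) (x : Site d) : quasiLocalAlgebra d N :=
  ((h ^ d / ((N : ℝ) / 2) : ℝ) : ℂ) • localObs {x}
    (Matrix.of fun a b =>
      spinMatrix N i (a ⟨x, Finset.mem_singleton_self x⟩) (b ⟨x, Finset.mem_singleton_self x⟩))

/-- The normal-ordered monomial `:Ŝ_{i_1}(x_1) ⋯ Ŝ_{i_p}(x_p):`: first all the factors with
index `+`, then those with index `z`, then those with index `-`. -/
def normalOrdered {d N p : ℕ} (h : ℝ) (i : Fin p → Fin 3) (x : Fin p → Site d) :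
    quasiLocalAlgebra d N :=
  ((List.finRange 3).map fun j =>
    (((List.finRange p).filter fun k => i k = j).map fun k => spin h j (x k)).prod).prod

/-! ### Smearing functions and quantization -/

/-- Families `f_{i_1 … i_p}(x_1, …, x_p)`. -/
abbrev Kernel (d p : ℕ) : Type := (Fin p → Fin 3) → (Fin p → E d) → ℂ

/-- The space `ℬ^(p)` of continuous kernels that are symmetric in their arguments. -/
structure IsSmearing {d p : ℕ} (f : Kernel d p) : Prop where
  continuous : ∀ i, Continuous (f i)
  symmetric : ∀ (σ : Equiv.Perm (Fin p)) (i : Fin p → Fin 3) (x : Fin p → E d),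
    f (i ∘ σ) (x ∘ σ) = f i x

/-- The space `ℬ_c^(p)` of compactly supported elements of `ℬ^(p)`. -/
structure IsCompactSmearing {d p : ℕ} (f : Kernel d p) : Prop extends IsSmearing f where
  compactSupport : ∀ i, HasCompactSupport (f i)

/-- The normal-ordered operator `:Ŝ_Λ(f):`. -/
def smearedSpinOn {d N p : ℕ} (h : ℝ) (Λ : Finset (Site d)) (f : Kernel d p) :
    quasiLocalAlgebra d N :=
  ∑ i : Fin p → Fin 3, ∑ x : Fin p → Λ,
    f i (fun k => latticePoint h (x k : Site d)) • normalOrdered h i (fun k => (x k : Site d))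

/-- The normal-ordered operator `:Ŝ(f):` of the whole lattice; for compactly supported `f` the sum
has only finitely many nonzero terms. -/
def smearedSpin {d N p : ℕ} (h : ℝ) (f : Kernel d p) : quasiLocalAlgebra d N :=
  ∑ i : Fin p → Fin 3, ∑' x : Fin p → Site d,
    f i (fun k => latticePoint h (x k)) • normalOrdered h i x

/-! ### Classical spins on the continuum -/

/-- The phase space `Ξ`: the closed unit ball of `L^∞(ℝ^d; ℝ³)`. -/
abbrev PhaseSpace (d : ℕ) : Type :=
  Metric.closedBall (0 : Lp (E 3) ∞ (volume : Measure (E d))) 1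

/-- The complex coordinates `M_+ = (M₁ + i M₂)/√2`, `M_z = M₃`, `M_- = (M₁ - i M₂)/√2`. -/
def coord (i : Fin 3) (v : E 3) : ℂ :=
  match i with
  | 0 => ((v 0 : ℂ) + Complex.I * (v 1 : ℂ)) / (Real.sqrt 2 : ℂ)
  | 1 => (v 2 : ℂ)
  | 2 => ((v 0 : ℂ) - Complex.I * (v 1 : ℂ)) / (Real.sqrt 2 : ℂ)

/-- The function `M(f)` on the phase space. -/
def smearedField {d p : ℕ} (f : Kernel d p) : PhaseSpace d → ℂ := fun M =>
  ∑ i : Fin p → Fin 3, ∫ x : Fin p → E d,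
    f i x * ∏ k, coord (i k) ((M : Lp (E 3) ∞ (volume : Measure (E d))) (x k))

/-- The algebra of functions on the phase space generated by the `M(f)` with compactly
supported `f`. -/
def polyAlgebra (d : ℕ) : Subalgebra ℂ (PhaseSpace d → ℂ) :=
  Algebra.adjoin ℂ
    {A | ∃ (p : ℕ) (f : Kernel d p), IsCompactSmearing f ∧ A = smearedField f}

/-- `Q` is the quantization of `A` (at every lattice spacing `h`): the map that is linear and sends
`M(f)` to `:Ŝ(f):`. The terms with `p = 0` are the constants. -/
def IsQuantization {d N : ℕ} (A : PhaseSpace d → ℂ) (Q : ℝ → quasiLocalAlgebra d N) : Prop :=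
  ∃ (P : ℕ) (f : (p : ℕ) → Kernel d p), (∀ p, IsCompactSmearing (f p)) ∧
    A = ∑ p ∈ Finset.range P, smearedField (f p) ∧
    ∀ h, Q h = ∑ p ∈ Finset.range P, smearedSpin h (f p)

/-! ### The interaction; `V n` is the kernel `V^(n+1)` of `n + 1` arguments -/

/-- The norm `‖f‖_{∞,1}^(h)`, the supremum being over the first lattice point. -/
def normInfOne {d n : ℕ} (h : ℝ) (f : Kernel d (n + 1)) : ℝ≥0∞ :=
  ⨆ k : Site d, ∑ i : Fin (n + 1) → Fin 3,
    ENNReal.ofReal (h ^ (n * d)) * ∑' y : Fin n → Site d,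
      ‖f i (fun j => latticePoint h ((Fin.cons k y : Fin (n + 1) → Site d) j))‖ₑ

/-- The norm `‖V‖^(h) = ∑_{n ≥ 1} n e^n ‖V^(n)‖_{∞,1}^(h)`. -/
def potentialNorm {d : ℕ} (h : ℝ) (V : (n : ℕ) → Kernel d (n + 1)) : ℝ≥0∞ :=
  ∑' n : ℕ, ENNReal.ofReal (((n : ℝ) + 1) * Real.exp ((n : ℝ) + 1)) * normInfOne h (V n)

/-- Real, finite-range interactions with `limsup_{h → 0} ‖V‖^(h) < ∞`. -/
structure IsPotential {d : ℕ} (V : (n : ℕ) → Kernel d (n + 1)) : Prop where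
  smearing : ∀ n, IsSmearing (V n)
  real : ∀ (n : ℕ) (i : Fin (n + 1) → Fin 3) (x : Fin (n + 1) → E d),
    (starRingEnd ℂ) (V n i x) = V n (fun k => (i k).rev) x
  norm_lt_top : limsup (fun h : ℝ => potentialNorm h V) (𝓝[>] 0) < ∞
  finiteRange : ∃ R : ℕ → ℝ, (∀ n, 0 < R n) ∧
    ∀ (n : ℕ) (x : Fin (n + 1) → E d), (∃ k l, R n < ‖x k - x l‖) → ∀ i, V n i x = 0

/-- The quantum Hamiltonian `Ĥ_Λ = ∑_n :Ŝ_Λ(V^(n)):`. -/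
def hamiltonian {d N : ℕ} (h : ℝ) (V : (n : ℕ) → Kernel d (n + 1)) (Λ : Finset (Site d)) :
    quasiLocalAlgebra d N :=
  ∑' n, smearedSpinOn h Λ (V n)

/-- The propagator `U_h(t; Ĥ_Λ) = exp (-i s h^{-d} t Ĥ_Λ)`, with `s = N/2`. -/
def propagator {d N : ℕ} (h : ℝ) (V : (n : ℕ) → Kernel d (n + 1)) (Λ : Finset (Site d)) (t : ℝ) :
    quasiLocalAlgebra d N :=
  NormedSpace.exp
    ((-(Complex.I * (((N : ℝ) / 2 * (h ^ d)⁻¹ * t : ℝ) : ℂ))) •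
      (hamiltonian h V Λ : quasiLocalAlgebra d N))

/-- The finite-volume dynamics `α̂_Λ^t a = U* a U`. -/
def localDynamics {d N : ℕ} (h : ℝ) (V : (n : ℕ) → Kernel d (n + 1)) (Λ : Finset (Site d))
    (t : ℝ) (a : quasiLocalAlgebra d N) : quasiLocalAlgebra d N :=
  star (propagator h V Λ t) * a * propagator h V Λ t

/-- The infinite-volume dynamics `α̂^t a = lim_{Λ → ∞} α̂_Λ^t a`, a limit in norm along the finite
sets of sites directed by inclusion. -/
def dynamics {d N : ℕ} (h : ℝ) (V : (n : ℕ) → Kernel d (n + 1)) (t : ℝ)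
    (a : quasiLocalAlgebra d N) : quasiLocalAlgebra d N :=
  limUnder atTop (fun Λ : Finset (Site d) => localDynamics h V Λ t a)

/-- The right-hand side of the continuum Landau–Lifshitz equation at the point `x`. -/
def llField {d : ℕ} (V : (n : ℕ) → Kernel d (n + 1)) (m : E d → E 3) (i : Fin 3) (x : E d) : ℂ :=
  Complex.I * ∑' n : ℕ, ((n : ℂ) + 1) * ∑ q : Fin (n + 1) → Fin 3, ∑ j : Fin 3,
    ∫ y : Fin n → E d, V n q (Fin.cons x y : Fin (n + 1) → E d) * epsT (q 0) i j *
      coord j (m x) * ∏ k : Fin n, coord (q k.succ) (m (y k))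

/-- `M ∈ C¹(ℝ, Ξ)` solves the continuum Landau–Lifshitz equation with initial condition `M₀`. -/
def IsLLSolution {d : ℕ} (V : (n : ℕ) → Kernel d (n + 1)) (M₀ : E d → E 3)
    (M : ℝ → PhaseSpace d) : Prop :=
  ((M 0 : Lp (E 3) ∞ (volume : Measure (E d))) : E d → E 3) =ᵐ[volume] M₀ ∧
  ∃ M' : ℝ → Lp (E 3) ∞ (volume : Measure (E d)), Continuous M' ∧
    ∀ t : ℝ, HasDerivAt (fun τ => (M τ : Lp (E 3) ∞ (volume : Measure (E d)))) (M' t) t ∧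
      ∀ᵐ x ∂(volume : Measure (E d)), ∀ i : Fin 3,
        coord i (M' t x) =
          llField V (M t : Lp (E 3) ∞ (volume : Measure (E d))) i x

/-! ### Coherent states -/

/-- `(θ/√2) (e^{iφ} S_- - e^{-iφ} S_+)`, where `θ, φ` are polar angles of the unit vector `m`. -/
def coherentGenerator (N : ℕ) (m : E 3) : Matrix (Fin (N + 1)) (Fin (N + 1)) ℂ :=
  ((Real.arccos (m 2) / Real.sqrt 2 : ℝ) : ℂ) •
    (Complex.exp (Complex.I * (Complex.arg ((m 0 : ℂ) + Complex.I * (m 1 : ℂ)) : ℂ)) •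
        spinMatrix N 2 -
      Complex.exp (-(Complex.I * (Complex.arg ((m 0 : ℂ) + Complex.I * (m 1 : ℂ)) : ℂ))) •
        spinMatrix N 0)

/-- The coherent spin state `|m⟩ ∈ ℂ^(N+1)`: the exponential of the generator, applied to the
highest-weight vector. -/
def coherentVector (N : ℕ) (m : E 3) : Fin (N + 1) → ℂ :=
  NormedSpace.exp (coherentGenerator N m) *ᵥ (Pi.single 0 1)

/-- The product vector `|M_Λ⟩ = ⨂_{x ∈ Λ} |M(x)⟩` in the product basis. -/
def productVector {d N : ℕ} (h : ℝ) (M₀ : E d → E 3) (Λ : Finset (Site d)) :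
    LocalConfig N Λ → ℂ :=
  fun b => ∏ x : Λ, coherentVector N (M₀ (latticePoint h (x : Site d))) (b x)

/-- The product vector, padded by the label `0` outside `Λ`. -/
def paddedVector {d N : ℕ} (u : Site d → Fin (N + 1) → ℂ) (Λ : Finset (Site d)) :
    SpinSpace d N :=
  open Classical in
  ∑ b : LocalConfig N Λ, (∏ x : Λ, u x (b x)) •
    lp.single 2 (Config.override (0 : Config d N) Λ b) (1 : ℂ)

theorem override_zero_injective {d N : ℕ} (Λ : Finset (Site d)) :
    Function.Injective (fun b : LocalConfig N Λ => Config.override (0 : Config d N) Λ b) := by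
  intro b b' hb
  funext x
  have := congrFun hb (x : Site d)
  simpa [Config.override] using this

theorem paddedVector_apply {d N : ℕ} (u : Site d → Fin (N + 1) → ℂ) (Λ : Finset (Site d))
    (b : LocalConfig N Λ) :
    paddedVector u Λ (Config.override (0 : Config d N) Λ b) = ∏ x : Λ, u x (b x) := by
  classical
  have h1 : ∀ b' : LocalConfig N Λ,
      (lp.single 2 (Config.override (0 : Config d N) Λ b') (1 : ℂ) : SpinSpace d N)
        (Config.override (0 : Config d N) Λ b) = if b = b' then 1 else 0 := by
    intro b'
    by_cases hb : b = b'
    · subst hb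
      simp
    · have : Config.override (0 : Config d N) Λ b ≠ Config.override (0 : Config d N) Λ b' :=
        fun h => hb (override_zero_injective Λ h)
      simp [hb, this]
  unfold paddedVector
  simp only [lp.coeFn_sum, Finset.sum_apply, lp.coeFn_smul, Pi.smul_apply, smul_eq_mul]
  rw [Finset.sum_eq_single b]
  · have h2 := h1 b
    rw [if_pos rfl] at h2
    have : (∏ x : Λ, u x (b x)) * 1 = ∏ x : Λ, u x (b x) := mul_one _
    rw [← h2] at this
    convert this
  · intro b' _ hb'
    have h2 := h1 b'
    rw [if_neg (Ne.symm hb')] at h2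
    have : (∏ x : Λ, u x (b' x)) * 0 = 0 := mul_zero _
    convert this
  · simp

theorem inner_paddedVector {d N : ℕ} (u : Site d → Fin (N + 1) → ℂ) (Λ : Finset (Site d))
    (φ : SpinSpace d N) :
    inner ℂ (paddedVector u Λ) φ =
      ∑ b : LocalConfig N Λ, star (∏ x : Λ, u x (b x)) *
        φ (Config.override (0 : Config d N) Λ b) := by
  classical
  unfold paddedVector
  rw [sum_inner]
  refine Finset.sum_congr rfl fun b _ => ?_
  rw [inner_smul_left]
  have := lp.inner_single_left (𝕜 := ℂ) (Config.override (0 : Config d N) Λ b) (1 : ℂ) φ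
  have h2 : inner ℂ (1 : ℂ) (φ (Config.override (0 : Config d N) Λ b)) =
    φ (Config.override (0 : Config d N) Λ b) := by simp
  rw [h2] at this
  change star (∏ x : Λ, u x (b x)) * _ = _
  convert congrArg (fun z => star (∏ x : Λ, u x (b x)) * z) this

theorem prod_split {d N : ℕ} (u : Site d → Fin (N + 1) → ℂ) {Λ Λ' : Finset (Site d)}
    (hΛ : Λ ⊆ Λ') (b : LocalConfig N Λ') :
    ∏ x : Λ', u x (b x) =
      (∏ x : Λ, u x (b ⟨x, hΛ x.2⟩)) *
        ∏ x : (Λ' \ Λ : Finset (Site d)), u x (b ⟨x, (Finset.mem_sdiff.1 x.2).1⟩) := by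
  classical
  let g : Site d → ℂ := fun x => if hx : x ∈ Λ' then u x (b ⟨x, hx⟩) else 1
  have h1 : ∏ x : Λ', u x (b x) = ∏ x ∈ Λ', g x := by
    refine Eq.trans ?_ (Finset.prod_coe_sort Λ' g)
    exact Finset.prod_congr rfl fun x _ => by simp [g]
  have h2 : ∏ x : Λ, u x (b ⟨x, hΛ x.2⟩) = ∏ x ∈ Λ, g x := by
    refine Eq.trans ?_ (Finset.prod_coe_sort Λ g)
    exact Finset.prod_congr rfl fun x _ => by simp [g, hΛ x.2]
  have h3 : ∏ x : (Λ' \ Λ : Finset (Site d)), u x (b ⟨x, (Finset.mem_sdiff.1 x.2).1⟩) =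
      ∏ x ∈ Λ' \ Λ, g x := by
    refine Eq.trans ?_ (Finset.prod_coe_sort (Λ' \ Λ) g)
    exact Finset.prod_congr rfl fun x _ => by simp [g, (Finset.mem_sdiff.1 x.2).1]
  rw [h1, h2, h3, mul_comm, Finset.prod_sdiff hΛ]

/-- Configurations of `Λ'` are pairs of configurations of `Λ` and of `Λ' \ Λ`. -/
def splitEquiv {d : ℕ} (N : ℕ) {Λ Λ' : Finset (Site d)} (hΛ : Λ ⊆ Λ') :
    LocalConfig N Λ' ≃ LocalConfig N Λ × LocalConfig N (Λ' \ Λ) where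
  toFun b := (fun x => b ⟨x, hΛ x.2⟩, fun x => b ⟨x, (Finset.mem_sdiff.1 x.2).1⟩)
  invFun q := fun x => if hx : (x : Site d) ∈ Λ then q.1 ⟨x, hx⟩
    else q.2 ⟨x, Finset.mem_sdiff.2 ⟨x.2, hx⟩⟩
  left_inv b := by
    funext x
    by_cases hx : (x : Site d) ∈ Λ <;> simp [hx]
  right_inv q := by
    apply Prod.ext
    · funext x
      simp
    · funext x
      have := (Finset.mem_sdiff.1 x.2).2
      simp [this]

theorem override_override {d N : ℕ} {Λ Λ' : Finset (Site d)} (hΛ : Λ ⊆ Λ')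
    (a e : LocalConfig N Λ) (r : LocalConfig N (Λ' \ Λ)) :
    (Config.override (0 : Config d N) Λ' ((splitEquiv N hΛ).symm (a, r))).override Λ e =
      Config.override (0 : Config d N) Λ' ((splitEquiv N hΛ).symm (e, r)) := by
  funext x
  by_cases hx : x ∈ Λ
  · simp [Config.override, splitEquiv, hx, hΛ hx]
  · by_cases hx' : x ∈ Λ' <;> simp [Config.override, splitEquiv, hx, hx']

theorem inner_localOp {d N : ℕ} (u : Site d → Fin (N + 1) → ℂ)
    (hu : ∀ x, ∑ j, star (u x j) * u x j = 1) {Λ Λ' : Finset (Site d)} (hΛ : Λ ⊆ Λ')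
    (T : Matrix (LocalConfig N Λ) (LocalConfig N Λ) ℂ) :
    inner ℂ (paddedVector u Λ') (localOp Λ T (paddedVector u Λ')) =
      star (fun b : LocalConfig N Λ => ∏ x : Λ, u x (b x)) ⬝ᵥ
        (T *ᵥ fun b : LocalConfig N Λ => ∏ x : Λ, u x (b x)) := by
  classical
  have hprod : ∀ (a : LocalConfig N Λ) (r : LocalConfig N (Λ' \ Λ)),
      ∏ x : Λ', u x ((splitEquiv N hΛ).symm (a, r) x) =
        (∏ x : Λ, u x (a x)) * ∏ x : (Λ' \ Λ : Finset (Site d)), u x (r x) := by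
    intro a r
    rw [prod_split u hΛ]
    congr 1
    · exact Finset.prod_congr rfl fun x _ => by simp [splitEquiv]
    · refine Finset.prod_congr rfl fun x _ => ?_
      have := (Finset.mem_sdiff.1 x.2).2
      simp [splitEquiv, this]
  have hone : ∑ r : LocalConfig N (Λ' \ Λ),
      (star (∏ x : (Λ' \ Λ : Finset (Site d)), u x (r x))) *
        ∏ x : (Λ' \ Λ : Finset (Site d)), u x (r x) = 1 := by
    have : ∀ r : LocalConfig N (Λ' \ Λ),
        (star (∏ x : (Λ' \ Λ : Finset (Site d)), u x (r x))) *
          ∏ x : (Λ' \ Λ : Finset (Site d)), u x (r x) =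
        ∏ x : (Λ' \ Λ : Finset (Site d)), star (u x (r x)) * u x (r x) := by
      intro r
      rw [star_prod, Finset.prod_mul_distrib]
    simp only [this]
    rw [← Fintype.prod_sum (fun (x : (Λ' \ Λ : Finset (Site d))) j => star (u x j) * u x j)]
    exact Finset.prod_eq_one fun x _ => hu x
  have hrestr : ∀ (a : LocalConfig N Λ) (r : LocalConfig N (Λ' \ Λ)),
      (Config.override (0 : Config d N) Λ' ((splitEquiv N hΛ).symm (a, r))).restrict Λ = a := by
    intro a r
    funext x
    simp [Config.restrict, Config.override, splitEquiv, hΛ x.2]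
  rw [inner_paddedVector, ← (splitEquiv N hΛ).symm.sum_comp, Fintype.sum_prod_type]
  have hmain : ∀ (a : LocalConfig N Λ) (r : LocalConfig N (Λ' \ Λ)),
      star (∏ x : Λ', u x ((splitEquiv N hΛ).symm (a, r) x)) *
        localOp Λ T (paddedVector u Λ')
          (Config.override (0 : Config d N) Λ' ((splitEquiv N hΛ).symm (a, r))) =
      (star (∏ x : Λ, u x (a x)) * ∑ e, T a e * ∏ x : Λ, u x (e x)) *
        ((star (∏ x : (Λ' \ Λ : Finset (Site d)), u x (r x))) *
          ∏ x : (Λ' \ Λ : Finset (Site d)), u x (r x)) := by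
    intro a r
    rw [localOp_apply]
    simp only [hrestr, override_override, paddedVector_apply, hprod]
    rw [star_mul']
    have : ∑ e, T a e * ((∏ x : Λ, u x (e x)) *
        ∏ x : (Λ' \ Λ : Finset (Site d)), u x (r x)) =
        (∑ e, T a e * ∏ x : Λ, u x (e x)) *
          ∏ x : (Λ' \ Λ : Finset (Site d)), u x (r x) := by
      rw [Finset.sum_mul]
      exact Finset.sum_congr rfl fun e _ => by ring
    rw [this]
    ring
  simp only [hmain, ← Finset.mul_sum, hone, mul_one]
  rfl

theorem norm_paddedVector {d N : ℕ} (u : Site d → Fin (N + 1) → ℂ)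
    (hu : ∀ x, ∑ j, star (u x j) * u x j = 1) (Λ : Finset (Site d)) :
    ‖paddedVector u Λ‖ = 1 := by
  classical
  have h1 := inner_localOp u hu (Finset.empty_subset Λ) (1 : Matrix _ _ ℂ)
  have h2 : localOp (∅ : Finset (Site d)) (1 : Matrix _ _ ℂ) (paddedVector u Λ) =
      paddedVector u Λ := by
    apply Subtype.ext
    funext c
    rw [localOp_apply]
    have : ∀ b : LocalConfig N (∅ : Finset (Site d)), c.override ∅ b = c := by
      intro b
      funext x
      simp [Config.override]
    rw [Fintype.sum_eq_single (c.restrict ∅)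
      (fun b hb => absurd (Subsingleton.elim _ _) hb), Matrix.one_apply_eq, one_mul, this]
  rw [h2] at h1
  rw [inner_self_eq_norm_sq_to_K] at h1
  simp [dotProduct] at h1
  have h4 := norm_nonneg (paddedVector u Λ)
  rcases h1 with h1 | h1
  · exact_mod_cast h1
  · have h3 : ‖paddedVector u Λ‖ = -1 := by exact_mod_cast h1
    linarith

theorem exists_state {d N : ℕ} (u : Site d → Fin (N + 1) → ℂ)
    (hu : ∀ x, ∑ j, star (u x j) * u x j = 1) :
    ∃ ρ : quasiLocalAlgebra d N →L[ℂ] ℂ,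
      ∀ (Λ : Finset (Site d)) (T : Matrix (LocalConfig N Λ) (LocalConfig N Λ) ℂ),
        ρ (localObs Λ T) = star (fun b : LocalConfig N Λ => ∏ x : Λ, u x (b x)) ⬝ᵥ
          (T *ᵥ fun b : LocalConfig N Λ => ∏ x : Λ, u x (b x)) := by
  let F : Ultrafilter (Finset (Site d)) := Ultrafilter.of atTop
  let e : (SpinSpace d N →L[ℂ] SpinSpace d N) → Finset (Site d) → ℂ := fun a Λ =>
    inner ℂ (paddedVector u Λ) (a (paddedVector u Λ))
  have hb : ∀ a Λ, ‖e a Λ‖ ≤ ‖a‖ := by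
    intro a Λ
    refine (norm_inner_le_norm _ _).trans ?_
    rw [norm_paddedVector u hu, one_mul]
    refine (a.le_opNorm _).trans ?_
    rw [norm_paddedVector u hu, mul_one]
  have hlim : ∀ a, ∃ z : ℂ, Tendsto (e a) F (𝓝 z) := by
    intro a
    have hK : IsCompact (Metric.closedBall (0 : ℂ) ‖a‖) := isCompact_closedBall _ _
    obtain ⟨z, _, hz⟩ := hK.ultrafilter_le_nhds (F.map (e a)) (by
      rw [Filter.le_principal_iff]
      change ∀ᶠ Λ in (F : Filter (Finset (Site d))), e a Λ ∈ Metric.closedBall (0 : ℂ) ‖a‖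
      exact Filter.Eventually.of_forall fun Λ => by simpa using hb a Λ)
    exact ⟨z, hz⟩
  choose z hz using hlim
  let L : quasiLocalAlgebra d N →ₗ[ℂ] ℂ :=
    { toFun := fun a => z a
      map_add' := by
        intro a b
        refine tendsto_nhds_unique (hz _) ?_
        have := (hz a).add (hz b)
        refine this.congr fun Λ => ?_
        simp [e]
      map_smul' := by
        intro c a
        refine tendsto_nhds_unique (hz _) ?_
        have := (hz a).const_mul c
        refine this.congr fun Λ => ?_
        simp [e] }
  refine ⟨L.mkContinuous 1 ?_, ?_⟩
  · intro a
    rw [one_mul]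
    exact le_of_tendsto (hz a).norm (Filter.Eventually.of_forall fun Λ => hb a Λ)
  · intro Λ T
    change z (localOp Λ T) = _
    refine tendsto_nhds_unique (hz _) ?_
    refine tendsto_const_nhds.congr' ?_
    have h1 : ∀ᶠ Λ' in (F : Filter (Finset (Site d))), Λ ≤ Λ' :=
      (Ultrafilter.of_le atTop) (eventually_ge_atTop Λ)
    filter_upwards [h1] with Λ' hΛ'
    exact (inner_localOp u hu hΛ' T).symm

theorem spinMatrix_zero_conjTranspose (N : ℕ) : (spinMatrix N 0)ᴴ = spinMatrix N 2 := by
  ext a b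
  by_cases h : (a : ℕ) = (b : ℕ) + 1
  · simp [spinMatrix, Matrix.conjTranspose_apply, h]
  · have h' : ¬ (b : ℕ) + 1 = (a : ℕ) := fun h'' => h h''.symm
    simp [spinMatrix, Matrix.conjTranspose_apply, h, h']

theorem coherentGenerator_conjTranspose (N : ℕ) (m : E 3) :
    (coherentGenerator N m)ᴴ = -coherentGenerator N m := by
  have h2 : (spinMatrix N 2)ᴴ = spinMatrix N 0 := by
    rw [← spinMatrix_zero_conjTranspose, Matrix.conjTranspose_conjTranspose]
  unfold coherentGenerator
  rw [Matrix.conjTranspose_smul, Matrix.conjTranspose_sub, Matrix.conjTranspose_smul,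
    Matrix.conjTranspose_smul, h2, spinMatrix_zero_conjTranspose]
  simp only [Complex.star_def, Complex.conj_ofReal, ← Complex.exp_conj, map_neg, map_mul,
    Complex.conj_I, neg_mul, neg_neg]
  rw [← smul_neg, neg_sub]

theorem coherentVector_unit (N : ℕ) (m : E 3) :
    ∑ j, star (coherentVector N m j) * coherentVector N m j = 1 := by
  have h1 : (NormedSpace.exp (coherentGenerator N m))ᴴ *
      NormedSpace.exp (coherentGenerator N m) = 1 := by
    rw [← Matrix.exp_conjTranspose, coherentGenerator_conjTranspose, Matrix.exp_neg]
    exact Matrix.nonsing_inv_mul _ ((Matrix.isUnit_iff_isUnit_det _).1 (Matrix.isUnit_exp _))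
  change star (coherentVector N m) ⬝ᵥ coherentVector N m = 1
  unfold coherentVector
  rw [Matrix.star_mulVec, Matrix.dotProduct_mulVec, Matrix.vecMul_vecMul, h1, Matrix.vecMul_one]
  simp

theorem exists_productState {d N : ℕ} (h : ℝ) (M₀ : E d → E 3) :
    ∃ ρ : quasiLocalAlgebra d N →L[ℂ] ℂ,
      ∀ (Λ : Finset (Site d)) (T : Matrix (LocalConfig N Λ) (LocalConfig N Λ) ℂ),
        ρ (localObs Λ T) =
          star (productVector h M₀ Λ) ⬝ᵥ (T *ᵥ productVector h M₀ Λ) :=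
  exists_state (fun x => coherentVector N (M₀ (latticePoint h x)))
    (fun x => coherentVector_unit N (M₀ (latticePoint h x)))

/-- The product state `ρ_M` on the quasi-local algebra: the continuous linear functional with
`ρ_M(𝒜) = ⟨M_Λ, 𝒜 M_Λ⟩` for every operator `𝒜` of a finite set `Λ` of sites. By density there is
only one. -/
def productState {d N : ℕ} (h : ℝ) (M₀ : E d → E 3) : quasiLocalAlgebra d N →L[ℂ] ℂ :=
  Classical.choose (exists_productState h M₀)

theorem productState_localObs {d N : ℕ} (h : ℝ) (M₀ : E d → E 3) (Λ : Finset (Site d))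
    (T : Matrix (LocalConfig N Λ) (LocalConfig N Λ) ℂ) :
    productState h M₀ (localObs Λ T) =
      star (productVector h M₀ Λ) ⬝ᵥ (T *ᵥ productVector h M₀ Λ) :=
  Classical.choose_spec (exists_productState h M₀) Λ T

end SpinLattice

end

open SpinLattice

/-! The quantum and the classical evolution solve the same linear hierarchy of equations, so it is
enough to compare their initial data. The unknowns are indexed by `Obs`: smeared monomials with one
index and one kernel component, in any fixed order of the factors. By the Leibniz rule, the
commutator of the (n+1)-body interaction with a monomial of degree p is a finite sum of monomials of
degree p + n, its children: one spin of the monomial and one spin of the interaction are contracted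
through ε̃ (`interaction_commutator_prod`, `Obs.ad_quant`). The factor s h^{-d} in the generator
cancels the factor h^d/s in the spin commutator, so the kernels of the children do not depend on h.
Along a Landau–Lifshitz solution the classical value of a monomial has as derivative the sum of the
classical values of the very same children (`Obs.hasDerivAt_val`).

The initial data agree in the limit by `Obs.tendsto_productState_quant`. At pairwise distinct sites
the product state factorizes, each factor is a component of the unit vector
(`coherentVector_expectation`), and what remains is a Riemann sum (`tendsto_lattice_sum`). Tuples
with coinciding sites fill a null set in the limit. Hence the order of the factors is invisible
classically, and the children never have to be brought back into normal order.

The hierarchy does not close, because degrees grow. `hierarchy_tendsto_zero` handles this. Iterating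
the equation gains a factor 1/2 per iteration on a time step whose length does not depend on the
observable. The a priori bounds (unitarity on one side, `‖M t‖ ≤ 1` on the other) hold at all times,
so the step can be repeated. The required growth bound is `Obs.sum_latNorm_child_le`, and
`summable_growth` says that the weight e^n in the norm of the interaction beats the factor √2 lost
with each new spin.

This lemma is used twice: for the difference of the dynamics of two volumes, which gives the
infinite-volume dynamics (`cauchy_localDynamics`), and for the difference between a finite-volume
expectation and the classical value, with h → 0 and Λ → ∞ at each h (`eventually_finite_volume`). On
the algebraic side, products of smeared fields are again smeared fields, so every element of the
algebra has a quantization (`exists_kernels`). -/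

/-! ### Propagation of smallness through a hierarchy of differential equations -/

/-- The mean value inequality with a majorant, run forward from the edge `T` of an interval that is
already controlled; negative times follow by the reflection t ↦ -t. -/
theorem norm_le_of_hasDerivAt_of_abs_le {X : Type*} [NormedAddCommGroup X] [NormedSpace ℝ X]
    {f f' : ℝ → X} (hf : ∀ t, HasDerivAt f (f' t) t) {T t₀ : ℝ} (hT : 0 ≤ T)
    {b b' : ℝ → ℝ} (hb : ∀ s, HasDerivAt b (b' s) s) (hb' : ∀ s, 0 ≤ b' s)
    (h0 : ∀ t, |t| ≤ T → ‖f t‖ ≤ b 0)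
    (h1 : ∀ s, 0 ≤ s → s ≤ t₀ → ∀ t, |t| ≤ T + s → ‖f' t‖ ≤ b' s) :
    ∀ s, 0 ≤ s → s ≤ t₀ → ∀ t, |t| ≤ T + s → ‖f t‖ ≤ b s := by
  have hmono : Monotone b := monotone_of_deriv_nonneg (fun s => (hb s).differentiableAt)
    (fun s => by rw [(hb s).deriv]; exact hb' s)
  have key : ∀ (g g' : ℝ → X), (∀ t, HasDerivAt g (g' t) t) → (∀ t, |t| ≤ T → ‖g t‖ ≤ b 0) →
      (∀ s, 0 ≤ s → s ≤ t₀ → ∀ t, |t| ≤ T + s → ‖g' t‖ ≤ b' s) →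
      ∀ s, 0 ≤ s → s ≤ t₀ → ‖g (T + s)‖ ≤ b s := by
    intro g g' hg hg0 hg1 s hs hs'
    have hder : ∀ u, HasDerivAt (fun u => g (T + u)) (g' (T + u)) u := fun u =>
      (hg (T + u)).comp_const_add T u
    refine image_norm_le_of_norm_deriv_right_le_deriv_boundary (a := 0) (b := s)
      (f := fun u => g (T + u)) (f' := fun u => g' (T + u)) (B := b) (B' := b')
      (fun u _ => (hder u).continuousAt.continuousWithinAt)
      (fun u _ => (hder u).hasDerivWithinAt) ?_ hb ?_ ⟨hs, le_rfl⟩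
    · simpa using hg0 T (abs_of_nonneg hT).le
    · intro u hu
      exact hg1 u hu.1 (hu.2.le.trans hs') _ (abs_of_nonneg (by linarith [hu.1])).le
  intro s hs hs' t ht
  by_cases htT : |t| ≤ T
  · exact (h0 t htT).trans (hmono hs)
  push Not at htT
  rcases le_total 0 t with h | h
  · rw [abs_of_nonneg h] at ht htT
    have := key f f' hf h0 h1 (t - T) (by linarith) (by linarith)
    rw [add_sub_cancel] at this
    exact this.trans (hmono (by linarith))
  · rw [abs_of_nonpos h] at ht htT
    have := key (fun t => f (-t)) (fun t => -f' (-t))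
      (fun t => by
        have := (hf (-t)).scomp t (hasDerivAt_neg t)
        rw [neg_one_smul] at this
        exact this)
      (fun t ht => h0 _ (by rwa [abs_neg]))
      (fun s hs hs' t ht => by rw [norm_neg]; exact h1 s hs hs' _ (by rwa [abs_neg]))
      (-t - T) (by linarith) (by linarith)
    simp only [add_sub_cancel, neg_neg] at this
    exact this.trans (hmono (by linarith))

/-- A hierarchy of evolution equations `e' = ∑ₙ Dₙ`, in which each `Dₙ` becomes a sum of
quantities of the same hierarchy of degree raised by `n`, propagates convergence to zero. -/
theorem hierarchy_tendsto_zero {ι O X : Type*} [NormedAddCommGroup X] [NormedSpace ℝ X]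
    (l : Filter ι) (deg : O → ℕ) (Idx : O → ℕ → Type) [∀ f n, Fintype (Idx f n)]
    (child : (f : O) → (n : ℕ) → Idx f n → O) (hdeg : ∀ f n b, deg (child f n b) = deg f + n)
    (e : ι → ℝ → O → X) (D : ι → ℝ → O → ℕ → X) (ν : ι → O → ℝ) (B : ℕ → ℝ) (lam : ℝ)
    (hlam : 0 < lam) (hB : ∀ n, 0 ≤ B n) (hBs : Summable fun n => B n * Real.exp (lam * n))
    (hν : ∀ᶠ a in l, ∀ f, 0 ≤ ν a f)
    (hbound : ∀ᶠ a in l, ∀ f t, ‖e a t f‖ ≤ ν a f)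
    (hchild : ∀ᶠ a in l, ∀ f n, ∑ b, ν a (child f n b) ≤ deg f * B n * ν a f)
    (hD : ∀ᶠ a in l, ∀ f n t, ‖D a t f n‖ ≤ deg f * B n * ν a f)
    (hderiv : ∀ᶠ a in l, ∀ f t, HasDerivAt (fun t => e a t f) (∑' n, D a t f n) t)
    (hDe : ∀ f n, ∀ᶠ a in l, ∀ t, D a t f n = ∑ b, e a t (child f n b))
    (hνb : ∀ f, ∃ C, ∀ᶠ a in l, ν a f ≤ C)
    (h0 : ∀ f, Tendsto (fun a => e a 0 f) l (𝓝 0)) :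
    ∀ T, ∀ f, ∀ ε > 0, ∀ᶠ a in l, ∀ t, |t| ≤ T → ‖e a t f‖ ≤ ε := by
  have hexp1 : ∀ n : ℕ, 1 ≤ Real.exp (lam * n) := fun n => Real.one_le_exp (by positivity)
  have hBsum : Summable B := Summable.of_nonneg_of_le hB
    (fun n => le_mul_of_one_le_right (hB n) (hexp1 n)) hBs
  set β := ∑' n, B n * Real.exp (lam * n) with hβ
  have hβ0 : 0 ≤ β := tsum_nonneg fun n => mul_nonneg (hB n) (Real.exp_pos _).le
  -- The step length depends on `lam` and `β` only, not on the observable or on the time already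
  -- reached. The `+ 1` keeps it finite when `β = 0`.
  set t₀ : ℝ := (lam / 2) / (2 * β + 1) with ht₀
  have ht₀pos : 0 < t₀ := by positivity
  -- The rate of this weight rises from `lam / 2` to `lam` during the step. It never exceeds `lam`,
  -- so raising the degree by `n` costs at most `exp (lam * n)`, which is summable against `B`. Its
  -- growth in `s` produces the factor `p` that absorbs `deg f` in the equation.
  let w : ℕ → ℝ → ℝ := fun p s => Real.exp (p * (lam / 2) * (1 + s / t₀))
  have hw0 : ∀ p s, 0 < w p s := fun p s => Real.exp_pos _
  have hw1 : ∀ p s, 0 ≤ s → 1 ≤ w p s := fun p s hs => Real.one_le_exp (by positivity)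
  have hwadd : ∀ p n s, s ≤ t₀ → w (p + n) s ≤ w p s * Real.exp (lam * n) := by
    intro p n s hs
    simp only [w]
    rw [← Real.exp_add, Real.exp_le_exp]
    have h1 : s / t₀ ≤ 1 := (div_le_one ht₀pos).2 hs
    push_cast
    nlinarith [mul_nonneg (mul_nonneg (Nat.cast_nonneg (α := ℝ) n) hlam.le) (sub_nonneg.2 h1)]
  have hwderiv : ∀ p s, HasDerivAt (w p) (p * (2 * β + 1) * w p s) s := by
    intro p s
    have h1 : HasDerivAt (fun s : ℝ => (p : ℝ) * (lam / 2) * (1 + s / t₀))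
        (p * (lam / 2) * (1 / t₀)) s :=
      (((hasDerivAt_id s).div_const t₀).const_add 1).const_mul _
    convert h1.exp using 1
    rw [mul_comm]
    simp only [w]
    congr 1
    rw [ht₀]
    field_simp
  have step : ∀ T, 0 ≤ T → (∀ f, ∀ ε > 0, ∀ᶠ a in l, ∀ t, |t| ≤ T → ‖e a t f‖ ≤ ε) →
      (∀ f, ∀ ε > 0, ∀ᶠ a in l, ∀ t, |t| ≤ T + t₀ → ‖e a t f‖ ≤ ε) := by
    intro T hT hA
    -- The a priori bound is the case `j = 0`; each use of the evolution equation halves the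
    -- constant in front of it, at the price of an arbitrarily small error.
    have claim : ∀ j : ℕ, ∀ f, ∀ ε > 0, ∀ᶠ a in l, ∀ s, 0 ≤ s → s ≤ t₀ → ∀ t, |t| ≤ T + s →
        ‖e a t f‖ ≤ ε + (1 / 2) ^ j * w (deg f) s * ν a f := by
      intro j
      induction j with
      | zero =>
        intro f ε hε
        filter_upwards [hν, hbound] with a ha hb s hs _ t _
        have := mul_le_mul_of_nonneg_right (hw1 (deg f) s hs) (ha f)
        have h3 := hb f t
        simp only [pow_zero, one_mul] at this ⊢
        linarith
      | succ j ih =>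
        intro f ε hε
        obtain ⟨C, hC⟩ := hνb f
        -- An error rate of `ε'` accumulates at most `ε / 2` over the step; the other half of `ε` is
        -- the initial value on `|t| ≤ T`.
        set ε' := ε / (2 * t₀) with hε'
        have hε'0 : 0 < ε' := by positivity
        -- The induction hypothesis enters for one `n` at a time, because the identity `hDe` holds
        -- from a point of the filter on that may depend on `n`.
        have hDn : ∀ n, ∀ δ > 0, ∀ᶠ a in l, ∀ s, 0 ≤ s → s ≤ t₀ → ∀ t, |t| ≤ T + s →
            ‖D a t f n‖ ≤ δ + (1 / 2) ^ j * w (deg f + n) s * (deg f * B n * ν a f) := by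
          intro n δ hδ
          have h1 : ∀ᶠ a in l, ∀ b : Idx f n, ∀ s, 0 ≤ s → s ≤ t₀ → ∀ t, |t| ≤ T + s →
              ‖e a t (child f n b)‖ ≤ δ / (Fintype.card (Idx f n) + 1) +
                (1 / 2) ^ j * w (deg (child f n b)) s * ν a (child f n b) :=
            Filter.eventually_all.2 fun b => ih _ _ (by positivity)
          filter_upwards [h1, hDe f n, hchild] with a h1 h2 h3 s hs hs' t ht
          rw [h2]
          calc ‖∑ b, e a t (child f n b)‖
              ≤ ∑ b, (δ / (Fintype.card (Idx f n) + 1) +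
                (1 / 2) ^ j * w (deg f + n) s * ν a (child f n b)) := by
                refine norm_sum_le_of_le _ fun b _ => ?_
                have := h1 b s hs hs' t ht
                rwa [hdeg] at this
            _ = Fintype.card (Idx f n) * (δ / (Fintype.card (Idx f n) + 1)) +
                (1 / 2) ^ j * w (deg f + n) s * ∑ b, ν a (child f n b) := by
                rw [Finset.sum_add_distrib, ← Finset.mul_sum]
                simp
            _ ≤ _ := by
                refine add_le_add ?_ (mul_le_mul_of_nonneg_left (h3 f n) ?_)
                · rw [mul_div_assoc', div_le_iff₀ (by positivity)]
                  nlinarith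
                · have := hw0 (deg f + n) s
                  positivity
        -- The tail `n ≥ m` is estimated by `hD` alone, so only finitely many of the non-uniform
        -- statements `hDn` have to hold simultaneously.
        obtain ⟨m, hm⟩ : ∃ m : ℕ, deg f * (∑' n, B (n + m)) * (|C| + 1) ≤ ε' / 2 := by
          have h1 : Tendsto (fun m : ℕ => deg f * (∑' n, B (n + m)) * (|C| + 1)) atTop
              (𝓝 (deg f * 0 * (|C| + 1))) :=
            ((tendsto_sum_nat_add B).const_mul _).mul_const _
          rw [mul_zero, zero_mul] at h1
          exact (h1.eventually (eventually_le_nhds (by positivity))).exists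
        have hfin : ∀ᶠ a in l, ∀ n ∈ Finset.range m, ∀ s, 0 ≤ s → s ≤ t₀ → ∀ t, |t| ≤ T + s →
            ‖D a t f n‖ ≤ ε' / (2 * (m + 1)) +
              (1 / 2) ^ j * w (deg f + n) s * (deg f * B n * ν a f) :=
          (Filter.eventually_all_finset _).2 fun n _ => hDn n _ (by positivity)
        filter_upwards [hfin, hA f (ε / 2) (by positivity), hC, hν, hD, hderiv] with
          a hfin hA hC hν hD hderiv
        have hsumD : ∀ t, Summable fun n => ‖D a t f n‖ := fun t =>
          Summable.of_nonneg_of_le (fun _ => norm_nonneg _) (fun n => hD f n t)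
            ((hBsum.mul_left _).mul_right _)
        have hDle : ∀ s, 0 ≤ s → s ≤ t₀ → ∀ t, |t| ≤ T + s →
            ‖∑' n, D a t f n‖ ≤ ε' +
              (1 / 2) ^ (j + 1) * (deg f * (2 * β + 1) * w (deg f) s) * ν a f := by
          intro s hs hs' t ht
          have h1 : ∑' n, ‖D a t f (n + m)‖ ≤ ε' / 2 := by
            calc ∑' n, ‖D a t f (n + m)‖ ≤ ∑' n, deg f * B (n + m) * ν a f := by
                  refine Summable.tsum_le_tsum (fun n => hD f _ t)
                    ((summable_nat_add_iff m).2 (hsumD t)) ?_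
                  exact (((summable_nat_add_iff m).2 hBsum).mul_left _).mul_right _
              _ = deg f * (∑' n, B (n + m)) * ν a f := by rw [tsum_mul_right, tsum_mul_left]
              _ ≤ deg f * (∑' n, B (n + m)) * (|C| + 1) := by
                  refine mul_le_mul_of_nonneg_left ?_
                    (mul_nonneg (Nat.cast_nonneg _) (tsum_nonneg fun n => hB _))
                  linarith [le_abs_self C]
              _ ≤ _ := hm
          have h2 : ∑ n ∈ Finset.range m, ‖D a t f n‖ ≤ ε' / 2 +
              (1 / 2) ^ j * (deg f * w (deg f) s * ν a f) * β := by
            calc ∑ n ∈ Finset.range m, ‖D a t f n‖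
                ≤ ∑ n ∈ Finset.range m, (ε' / (2 * (m + 1)) +
                    (1 / 2) ^ j * (deg f * w (deg f) s * ν a f) *
                      (B n * Real.exp (lam * n))) := by
                  refine Finset.sum_le_sum fun n hn => (hfin n hn s hs hs' t ht).trans ?_
                  refine add_le_add le_rfl ?_
                  have h3 := hwadd (deg f) n s hs'
                  have h4 : 0 ≤ (1 / 2 : ℝ) ^ j * (deg f * B n * ν a f) := by
                    have := hB n
                    have := hν f
                    positivity
                  calc _ = w (deg f + n) s * ((1 / 2 : ℝ) ^ j * (deg f * B n * ν a f)) := by ring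
                    _ ≤ _ := mul_le_mul_of_nonneg_right h3 h4
                    _ = _ := by ring
              _ = m * (ε' / (2 * (m + 1))) + (1 / 2) ^ j * (deg f * w (deg f) s * ν a f) *
                    ∑ n ∈ Finset.range m, (B n * Real.exp (lam * n)) := by
                  rw [Finset.sum_add_distrib, ← Finset.mul_sum]
                  simp
              _ ≤ _ := by
                  refine add_le_add ?_ (mul_le_mul_of_nonneg_left ?_ ?_)
                  · rw [mul_div_assoc', div_le_div_iff₀ (by positivity) (by positivity)]
                    nlinarith
                  · exact hBs.sum_le_tsum _ fun n _ => mul_nonneg (hB n) (Real.exp_pos _).le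
                  · have := hw0 (deg f) s
                    have := hν f
                    positivity
          have h3 : ‖∑' n, D a t f n‖ ≤ ∑' n, ‖D a t f n‖ := norm_tsum_le_tsum_norm (hsumD t)
          rw [← (hsumD t).sum_add_tsum_nat_add m] at h3
          have h4 : 0 ≤ (1 / 2 : ℝ) ^ j * (deg f * w (deg f) s * ν a f) := by
            have := hw0 (deg f) s
            have := hν f
            positivity
          -- Here the factor 1/2 is gained: `(1/2)^j * β` is at most `(1/2)^(j+1) * (2 * β + 1)`,
          -- and the latter is what the derivative of the weight provides.
          rw [pow_succ]
          nlinarith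
        have hmain := norm_le_of_hasDerivAt_of_abs_le (f := fun t => e a t f)
          (f' := fun t => ∑' n, D a t f n) (hderiv f) (T := T) (t₀ := t₀) hT
          (b := fun s => ε / 2 + ε' * s + (1 / 2) ^ (j + 1) * w (deg f) s * ν a f)
          (b' := fun s => ε' + (1 / 2) ^ (j + 1) * (deg f * (2 * β + 1) * w (deg f) s) * ν a f)
          (fun s => by
            have h1 := (((hasDerivAt_id s).const_mul ε').const_add (ε / 2)).add
              (((hwderiv (deg f) s).const_mul ((1 / 2) ^ (j + 1))).mul_const (ν a f))
            rw [mul_one] at h1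
            exact h1)
          (fun s => by
            have := hw0 (deg f) s
            have := hν f
            positivity)
          (fun t ht => by
            have h1 := hA t ht
            have h2 : 0 ≤ (1 / 2) ^ (j + 1) * w (deg f) 0 * ν a f := by
              have := hw0 (deg f) 0
              have := hν f
              positivity
            simp only [mul_zero, add_zero]
            linarith)
          hDle
        intro s hs hs' t ht
        refine (hmain s hs hs' t ht).trans ?_
        have : ε' * s ≤ ε / 2 := by
          calc ε' * s ≤ ε' * t₀ := mul_le_mul_of_nonneg_left hs' hε'0.le
            _ = ε / 2 := by rw [hε']; field_simp
        linarith
    intro f ε hε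
    obtain ⟨C, hC⟩ := hνb f
    obtain ⟨j, hj⟩ : ∃ j : ℕ, (1 / 2) ^ j * w (deg f) t₀ * (|C| + 1) ≤ ε / 2 := by
      have h1 : Tendsto (fun j : ℕ => (1 / 2 : ℝ) ^ j * w (deg f) t₀ * (|C| + 1)) atTop
          (𝓝 (0 * w (deg f) t₀ * (|C| + 1))) :=
        ((tendsto_pow_atTop_nhds_zero_of_lt_one (by norm_num) (by norm_num)).mul_const _).mul_const _
      rw [zero_mul, zero_mul] at h1
      exact (h1.eventually (eventually_le_nhds (by positivity))).exists
    filter_upwards [claim j f (ε / 2) (by positivity), hC] with a h1 h2 t ht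
    refine (h1 t₀ ht₀pos.le le_rfl t ht).trans ?_
    have h3 : (1 / 2) ^ j * w (deg f) t₀ * ν a f ≤ (1 / 2) ^ j * w (deg f) t₀ * (|C| + 1) := by
      refine mul_le_mul_of_nonneg_left (by linarith [le_abs_self C]) ?_
      have := hw0 (deg f) t₀
      positivity
    linarith
  have hall : ∀ k : ℕ, ∀ f, ∀ ε > 0, ∀ᶠ a in l, ∀ t, |t| ≤ k * t₀ → ‖e a t f‖ ≤ ε := by
    intro k
    induction k with
    | zero =>
      intro f ε hε
      have h1 := (h0 f).norm
      rw [norm_zero] at h1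
      filter_upwards [h1.eventually (eventually_le_nhds hε)] with a ha t ht
      have : t = 0 := by simpa using ht
      rwa [this]
    | succ k ih =>
      have := step (k * t₀) (by positivity) ih
      intro f ε hε
      filter_upwards [this f ε hε] with a ha t ht
      exact ha t (by push_cast at ht; linarith)
  intro T f ε hε
  obtain ⟨k, hk⟩ := exists_nat_ge (T / t₀)
  filter_upwards [hall k f ε hε] with a ha t ht
  exact ha t (ht.trans ((div_le_iff₀ ht₀pos).1 hk))

namespace SpinLattice

/-! ### Ordered products -/

section ListProd

variable {R : Type*} [Ring R] {P : Type*} [DecidableEq P]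

theorem map_update_of_notMem {α β : Type*} [DecidableEq α] (o : List α) (F : α → β) (k : α) (z : β)
    (hk : k ∉ o) : o.map (Function.update F k z) = o.map F :=
  List.map_congr_left fun a ha => Function.update_of_ne (fun h : a = k => hk (h ▸ ha)) _ _

/-- An ordered product depends on a single factor as `z ↦ a * z * b`, so identities for that factor
can be inserted by linearity. -/
theorem exists_prod_map_update {o : List P} (ho : o.Nodup) (F : P → R) {k : P} (hk : k ∈ o) :
    ∃ a b : R, ∀ z, (o.map (Function.update F k z)).prod = a * z * b := by
  obtain ⟨s, t, rfl⟩ := List.append_of_mem hk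
  rw [List.nodup_append'] at ho
  obtain ⟨-, h2, h3⟩ := ho
  have hs : k ∉ s := fun h => h3 h (by simp)
  have ht : k ∉ t := (List.nodup_cons.1 h2).1
  refine ⟨(s.map F).prod, (t.map F).prod, fun z => ?_⟩
  rw [List.map_append, List.map_cons, map_update_of_notMem s F k z hs,
    map_update_of_notMem t F k z ht, List.prod_append, List.prod_cons, Function.update_self,
    mul_assoc]

/-- A commutator is a derivation. The Leibniz rule is stated so that the order of the factors is
untouched: only the entry of the list is changed. -/
theorem mul_prod_map_sub_prod_map_mul {o : List P} (ho : o.Nodup) (F : P → R) (z : R) :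
    z * (o.map F).prod - (o.map F).prod * z =
      ∑ k ∈ o.toFinset, (o.map (Function.update F k (z * F k - F k * z))).prod := by
  induction o with
  | nil => simp
  | cons a o ih =>
    obtain ⟨h1, h2⟩ := List.nodup_cons.1 ho
    rw [List.toFinset_cons, Finset.sum_insert (by simpa using h1)]
    have h3 : ∀ k ∈ o.toFinset,
        ((a :: o).map (Function.update F k (z * F k - F k * z))).prod =
          F a * (o.map (Function.update F k (z * F k - F k * z))).prod := by
      intro k hk
      have : a ≠ k := fun h => h1 (by rw [h]; simpa using hk)
      rw [List.map_cons, List.prod_cons, Function.update_of_ne this]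
    rw [Finset.sum_congr rfl h3, ← Finset.mul_sum, ← ih h2, List.map_cons, List.map_cons,
      List.prod_cons, List.prod_cons, Function.update_self,
      map_update_of_notMem o F a _ h1]
    noncomm_ring

end ListProd

/-! ### Local operators -/

section LocalOp

variable {d N : ℕ}

theorem localOp_ext {A B : SpinSpace d N →L[ℂ] SpinSpace d N}
    (h : ∀ (ψ : SpinSpace d N) (c : Config d N), A ψ c = B ψ c) : A = B := by
  ext ψ c
  exact h ψ c

theorem localOp_add (Λ : Finset (Site d)) (T T' : Matrix (LocalConfig N Λ) (LocalConfig N Λ) ℂ) :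
    localOp Λ (T + T') = localOp Λ T + localOp Λ T' := by
  simp [localOp, add_smul, Finset.sum_add_distrib]

theorem localOp_smul (Λ : Finset (Site d)) (z : ℂ)
    (T : Matrix (LocalConfig N Λ) (LocalConfig N Λ) ℂ) :
    localOp Λ (z • T) = z • localOp Λ T := by
  simp [localOp, mul_smul, Finset.smul_sum]

theorem override_restrict (c : Config d N) (Λ : Finset (Site d)) (b : LocalConfig N Λ) :
    (c.override Λ b).restrict Λ = b := by
  funext x
  simp [Config.restrict, Config.override]

theorem override_override_self (c : Config d N) (Λ : Finset (Site d)) (b b' : LocalConfig N Λ) :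
    (c.override Λ b).override Λ b' = c.override Λ b' := by
  funext x
  by_cases hx : x ∈ Λ <;> simp [Config.override, hx]

theorem override_restrict_self (c : Config d N) (Λ : Finset (Site d)) :
    c.override Λ (c.restrict Λ) = c := by
  funext x
  by_cases hx : x ∈ Λ <;> simp [Config.restrict, Config.override]

theorem localOp_mul (Λ : Finset (Site d)) (T T' : Matrix (LocalConfig N Λ) (LocalConfig N Λ) ℂ) :
    localOp Λ T * localOp Λ T' = localOp Λ (T * T') := by
  refine localOp_ext fun ψ c => ?_
  change localOp Λ T (localOp Λ T' ψ) c = _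
  rw [localOp_apply, localOp_apply]
  simp only [localOp_apply, override_restrict, override_override_self, Matrix.mul_apply,
    Finset.mul_sum, Finset.sum_mul]
  rw [Finset.sum_comm]
  simp only [mul_assoc]

theorem localOp_one (Λ : Finset (Site d)) :
    localOp (N := N) Λ 1 = 1 := by
  classical
  refine localOp_ext fun ψ c => ?_
  rw [localOp_apply, Finset.sum_eq_single (c.restrict Λ)]
  · simp [override_restrict_self]
  · intro b _ hb
    simp [Matrix.one_apply_ne hb.symm]
  · simp

/-- Exchange of the local configurations `a` and `b` on `Λ`. -/
def overrideEquiv (Λ : Finset (Site d)) (a b : LocalConfig N Λ) :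
    {c : Config d N | c.restrict Λ = a} ≃ {c : Config d N | c.restrict Λ = b} where
  toFun c := ⟨(c : Config d N).override Λ b, override_restrict _ _ _⟩
  invFun c := ⟨(c : Config d N).override Λ a, override_restrict _ _ _⟩
  left_inv := by
    rintro ⟨c, rfl⟩
    apply Subtype.ext
    simp [override_override_self, override_restrict_self]
  right_inv := by
    rintro ⟨c, rfl⟩
    apply Subtype.ext
    simp [override_override_self, override_restrict_self]

/-- Overwriting `a` by `b` on `Λ` is a bijection between the configurations with these restrictions,
and it carries one sum into the other. -/
theorem inner_matrixUnitOp (Λ : Finset (Site d)) (a b : LocalConfig N Λ) (φ ψ : SpinSpace d N) :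
    inner ℂ (matrixUnitOp Λ a b φ) ψ = inner ℂ φ (matrixUnitOp Λ b a ψ) := by
  classical
  rw [lp.inner_eq_tsum, lp.inner_eq_tsum]
  have h1 : (fun c => inner ℂ ((matrixUnitOp Λ a b φ : SpinSpace d N) c) (ψ c)) =
      Set.indicator {c : Config d N | c.restrict Λ = a}
        (fun c => inner ℂ (φ (c.override Λ b)) (ψ c)) := by
    funext c
    change inner ℂ (matrixUnitFun Λ a b φ c) (ψ c) = _
    by_cases hc : c.restrict Λ = a <;> simp [matrixUnitFun, Set.indicator, hc]
  have h2 : (fun c => inner ℂ (φ c) ((matrixUnitOp Λ b a ψ : SpinSpace d N) c)) =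
      Set.indicator {c : Config d N | c.restrict Λ = b}
        (fun c => inner ℂ (φ c) (ψ (c.override Λ a))) := by
    funext c
    change inner ℂ (φ c) (matrixUnitFun Λ b a ψ c) = _
    by_cases hc : c.restrict Λ = b <;> simp [matrixUnitFun, Set.indicator, hc]
  rw [h1, h2, ← tsum_subtype, ← tsum_subtype, ← (overrideEquiv Λ a b).tsum_eq]
  refine tsum_congr fun c => ?_
  obtain ⟨c, rfl⟩ := c
  simp [overrideEquiv, override_override_self, override_restrict_self]

theorem star_matrixUnitOp (Λ : Finset (Site d)) (a b : LocalConfig N Λ) :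
    star (matrixUnitOp Λ a b) = matrixUnitOp (d := d) Λ b a := by
  rw [ContinuousLinearMap.star_eq_adjoint, eq_comm, ContinuousLinearMap.eq_adjoint_iff]
  intro φ ψ
  exact inner_matrixUnitOp Λ b a φ ψ

theorem star_localOp (Λ : Finset (Site d)) (T : Matrix (LocalConfig N Λ) (LocalConfig N Λ) ℂ) :
    star (localOp Λ T) = localOp Λ Tᴴ := by
  simp only [localOp, star_sum, star_smul, star_matrixUnitOp, Matrix.conjTranspose_apply]
  rw [Finset.sum_comm]

/-- The matrix `T ⊗ 1` on a larger set of sites. -/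
def extendMatrix {Λ Λ' : Finset (Site d)} (hΛ : Λ ⊆ Λ')
    (T : Matrix (LocalConfig N Λ) (LocalConfig N Λ) ℂ) :
    Matrix (LocalConfig N Λ') (LocalConfig N Λ') ℂ :=
  open Classical in Matrix.of fun a b =>
    if (splitEquiv N hΛ a).2 = (splitEquiv N hΛ b).2 then
      T (splitEquiv N hΛ a).1 (splitEquiv N hΛ b).1 else 0

theorem localOp_extendMatrix {Λ Λ' : Finset (Site d)} (hΛ : Λ ⊆ Λ')
    (T : Matrix (LocalConfig N Λ) (LocalConfig N Λ) ℂ) :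
    localOp Λ' (extendMatrix hΛ T) = localOp Λ T := by
  classical
  refine localOp_ext fun ψ c => ?_
  rw [localOp_apply, localOp_apply, ← (splitEquiv N hΛ).symm.sum_comp, Fintype.sum_prod_type]
  refine Finset.sum_congr rfl fun e _ => ?_
  rw [Finset.sum_eq_single (splitEquiv N hΛ (c.restrict Λ')).2]
  · simp only [extendMatrix, Matrix.of_apply, Equiv.apply_symm_apply, if_true]
    refine congrArg (fun c' => T (c.restrict Λ) e * ψ c') ?_
    funext x
    by_cases hx : x ∈ Λ
    · simp [Config.override, splitEquiv, hx, hΛ hx]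
    · by_cases hx' : x ∈ Λ' <;> simp [Config.override, Config.restrict, splitEquiv, hx, hx']
  · intro r _ hr
    simp [extendMatrix, hr.symm]
  · simp

theorem exists_localOp_of_subset {Λ Λ' : Finset (Site d)} (hΛ : Λ ⊆ Λ')
    (T : Matrix (LocalConfig N Λ) (LocalConfig N Λ) ℂ) :
    ∃ T' : Matrix (LocalConfig N Λ') (LocalConfig N Λ') ℂ, localOp Λ T = localOp Λ' T' :=
  ⟨extendMatrix hΛ T, (localOp_extendMatrix hΛ T).symm⟩

/-- The matrix of the product operator `⨂_{x ∈ Λ} A x`. -/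
def productMatrix (A : Site d → Matrix (Fin (N + 1)) (Fin (N + 1)) ℂ) (Λ : Finset (Site d)) :
    Matrix (LocalConfig N Λ) (LocalConfig N Λ) ℂ :=
  Matrix.of fun a b => ∏ x : Λ, A x (a x) (b x)

/-- The operator `A` acting at the site `x`. -/
noncomputable def siteOp (x : Site d) (A : Matrix (Fin (N + 1)) (Fin (N + 1)) ℂ) :
    SpinSpace d N →L[ℂ] SpinSpace d N :=
  localOp {x} (Matrix.of fun a b =>
    A (a ⟨x, Finset.mem_singleton_self x⟩) (b ⟨x, Finset.mem_singleton_self x⟩))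

theorem siteOp_apply (x : Site d) (A : Matrix (Fin (N + 1)) (Fin (N + 1)) ℂ) (ψ : SpinSpace d N)
    (c : Config d N) :
    siteOp x A ψ c = ∑ j, A (c x) j * ψ (Function.update c x j) := by
  classical
  rw [siteOp, localOp_apply,
    ← (Equiv.funUnique ({x} : Finset (Site d)) (Fin (N + 1))).symm.sum_comp]
  refine Finset.sum_congr rfl fun j _ => ?_
  refine congrArg (fun c' => A (c x) j * ψ c') ?_
  funext y
  by_cases hy : y = x
  · subst hy
    simp [Config.override]
  · simp [Config.override, hy]

theorem siteOp_add (x : Site d) (A B : Matrix (Fin (N + 1)) (Fin (N + 1)) ℂ) :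
    siteOp x (A + B) = siteOp x A + siteOp x B := by
  refine localOp_ext fun ψ c => ?_
  simp [siteOp_apply, add_mul, Finset.sum_add_distrib]

theorem siteOp_smul (x : Site d) (z : ℂ) (A : Matrix (Fin (N + 1)) (Fin (N + 1)) ℂ) :
    siteOp x (z • A) = z • siteOp x A := by
  refine localOp_ext fun ψ c => ?_
  simp [siteOp_apply, mul_assoc, Finset.mul_sum]

theorem siteOp_mul (x : Site d) (A B : Matrix (Fin (N + 1)) (Fin (N + 1)) ℂ) :
    siteOp x A * siteOp x B = siteOp x (A * B) := by
  refine localOp_ext fun ψ c => ?_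
  change siteOp x A (siteOp x B ψ) c = _
  rw [siteOp_apply, siteOp_apply]
  simp only [siteOp_apply, Function.update_self, Function.update_idem, Matrix.mul_apply,
    Finset.mul_sum, Finset.sum_mul]
  rw [Finset.sum_comm]
  simp only [mul_assoc]

theorem siteOp_mul_comm {x y : Site d} (hxy : x ≠ y)
    (A B : Matrix (Fin (N + 1)) (Fin (N + 1)) ℂ) :
    siteOp x A * siteOp y B = siteOp y B * siteOp x A := by
  refine localOp_ext fun ψ c => ?_
  change siteOp x A (siteOp y B ψ) c = siteOp y B (siteOp x A ψ) c
  rw [siteOp_apply, siteOp_apply]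
  simp only [siteOp_apply, Finset.mul_sum]
  rw [Finset.sum_comm]
  refine Finset.sum_congr rfl fun j _ => Finset.sum_congr rfl fun k _ => ?_
  rw [Function.update_of_ne hxy, Function.update_of_ne hxy.symm, Function.update_comm hxy]
  ring

theorem star_siteOp (x : Site d) (A : Matrix (Fin (N + 1)) (Fin (N + 1)) ℂ) :
    star (siteOp x A) = siteOp x Aᴴ :=
  star_localOp _ _

theorem norm_siteOp_diagonal_le (x : Site d) (v : Fin (N + 1) → ℂ) {K : ℝ} (hK : 0 ≤ K)
    (hv : ∀ j, ‖v j‖ ≤ K) : ‖siteOp x (Matrix.diagonal v)‖ ≤ K := by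
  refine ContinuousLinearMap.opNorm_le_bound _ hK fun ψ => ?_
  have h2 : ∀ c, (siteOp x (Matrix.diagonal v) ψ : SpinSpace d N) c = v (c x) * ψ c := by
    intro c
    rw [siteOp_apply, Finset.sum_eq_single (c x)]
    · simp
    · intro j _ hj
      simp [Matrix.diagonal_apply_ne _ hj.symm]
    · simp
  have h3 : ‖siteOp x (Matrix.diagonal v) ψ‖ ≤ ‖(K : ℂ) • ψ‖ := by
    have h2' : (0 : ℝ) < (2 : ℝ≥0∞).toReal := by norm_num
    refine lp.norm_le_of_tsum_le h2' (norm_nonneg _) ?_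
    rw [lp.norm_rpow_eq_tsum h2']
    refine Summable.tsum_le_tsum (fun c => ?_) ((lp.memℓp _).summable h2')
      ((lp.memℓp _).summable h2')
    rw [h2]
    refine Real.rpow_le_rpow (norm_nonneg _) ?_ h2'.le
    rw [lp.coeFn_smul, Pi.smul_apply, norm_mul, norm_smul, Complex.norm_real, Real.norm_eq_abs,
      abs_of_nonneg hK]
    exact mul_le_mul_of_nonneg_right (hv _) (norm_nonneg _)
  rwa [norm_smul, Complex.norm_real, Real.norm_eq_abs, abs_of_nonneg hK] at h3

/-- A configuration of `insert x Λ` is a configuration of `Λ` together with one label at `x`; the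
matrix entries of a tensor product factorize accordingly. -/
theorem siteOp_mul_localOp_productMatrix (A : Site d → Matrix (Fin (N + 1)) (Fin (N + 1)) ℂ)
    {x : Site d} {Λ : Finset (Site d)} (hx : x ∉ Λ) :
    siteOp x (A x) * localOp Λ (productMatrix A Λ) =
      localOp (insert x Λ) (productMatrix A (insert x Λ)) := by
  refine localOp_ext fun ψ c => ?_
  change siteOp x (A x) (localOp Λ (productMatrix A Λ) ψ) c = _
  have hΛ : Λ ⊆ insert x Λ := Finset.subset_insert x Λ
  have hmem : x ∈ insert x Λ \ Λ := Finset.mem_sdiff.2 ⟨Finset.mem_insert_self x Λ, hx⟩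
  let _ : Unique (insert x Λ \ Λ : Finset (Site d)) :=
    { default := ⟨x, hmem⟩
      uniq := by
        rintro ⟨y, hy⟩
        obtain ⟨h1, h2⟩ := Finset.mem_sdiff.1 hy
        exact Subtype.ext ((Finset.mem_insert.1 h1).resolve_right h2) }
  rw [siteOp_apply, localOp_apply, ← (splitEquiv N hΛ).symm.sum_comp, Fintype.sum_prod_type,
    Finset.sum_comm,
    ← (Equiv.funUnique (insert x Λ \ Λ : Finset (Site d)) (Fin (N + 1))).symm.sum_comp]
  refine Finset.sum_congr rfl fun j _ => ?_
  rw [localOp_apply, Finset.mul_sum]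
  refine Finset.sum_congr rfl fun e _ => ?_
  set b' := (splitEquiv N hΛ).symm
    (e, (Equiv.funUnique (insert x Λ \ Λ : Finset (Site d)) (Fin (N + 1))).symm j) with hb'
  have hprod : productMatrix A (insert x Λ) (c.restrict _) b' =
      productMatrix A Λ (Config.restrict (Function.update c x j) Λ) e * A x (c x) j := by
    have h1 := prod_split (fun y k => A y (c y) k) hΛ b'
    refine h1.trans (congrArg₂ (· * ·) ?_ ((Fintype.prod_unique _).trans ?_))
    · refine Finset.prod_congr rfl fun y _ => ?_
      have : (y : Site d) ≠ x := fun h => hx (h ▸ y.2)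
      simp [hb', splitEquiv, Config.restrict, Function.update_of_ne this]
    · change A x (c x) (b' ⟨x, _⟩) = _
      congr 1
      simp [hb', splitEquiv, hx]
  have hover : Config.override (Function.update c x j) Λ e = c.override (insert x Λ) b' := by
    funext y
    by_cases hy : y ∈ Λ
    · simp [Config.override, hy, hb', splitEquiv]
    · by_cases hyx : y = x
      · subst hyx
        simp [Config.override, hy, hb', splitEquiv]
      · simp [Config.override, hy, hyx]
  rw [hprod, hover]
  ring

/-- Operators at distinct sites multiply to a tensor product. The right-hand side sees only the set
of sites, which is how the order of the factors disappears. -/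
theorem prod_map_siteOp (A : Site d → Matrix (Fin (N + 1)) (Fin (N + 1)) ℂ)
    {o : List (Site d)} (ho : o.Nodup) :
    (o.map fun x => siteOp x (A x)).prod = localOp o.toFinset (productMatrix A o.toFinset) := by
  induction o with
  | nil =>
    rw [List.map_nil, List.prod_nil]
    have : productMatrix A (∅ : Finset (Site d)) = 1 := by
      ext a b
      rw [Subsingleton.elim a b]
      simp [productMatrix]
    rw [List.toFinset_nil, this, localOp_one]
  | cons x o ih =>
    obtain ⟨h1, h2⟩ := List.nodup_cons.1 ho
    rw [List.map_cons, List.prod_cons, ih h2, siteOp_mul_localOp_productMatrix A (by simpa using h1),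
      List.toFinset_cons]

end LocalOp


/-! ### Spin matrices -/

theorem spinMatrix_zero_mul_two (N : ℕ) :
    spinMatrix N 0 * spinMatrix N 2 =
      Matrix.diagonal fun a : Fin (N + 1) => (((a : ℕ) + 1 : ℂ) * ((N : ℂ) - (a : ℕ)) / 2) := by
  ext a b
  rw [Matrix.mul_apply]
  by_cases ha : (a : ℕ) + 1 < N + 1
  · rw [Finset.sum_eq_single ⟨(a : ℕ) + 1, ha⟩]
    · by_cases hab : a = b
      · subst hab
        have h1 : (0 : ℝ) ≤ ((a : ℝ) + 1) * ((N : ℝ) + 1 - ((a : ℝ) + 1)) / 2 := by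
          have : ((a : ℕ) : ℝ) + 1 ≤ N := by exact_mod_cast (by omega : (a : ℕ) + 1 ≤ N)
          have : (0 : ℝ) ≤ (N : ℝ) + 1 - ((a : ℝ) + 1) := by linarith
          positivity
        simp only [spinMatrix, Matrix.of_apply, if_true, Matrix.diagonal_apply_eq]
        push_cast
        rw [← Complex.ofReal_mul, Real.mul_self_sqrt h1]
        push_cast
        ring
      · have h2 : ¬ (a : ℕ) = (b : ℕ) := fun h => hab (Fin.ext h)
        simp [spinMatrix, Matrix.diagonal_apply_ne _ hab, h2]
    · intro c _ hc
      have h2 : ¬ (a : ℕ) + 1 = (c : ℕ) := fun h => hc (Fin.ext h.symm)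
      simp [spinMatrix, h2]
    · simp
  -- At the lowest weight there is no further basis vector; the general formula survives because its
  -- factor `N - a` vanishes.
  · have haN : (a : ℕ) = N := by omega
    rw [Finset.sum_eq_zero]
    · by_cases hab : a = b
      · subst hab
        simp [haN]
      · simp [Matrix.diagonal_apply_ne _ hab]
    · intro c _
      have h2 : ¬ (a : ℕ) + 1 = (c : ℕ) := fun h => ha (h ▸ c.2)
      simp [spinMatrix, h2]

theorem spinMatrix_two_mul_zero (N : ℕ) :
    spinMatrix N 2 * spinMatrix N 0 =
      Matrix.diagonal fun a : Fin (N + 1) => (((a : ℕ) : ℂ) * ((N : ℂ) + 1 - (a : ℕ)) / 2) := by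
  ext a b
  rw [Matrix.mul_apply]
  by_cases ha : 0 < (a : ℕ)
  · rw [Finset.sum_eq_single ⟨(a : ℕ) - 1, by omega⟩]
    · have h0 : (a : ℕ) = (a : ℕ) - 1 + 1 := by omega
      by_cases hab : a = b
      · subst hab
        have h1 : (0 : ℝ) ≤ (a : ℝ) * ((N : ℝ) + 1 - (a : ℝ)) / 2 := by
          have : ((a : ℕ) : ℝ) ≤ N := by exact_mod_cast (by omega : (a : ℕ) ≤ N)
          have : (0 : ℝ) ≤ (N : ℝ) + 1 - (a : ℝ) := by linarith
          positivity
        simp only [spinMatrix, Matrix.of_apply, if_pos h0, if_pos h0.symm,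
          Matrix.diagonal_apply_eq]
        rw [← Complex.ofReal_mul, Real.mul_self_sqrt h1]
        push_cast
        ring
      · have h2 : ¬ (a : ℕ) - 1 + 1 = (b : ℕ) := fun h => hab (Fin.ext (by omega))
        simp [spinMatrix, Matrix.diagonal_apply_ne _ hab, h2]
    · intro c _ hc
      have h2 : ¬ (a : ℕ) = (c : ℕ) + 1 := fun h => hc (Fin.ext (by simp; omega))
      simp [spinMatrix, h2]
    · simp
  · have haN : (a : ℕ) = 0 := by omega
    rw [Finset.sum_eq_zero]
    · by_cases hab : a = b
      · subst hab
        simp [haN]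
      · simp [Matrix.diagonal_apply_ne _ hab]
    · intro c _
      have h2 : ¬ (a : ℕ) = (c : ℕ) + 1 := by omega
      simp [spinMatrix, h2]

theorem spinMatrix_zero_two_commutator (N : ℕ) :
    spinMatrix N 0 * spinMatrix N 2 - spinMatrix N 2 * spinMatrix N 0 = spinMatrix N 1 := by
  rw [spinMatrix_zero_mul_two, spinMatrix_two_mul_zero, Matrix.diagonal_sub]
  refine congrArg Matrix.diagonal (funext fun a => ?_)
  ring

theorem spinMatrix_zero_one_commutator (N : ℕ) :
    spinMatrix N 0 * spinMatrix N 1 - spinMatrix N 1 * spinMatrix N 0 = -spinMatrix N 0 := by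
  ext a b
  simp only [Matrix.sub_apply, spinMatrix, Matrix.mul_diagonal, Matrix.diagonal_mul,
    Matrix.of_apply, Matrix.neg_apply]
  split_ifs with h
  · rw [← h]
    push_cast
    ring
  · simp

theorem spinMatrix_two_one_commutator (N : ℕ) :
    spinMatrix N 2 * spinMatrix N 1 - spinMatrix N 1 * spinMatrix N 2 = spinMatrix N 2 := by
  ext a b
  simp only [Matrix.sub_apply, spinMatrix, Matrix.mul_diagonal, Matrix.diagonal_mul,
    Matrix.of_apply]
  split_ifs with h
  · rw [h]
    push_cast
    ring
  · simp

theorem spinMatrix_commutator (N : ℕ) (i j : Fin 3) :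
    spinMatrix N i * spinMatrix N j - spinMatrix N j * spinMatrix N i =
      ∑ m, epsT i j m • spinMatrix N m := by
  have h1 := spinMatrix_zero_two_commutator N
  have h2 := spinMatrix_zero_one_commutator N
  have h3 := spinMatrix_two_one_commutator N
  fin_cases i <;> fin_cases j <;> simp only [Fin.sum_univ_three, Fin.zero_eta, Fin.mk_one,
    Fin.reduceFinMk, epsT, zero_smul, one_smul, neg_smul, add_zero, zero_add, sub_self]
  · exact h2
  · exact h1
  · rw [← neg_sub, h2, neg_neg]
  · rw [← neg_sub, h3]
  · rw [← neg_sub, h1]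
  · exact h3

theorem spinMatrix_conjTranspose (N : ℕ) (i : Fin 3) : (spinMatrix N i)ᴴ = spinMatrix N i.rev := by
  fin_cases i
  · exact spinMatrix_zero_conjTranspose N
  · simp only [Fin.mk_one]
    change (spinMatrix N 1)ᴴ = spinMatrix N 1
    simp only [spinMatrix, Matrix.diagonal_conjTranspose]
    refine congrArg Matrix.diagonal (funext fun a => ?_)
    simp
  · change (spinMatrix N 2)ᴴ = spinMatrix N 0
    rw [← spinMatrix_zero_conjTranspose, Matrix.conjTranspose_conjTranspose]

/-- For given `i`, `j` at most one `m` contributes. The sum over the new index in a commutator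
therefore costs nothing in the growth estimates. -/
theorem sum_norm_epsT_le (i j : Fin 3) : ∑ m, ‖epsT i j m‖ ≤ 1 := by
  fin_cases i <;> fin_cases j <;> simp [Fin.sum_univ_three, epsT]

/-! ### The rescaled spins -/

section Spin

variable {d N : ℕ}

/-- By the C*-identity the square of the norm is the norm of the product of the spin matrix with its
adjoint, which is diagonal with entries at most N²/2. For N = 1 and index + the bound is attained,
so the factor √2 cannot be dropped uniformly in s. -/
theorem norm_siteOp_spinMatrix_le (hN : 0 < N) (x : Site d) (i : Fin 3) :
    ‖siteOp x (spinMatrix N i)‖ ≤ Real.sqrt 2 * ((N : ℝ) / 2) := by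
  have hN' : (0 : ℝ) < N := by exact_mod_cast hN
  have hN1 : (1 : ℝ) ≤ N := by exact_mod_cast hN
  have hsq : Real.sqrt 2 * Real.sqrt 2 = 2 := Real.mul_self_sqrt (by norm_num)
  have key : ∀ i j : Fin 3, ∀ v : Fin (N + 1) → ℂ, (spinMatrix N i)ᴴ = spinMatrix N j →
      spinMatrix N j * spinMatrix N i = Matrix.diagonal v → (∀ a, ‖v a‖ ≤ (N : ℝ) ^ 2 / 2) →
      ‖siteOp x (spinMatrix N i)‖ ≤ Real.sqrt 2 * ((N : ℝ) / 2) := by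
    intro i j v h1 h2 h3
    have h4 := norm_siteOp_diagonal_le x v (by positivity) h3
    rw [← h2, ← h1, ← siteOp_mul, ← star_siteOp] at h4
    have h5 : ‖star (siteOp x (spinMatrix N i)) * siteOp x (spinMatrix N i)‖ =
        ‖siteOp x (spinMatrix N i)‖ * ‖siteOp x (spinMatrix N i)‖ :=
      ContinuousLinearMap.norm_adjoint_comp_self _
    rw [h5] at h4
    refine abs_le_of_sq_le_sq' ?_ (by positivity) |>.2
    nlinarith
  fin_cases i
  · refine key 0 2 _ (spinMatrix_conjTranspose N 0) (spinMatrix_two_mul_zero N) fun a => ?_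
    have h1 : ((a : ℕ) : ℝ) ≤ N := by exact_mod_cast (by omega : (a : ℕ) ≤ N)
    have h0 : (0 : ℝ) ≤ (a : ℕ) := Nat.cast_nonneg _
    have : (((a : ℕ) : ℂ) * ((N : ℂ) + 1 - (a : ℕ)) / 2) =
      ((((a : ℕ) : ℝ) * ((N : ℝ) + 1 - (a : ℕ)) / 2 : ℝ) : ℂ) := by push_cast; ring
    rw [this, Complex.norm_real, Real.norm_eq_abs, abs_of_nonneg (by
      have : (0 : ℝ) ≤ (N : ℝ) + 1 - (a : ℕ) := by linarith
      positivity)]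
    rcases Nat.eq_zero_or_pos (a : ℕ) with h | h
    · rw [h]; simp; positivity
    · have h5 : (1 : ℝ) ≤ (a : ℕ) := by exact_mod_cast h
      nlinarith [mul_nonneg hN'.le (sub_nonneg.2 h1)]
  · refine key 1 1 (fun a => ((N : ℂ) / 2 - ((a : ℕ) : ℂ)) ^ 2) (spinMatrix_conjTranspose N 1) ?_
      fun a => ?_
    · simp only [spinMatrix, Matrix.diagonal_mul_diagonal, sq]
    · have h1 : ((a : ℕ) : ℝ) ≤ N := by exact_mod_cast (by omega : (a : ℕ) ≤ N)
      have h0 : (0 : ℝ) ≤ (a : ℕ) := Nat.cast_nonneg _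
      have : ((N : ℂ) / 2 - ((a : ℕ) : ℂ)) = (((N : ℝ) / 2 - (a : ℕ) : ℝ) : ℂ) := by push_cast; ring
      rw [this, norm_pow, Complex.norm_real, Real.norm_eq_abs, sq_abs]
      nlinarith
  · refine key 2 0 _ (spinMatrix_conjTranspose N 2) (spinMatrix_zero_mul_two N) fun a => ?_
    have h1 : ((a : ℕ) : ℝ) ≤ N := by exact_mod_cast (by omega : (a : ℕ) ≤ N)
    have h0 : (0 : ℝ) ≤ (a : ℕ) := Nat.cast_nonneg _
    have : (((a : ℕ) + 1 : ℂ) * ((N : ℂ) - (a : ℕ)) / 2) =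
      (((a : ℕ) + 1 : ℝ) * ((N : ℝ) - (a : ℕ)) / 2 : ℝ) := by push_cast; ring
    rw [this, Complex.norm_real, Real.norm_eq_abs, abs_of_nonneg (by
      have : (0 : ℝ) ≤ (N : ℝ) - (a : ℕ) := by linarith
      positivity)]
    nlinarith [mul_nonneg h0 (sub_nonneg.2 h1)]

theorem coe_spin (h : ℝ) (i : Fin 3) (x : Site d) :
    ((spin h i x : quasiLocalAlgebra d N) : SpinSpace d N →L[ℂ] SpinSpace d N) =
      ((h ^ d / ((N : ℝ) / 2) : ℝ) : ℂ) • siteOp x (spinMatrix N i) := rfl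

theorem norm_spin_le (hN : 0 < N) {h : ℝ} (hh : 0 ≤ h) (i : Fin 3) (x : Site d) :
    ‖(spin h i x : quasiLocalAlgebra d N)‖ ≤ Real.sqrt 2 * h ^ d := by
  have hN' : (0 : ℝ) < N := by exact_mod_cast hN
  change ‖((spin h i x : quasiLocalAlgebra d N) : SpinSpace d N →L[ℂ] SpinSpace d N)‖ ≤ _
  rw [coe_spin, norm_smul, Complex.norm_real, Real.norm_eq_abs, abs_of_nonneg (by positivity)]
  refine (mul_le_mul_of_nonneg_left (norm_siteOp_spinMatrix_le hN x i) (by positivity)).trans ?_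
  refine le_of_eq ?_
  field_simp

theorem star_spin (h : ℝ) (i : Fin 3) (x : Site d) :
    star (spin h i x : quasiLocalAlgebra d N) = spin h i.rev x := by
  apply Subtype.ext
  change star ((spin h i x : quasiLocalAlgebra d N) : SpinSpace d N →L[ℂ] SpinSpace d N) = _
  rw [coe_spin, coe_spin, star_smul, star_siteOp, spinMatrix_conjTranspose, Complex.star_def,
    Complex.conj_ofReal]

theorem siteOp_zero (x : Site d) : siteOp x (0 : Matrix (Fin (N + 1)) (Fin (N + 1)) ℂ) = 0 := by
  refine localOp_ext fun ψ c => ?_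
  simp [siteOp_apply]

theorem siteOp_sum {ι : Type*} (s : Finset ι) (x : Site d)
    (A : ι → Matrix (Fin (N + 1)) (Fin (N + 1)) ℂ) :
    siteOp x (∑ m ∈ s, A m) = ∑ m ∈ s, siteOp x (A m) := by
  induction s using Finset.cons_induction with
  | empty => simp [siteOp_zero]
  | cons a s ha ih => rw [Finset.sum_cons, Finset.sum_cons, siteOp_add, ih]

/-- The factor h^d/s makes the spins commute in the limit h → 0. It is the exact inverse of the
prefactor of the Hamiltonian in the generator. -/
theorem spin_commutator (h : ℝ) (i j : Fin 3) (x y : Site d) :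
    (spin h i x * spin h j y - spin h j y * spin h i x : quasiLocalAlgebra d N) =
      if x = y then ((h ^ d / ((N : ℝ) / 2) : ℝ) : ℂ) • ∑ m, epsT i j m • spin h m y else 0 := by
  set κ : ℂ := ((h ^ d / ((N : ℝ) / 2) : ℝ) : ℂ) with hκ
  apply Subtype.ext
  change ((spin h i x : quasiLocalAlgebra d N) : SpinSpace d N →L[ℂ] SpinSpace d N) *
      (spin h j y : quasiLocalAlgebra d N) - (spin h j y : quasiLocalAlgebra d N) *
      (spin h i x : quasiLocalAlgebra d N) = _
  rw [coe_spin, coe_spin, smul_mul_smul_comm, smul_mul_smul_comm, ← smul_sub, ← hκ]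
  split_ifs with hxy
  · subst hxy
    have h1 : siteOp x (spinMatrix N i) * siteOp x (spinMatrix N j) -
        siteOp x (spinMatrix N j) * siteOp x (spinMatrix N i) =
        ∑ m, epsT i j m • siteOp x (spinMatrix N m) := by
      have h2 := congrArg (siteOp x) (spinMatrix_commutator N i j)
      rw [siteOp_sum, sub_eq_add_neg, ← neg_one_smul ℂ, siteOp_add, siteOp_smul, neg_one_smul,
        ← sub_eq_add_neg] at h2
      rw [siteOp_mul, siteOp_mul, h2]
      exact Finset.sum_congr rfl fun m _ => siteOp_smul _ _ _
    rw [h1, mul_smul]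
    simp only [SetLike.val_smul, AddSubmonoidClass.coe_finsetSum, coe_spin]
    rw [Finset.smul_sum (r := κ) (f := fun m => epsT i j m • siteOp x (spinMatrix N m))]
    simp only [← hκ, smul_comm κ]
  · rw [siteOp_mul_comm hxy, sub_self, smul_zero]
    rfl

theorem spin_mul_comm_of_ne (h : ℝ) (i j : Fin 3) {x y : Site d} (hxy : x ≠ y) :
    (spin h i x * spin h j y : quasiLocalAlgebra d N) = spin h j y * spin h i x := by
  have := spin_commutator (N := N) h i j x y
  rwa [if_neg hxy, sub_eq_zero] at this

theorem spin_mul_comm_same (h : ℝ) (i : Fin 3) (x y : Site d) :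
    (spin h i x * spin h i y : quasiLocalAlgebra d N) = spin h i y * spin h i x := by
  by_cases hxy : x = y
  · rw [hxy]
  · exact spin_mul_comm_of_ne h i i hxy

/-! ### Density of the local operators and the product states -/

/-- Two local operators both live on the union of their sets of sites, so the local operators
already form a star algebra. -/
theorem localOp_mem_closed (a : SpinSpace d N →L[ℂ] SpinSpace d N)
    (ha : a ∈ StarAlgebra.adjoin ℂ {a | ∃ (Λ : Finset (Site d))
      (T : Matrix (LocalConfig N Λ) (LocalConfig N Λ) ℂ), a = localOp Λ T}) :
    ∃ (Λ : Finset (Site d)) (T : Matrix (LocalConfig N Λ) (LocalConfig N Λ) ℂ),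
      a = localOp Λ T := by
  induction ha using StarAlgebra.adjoin_induction with
  | mem a ha => exact ha
  | algebraMap r =>
    refine ⟨∅, r • 1, ?_⟩
    rw [localOp_smul, localOp_one, Algebra.algebraMap_eq_smul_one]
  | add a b _ _ iha ihb =>
    obtain ⟨Λ, T, rfl⟩ := iha
    obtain ⟨Λ', T', rfl⟩ := ihb
    obtain ⟨S, hS⟩ := exists_localOp_of_subset (Finset.subset_union_left (s₂ := Λ')) T
    obtain ⟨S', hS'⟩ := exists_localOp_of_subset (Finset.subset_union_right (s₁ := Λ)) T'
    exact ⟨_, S + S', by rw [hS, hS', localOp_add]⟩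
  | mul a b _ _ iha ihb =>
    obtain ⟨Λ, T, rfl⟩ := iha
    obtain ⟨Λ', T', rfl⟩ := ihb
    obtain ⟨S, hS⟩ := exists_localOp_of_subset (Finset.subset_union_left (s₂ := Λ')) T
    obtain ⟨S', hS'⟩ := exists_localOp_of_subset (Finset.subset_union_right (s₁ := Λ)) T'
    exact ⟨_, S * S', by rw [hS, hS', localOp_mul]⟩
  | star a _ iha =>
    obtain ⟨Λ, T, rfl⟩ := iha
    exact ⟨Λ, Tᴴ, star_localOp Λ T⟩

theorem denseRange_localObs :
    DenseRange (fun p : Σ Λ : Finset (Site d), Matrix (LocalConfig N Λ) (LocalConfig N Λ) ℂ =>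
      localObs p.1 p.2) := by
  rw [DenseRange, Topology.IsInducing.subtypeVal.dense_iff]
  intro a
  refine closure_mono ?_ a.2
  intro b hb
  obtain ⟨Λ, T, rfl⟩ := localOp_mem_closed b hb
  exact ⟨localObs Λ T, ⟨⟨Λ, T⟩, rfl⟩, rfl⟩

/-- The state is known only as some continuous functional with given values on local operators. On
these it is a vector state of a unit vector, hence a contraction, and density does the rest. -/
theorem norm_productState_le (h : ℝ) (M₀ : E d → E 3) (a : quasiLocalAlgebra d N) :
    ‖productState h M₀ a‖ ≤ ‖a‖ := by
  refine (denseRange_localObs (d := d) (N := N)).induction_on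
    (p := fun a : quasiLocalAlgebra d N => ‖productState h M₀ a‖ ≤ ‖a‖) a ?_ ?_
  · exact isClosed_le (productState (N := N) h M₀).continuous.norm continuous_norm
  · rintro ⟨Λ, T⟩
    set u : Site d → Fin (N + 1) → ℂ := fun x => coherentVector N (M₀ (latticePoint h x))
    have hu : ∀ x, ∑ j, star (u x j) * u x j = 1 := fun x => coherentVector_unit N _
    have h1 : productState h M₀ (localObs Λ T) =
        inner ℂ (paddedVector u Λ) (localOp Λ T (paddedVector u Λ)) := by
      rw [productState_localObs, inner_localOp u hu subset_rfl]
      rfl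
    change ‖productState h M₀ (localObs Λ T)‖ ≤ ‖localOp Λ T‖
    rw [h1]
    refine (norm_inner_le_norm _ _).trans ?_
    rw [norm_paddedVector u hu, one_mul]
    refine ((localOp Λ T).le_opNorm _).trans ?_
    rw [norm_paddedVector u hu, mul_one]

theorem productState_prod_siteOp (h : ℝ) (M₀ : E d → E 3)
    (A : Site d → Matrix (Fin (N + 1)) (Fin (N + 1)) ℂ) (Λ : Finset (Site d)) :
    productState h M₀ (localObs Λ (productMatrix A Λ)) =
      ∏ x ∈ Λ, star (coherentVector N (M₀ (latticePoint h x))) ⬝ᵥ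
        (A x *ᵥ coherentVector N (M₀ (latticePoint h x))) := by
  rw [productState_localObs, ← Finset.prod_coe_sort]
  simp only [dotProduct, Matrix.mulVec, productVector, productMatrix, Pi.star_apply,
    Matrix.of_apply, Finset.mul_sum]
  simp only [Fintype.prod_sum]
  refine Finset.sum_congr rfl fun a _ => Finset.sum_congr rfl fun b _ => ?_
  rw [star_prod, ← Finset.prod_mul_distrib, ← Finset.prod_mul_distrib]

/-- At pairwise distinct sites the monomial is a tensor product, so its expectation in a product
vector factorizes whatever the order `o` is. -/
theorem productState_prod_spin (h : ℝ) (M₀ : E d → E 3) {P : Type*} {o : List P}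
    (i : P → Fin 3) (x : P → Site d) (hx : (o.map x).Nodup)
    (hM : ∀ y, ∀ i, star (coherentVector N (M₀ y)) ⬝ᵥ
      (spinMatrix N i *ᵥ coherentVector N (M₀ y)) = (N : ℂ) / 2 * coord i (M₀ y)) (hN : 0 < N) :
    productState h M₀ ((o.map fun k => (spin h (i k) (x k) : quasiLocalAlgebra d N)).prod) =
      (o.map fun k => ((h ^ d : ℝ) : ℂ) * coord (i k) (M₀ (latticePoint h (x k)))).prod := by
  classical
  set κ : ℂ := ((h ^ d / ((N : ℝ) / 2) : ℝ) : ℂ) with hκ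
  have hinj : ∀ k ∈ o, ∀ k' ∈ o, x k = x k' → i k = i k' := by
    intro k hk k' hk' h
    rw [List.inj_on_of_nodup_map hx hk hk' h]
  -- The indices are read as a function of the site; the default `0` sits at sites that do not occur
  -- in the monomial and is never evaluated.
  let ix : Site d → Fin 3 := fun y => if hy : ∃ k ∈ o, x k = y then i hy.choose else 0
  have hix : ∀ k ∈ o, ix (x k) = i k := by
    intro k hk
    have hy : ∃ k' ∈ o, x k' = x k := ⟨k, hk, rfl⟩
    simp only [ix, dif_pos hy]
    exact hinj _ hy.choose_spec.1 _ hk hy.choose_spec.2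
  have h1 : (o.map fun k => (spin h (i k) (x k) : quasiLocalAlgebra d N)).prod =
      localObs (o.map x).toFinset (productMatrix (fun y => κ • spinMatrix N (ix y)) _) := by
    apply Subtype.ext
    change (quasiLocalAlgebra d N).subtype _ = localOp _ _
    rw [map_list_prod, List.map_map, ← prod_map_siteOp _ hx, List.map_map]
    refine congrArg List.prod (List.map_congr_left fun k hk => ?_)
    simp only [Function.comp_apply, siteOp_smul, hix k hk]
    exact coe_spin h (i k) (x k)
  rw [h1, productState_prod_siteOp, List.prod_toFinset _ hx, List.map_map]
  refine congrArg List.prod (List.map_congr_left fun k hk => ?_)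
  simp only [Function.comp_apply, Matrix.smul_mulVec, dotProduct_smul, hM, hix k hk, smul_eq_mul]
  have hN' : (N : ℂ) ≠ 0 := by exact_mod_cast hN.ne'
  rw [hκ]
  push_cast
  field_simp

end Spin


/-! ### Expectations of the spins in coherent states -/

/-- The adjoint action of `Y` rotates the plane of `Z` and `T`. Rotating by the angle θ in one sense
and conjugating in the other gives a curve with zero derivative, which is therefore constant and
equal to its value `Z` at θ = 0. -/
theorem exp_neg_mul_mul_exp_of_rotation {𝔸 : Type*} [NormedRing 𝔸] [NormedAlgebra ℝ 𝔸]
    [CompleteSpace 𝔸] {Y Z T : 𝔸} (h1 : Y * Z - Z * Y = T) (h2 : Y * T - T * Y = -Z) (θ : ℝ) :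
    NormedSpace.exp (-(θ • Y)) * Z * NormedSpace.exp (θ • Y) =
      Real.cos θ • Z - Real.sin θ • T := by
  let _ : NormedAlgebra ℚ 𝔸 := NormedAlgebra.restrictScalars ℚ ℝ 𝔸
  have hinv : ∀ θ : ℝ, NormedSpace.exp (-(θ • Y)) * NormedSpace.exp (θ • Y) = 1 := fun θ => by
    rw [← NormedSpace.exp_add_of_commute (Commute.refl (θ • Y)).neg_left, neg_add_cancel,
      NormedSpace.exp_zero]
  have hcomm' : ∀ θ : ℝ, Y * NormedSpace.exp (θ • -Y) = NormedSpace.exp (θ • -Y) * Y := fun θ =>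
    (((Commute.refl Y).neg_right).smul_right θ).exp_right.eq
  have hder : ∀ θ : ℝ, HasDerivAt (fun θ : ℝ => NormedSpace.exp (θ • Y) *
      (Real.cos θ • Z - Real.sin θ • T) * NormedSpace.exp (θ • -Y)) 0 θ := by
    intro θ
    have d1 := hasDerivAt_exp_smul_const (𝕂 := ℝ) Y θ
    have d2 := hasDerivAt_exp_smul_const (𝕂 := ℝ) (-Y) θ
    have d3 : HasDerivAt (fun θ : ℝ => Real.cos θ • Z - Real.sin θ • T)
        ((-Real.sin θ) • Z - Real.cos θ • T) θ :=
      ((Real.hasDerivAt_cos θ).smul_const Z).sub ((Real.hasDerivAt_sin θ).smul_const T)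
    have h1' : Y * Z = Z * Y + T := by rw [← h1]; abel
    have h2' : Y * T = T * Y - Z := by rw [sub_eq_add_neg, ← h2]; abel
    have h3 : Y * (Real.cos θ • Z - Real.sin θ • T) + ((-Real.sin θ) • Z - Real.cos θ • T) =
        (Real.cos θ • Z - Real.sin θ • T) * Y := by
      rw [mul_sub, mul_smul_comm, mul_smul_comm, h1', h2', sub_mul, smul_mul_assoc, smul_mul_assoc,
        smul_add, smul_sub, neg_smul]
      abel
    have h4 : NormedSpace.exp (θ • Y) * Y * (Real.cos θ • Z - Real.sin θ • T) +
        NormedSpace.exp (θ • Y) * ((-Real.sin θ) • Z - Real.cos θ • T) =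
        NormedSpace.exp (θ • Y) * (Real.cos θ • Z - Real.sin θ • T) * Y := by
      rw [mul_assoc, ← mul_add, h3, mul_assoc]
    refine ((d1.mul d3).mul d2).congr_deriv ?_
    rw [h4, mul_neg, ← hcomm' θ, mul_neg, mul_assoc]
    exact add_neg_cancel _
  have hconst := is_const_of_deriv_eq_zero (fun θ => (hder θ).differentiableAt)
    (fun θ => (hder θ).deriv) θ 0
  simp only [zero_smul, NormedSpace.exp_zero, Real.cos_zero, one_smul, Real.sin_zero, sub_zero,
    one_mul, mul_one, smul_neg, neg_zero] at hconst
  have h5 : NormedSpace.exp (θ • Y) * NormedSpace.exp (-(θ • Y)) = 1 := by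
    rw [← NormedSpace.exp_add_of_commute (Commute.refl (θ • Y)).neg_right, add_neg_cancel,
      NormedSpace.exp_zero]
  conv_lhs => rw [← hconst]
  calc _ = (NormedSpace.exp (-(θ • Y)) * NormedSpace.exp (θ • Y)) *
        (Real.cos θ • Z - Real.sin θ • T) *
        (NormedSpace.exp (-(θ • Y)) * NormedSpace.exp (θ • Y)) := by simp only [mul_assoc]
    _ = _ := by rw [hinv, one_mul, mul_one]

-- The operator norm serves only to make the matrices a Banach algebra; the identity itself does not
-- involve it.
open scoped Matrix.Norms.Operator in
theorem Matrix.exp_neg_mul_mul_exp_of_rotation {n : Type*} [Fintype n] [DecidableEq n]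
    {Y Z T : Matrix n n ℂ} (h1 : Y * Z - Z * Y = T) (h2 : Y * T - T * Y = -Z) (θ : ℝ) :
    NormedSpace.exp (-((θ : ℂ) • Y)) * Z * NormedSpace.exp ((θ : ℂ) • Y) =
      (Real.cos θ : ℂ) • Z - (Real.sin θ : ℂ) • T := by
  have := SpinLattice.exp_neg_mul_mul_exp_of_rotation h1 h2 θ
  have e : ∀ (r : ℝ) (X : Matrix n n ℂ), (r : ℂ) • X = r • X := fun r X => by
    ext i j
    simp
  rw [e, e, e]
  exact this

/-- The generator of the coherent state is θ `Y`, and `Y`, `Sz`, `T` satisfy the rotation relations,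
while `Sp` and `Sm` are multiples of `T - Y` and `T + Y`. An expectation becomes the highest-weight
entry of a conjugated matrix; that entry is N/2 for `Sz` and zero for `Y` and `T`, so only the `Sz`
part of the rotated matrix counts. -/
theorem coherentVector_expectation {N : ℕ} {m : E 3} (hm : ‖m‖ = 1) (i : Fin 3) :
    star (coherentVector N m) ⬝ᵥ (spinMatrix N i *ᵥ coherentVector N m) =
      (N : ℂ) / 2 * coord i m := by
  set φ : ℂ := (Complex.arg ((m 0 : ℂ) + Complex.I * (m 1 : ℂ)) : ℂ) with hφ
  set θ := Real.arccos (m 2) with hθ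
  set a := Complex.exp (Complex.I * φ) with ha
  set a' := Complex.exp (-(Complex.I * φ)) with ha'
  set r : ℂ := ((Real.sqrt 2 : ℝ) : ℂ) with hr
  have haa : a * a' = 1 := by rw [ha, ha', ← Complex.exp_add, add_neg_cancel, Complex.exp_zero]
  have hrr : r * r = 2 := by
    rw [hr, ← Complex.ofReal_mul, Real.mul_self_sqrt (by norm_num)]; norm_num
  have hr0 : r ≠ 0 := fun h => by rw [h] at hrr; norm_num at hrr
  have hri : r⁻¹ * r⁻¹ = 2⁻¹ := by rw [← mul_inv, hrr]
  set Sp := spinMatrix N 0 with hSp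
  set Sz := spinMatrix N 1 with hSz
  set Sm := spinMatrix N 2 with hSm
  have hpm : Sp * Sm - Sm * Sp = Sz := spinMatrix_zero_two_commutator N
  have hpz : Sp * Sz - Sz * Sp = -Sp := spinMatrix_zero_one_commutator N
  have hmz : Sm * Sz - Sz * Sm = Sm := spinMatrix_two_one_commutator N
  set Y := r⁻¹ • (a • Sm - a' • Sp) with hY
  set T := r⁻¹ • (a • Sm + a' • Sp) with hT
  have hG : coherentGenerator N m = (θ : ℂ) • Y := by
    rw [hY, smul_smul, coherentGenerator]
    push_cast
    rw [div_eq_mul_inv]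
  have hYZ : Y * Sz - Sz * Y = T := by
    have h1 : Sp * Sz = Sz * Sp - Sp := by rw [sub_eq_add_neg, ← hpz]; abel
    have h2 : Sm * Sz = Sz * Sm + Sm := by nth_rewrite 3 [← hmz]; abel
    rw [hY, hT]
    simp only [smul_mul_assoc, mul_smul_comm, sub_mul, mul_sub, h1, h2, smul_add, smul_sub]
    abel
  have hYT : Y * T - T * Y = -Sz := by
    rw [← hpm, hY, hT]
    have e1 : r⁻¹ • (a • Sm - a' • Sp) * r⁻¹ • (a • Sm + a' • Sp) -
        r⁻¹ • (a • Sm + a' • Sp) * r⁻¹ • (a • Sm - a' • Sp) =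
        (2 * (r⁻¹ * r⁻¹) * (a * a')) • (Sm * Sp - Sp * Sm) := by
      simp only [smul_mul_assoc, mul_smul_comm, sub_mul, mul_sub, add_mul, mul_add]
      module
    rw [e1, hri, haa, neg_sub]
    norm_num
  have hexpect : ∀ X : Matrix (Fin (N + 1)) (Fin (N + 1)) ℂ,
      star (coherentVector N m) ⬝ᵥ (X *ᵥ coherentVector N m) =
        (NormedSpace.exp (-((θ : ℂ) • Y)) * X * NormedSpace.exp ((θ : ℂ) • Y)) 0 0 := by
    intro X
    have h1 : (NormedSpace.exp (coherentGenerator N m))ᴴ =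
        NormedSpace.exp (-coherentGenerator N m) := by
      rw [← Matrix.exp_conjTranspose, coherentGenerator_conjTranspose]
    unfold coherentVector
    rw [Matrix.star_mulVec, Matrix.dotProduct_mulVec, Matrix.vecMul_vecMul, Matrix.dotProduct_mulVec,
      Matrix.vecMul_vecMul, h1, hG]
    have : star (Pi.single 0 1 : Fin (N + 1) → ℂ) = Pi.single 0 1 := by
      ext j
      by_cases hj : j = 0
      · subst hj; simp
      · simp [hj]
    rw [this, Matrix.single_one_vecMul, dotProduct_single_one]
    rfl
  have hp00 : Sp 0 0 = 0 := by simp [hSp, spinMatrix]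
  have hm00 : Sm 0 0 = 0 := by simp [hSm, spinMatrix]
  have hz00 : Sz 0 0 = (N : ℂ) / 2 := by simp [hSz, spinMatrix]
  have hY00 : Y 0 0 = 0 := by simp [hY, hp00, hm00]
  have hT00 : T 0 0 = 0 := by simp [hT, hp00, hm00]
  have hEz := Matrix.exp_neg_mul_mul_exp_of_rotation hYZ hYT θ
  -- The rotation lemma also applies to the pair (`T`, `-Sz`), because the bracket of `Y` with `-Sz`
  -- is `-T`.
  have hET := Matrix.exp_neg_mul_mul_exp_of_rotation (Z := T) (T := -Sz) hYT
    (by rw [mul_neg, neg_mul, sub_neg_eq_add, neg_add_eq_sub, ← neg_sub, hYZ]) θ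
  have hEY : NormedSpace.exp (-((θ : ℂ) • Y)) * Y * NormedSpace.exp ((θ : ℂ) • Y) = Y := by
    have h1 : Commute (-((θ : ℂ) • Y)) Y := ((Commute.refl Y).smul_left _).neg_left
    rw [h1.exp_left.eq, mul_assoc, ← Matrix.exp_add_of_commute _ _
      (Commute.refl ((θ : ℂ) • Y)).neg_left, neg_add_cancel, NormedSpace.exp_zero, mul_one]
  have hnorm : m 0 ^ 2 + m 1 ^ 2 + m 2 ^ 2 = 1 := by
    have := EuclideanSpace.norm_sq_eq m
    rw [hm, Fin.sum_univ_three] at this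
    simp only [Real.norm_eq_abs, sq_abs] at this
    linarith
  have hcos : Real.cos θ = m 2 := Real.cos_arccos (by nlinarith [sq_nonneg (m 0), sq_nonneg (m 1)])
    (by nlinarith [sq_nonneg (m 0), sq_nonneg (m 1)])
  have hsin : Real.sin θ = ‖(m 0 : ℂ) + Complex.I * (m 1 : ℂ)‖ := by
    rw [hθ, Real.sin_arccos, mul_comm, Complex.norm_add_mul_I]
    congr 1
    linarith
  -- At the poles φ is only a convention (the argument of 0), but there sin θ = 0.
  have hpol : (Real.sin θ : ℂ) * a = (m 0 : ℂ) + Complex.I * (m 1 : ℂ) := by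
    rw [hsin, ha, mul_comm Complex.I φ, hφ]
    exact Complex.norm_mul_exp_arg_mul_I _
  have hpol' : (Real.sin θ : ℂ) * a' = (m 0 : ℂ) - Complex.I * (m 1 : ℂ) := by
    have h1 := congrArg (starRingEnd ℂ) hpol
    have h2 : (starRingEnd ℂ) a = a' := by
      rw [ha, ha', ← Complex.exp_conj, map_mul, Complex.conj_I, hφ, Complex.conj_ofReal, neg_mul]
    rw [map_mul, h2, map_add, map_mul, Complex.conj_I, Complex.conj_ofReal, Complex.conj_ofReal,
      Complex.conj_ofReal] at h1
    rw [h1]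
    ring
  fin_cases i
  · have h1 : Sp = (a * r⁻¹) • (T - Y) := by
      rw [hT, hY, ← smul_sub, smul_smul]
      have : a • Sm + a' • Sp - (a • Sm - a' • Sp) = (2 * a') • Sp := by
        rw [two_mul, add_smul]; abel
      rw [this, smul_smul, show a * r⁻¹ * r⁻¹ * (2 * a') = (a * a') * (r⁻¹ * r⁻¹) * 2 by ring,
        haa, hri]
      norm_num
    change star (coherentVector N m) ⬝ᵥ (Sp *ᵥ coherentVector N m) = _
    rw [hexpect, h1, mul_smul_comm, smul_mul_assoc, mul_sub, sub_mul, hET, hEY]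
    simp only [Matrix.smul_apply, Matrix.sub_apply, Matrix.neg_apply, hY00, hT00, hz00,
      smul_eq_mul, coord, ← hpol, ← hr]
    ring
  · change star (coherentVector N m) ⬝ᵥ (Sz *ᵥ coherentVector N m) = _
    rw [hexpect, hEz]
    simp only [Matrix.smul_apply, Matrix.sub_apply, hT00, hz00, smul_eq_mul, coord,
      hcos]
    ring
  · have h1 : Sm = (a' * r⁻¹) • (T + Y) := by
      rw [hT, hY, ← smul_add, smul_smul]
      have : a • Sm + a' • Sp + (a • Sm - a' • Sp) = (2 * a) • Sm := by
        rw [two_mul, add_smul]; abel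
      rw [this, smul_smul, show a' * r⁻¹ * r⁻¹ * (2 * a) = (a * a') * (r⁻¹ * r⁻¹) * 2 by ring,
        haa, hri]
      norm_num
    change star (coherentVector N m) ⬝ᵥ (Sm *ᵥ coherentVector N m) = _
    rw [hexpect, h1, mul_smul_comm, smul_mul_assoc, mul_add, add_mul, hET, hEY]
    simp only [Matrix.smul_apply, Matrix.sub_apply, Matrix.add_apply, Matrix.neg_apply, hY00, hT00,
      hz00, smul_eq_mul, coord, ← hpol', ← hr]
    ring


/-! ### Riemann sums -/

section Riemann

variable {d : ℕ} {P : Type*} [Fintype P]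

/-- The site of the lattice cell containing `y`. -/
noncomputable def floorSite (h : ℝ) (y : E d) : Site d := fun j => ⌊y j / h⌋

theorem measurable_floorSite (h : ℝ) : Measurable (floorSite (d := d) h) := by
  refine measurable_pi_iff.2 fun j => Int.measurable_floor.comp ?_
  have : Measurable fun y : E d => y j := by fun_prop
  exact this.div_const h

theorem floorSite_eq_iff {h : ℝ} (hh : 0 < h) (y : E d) (n : Site d) :
    floorSite h y = n ↔ ∀ j, y j ∈ Set.Ico (h * n j) (h * n j + h) := by
  rw [funext_iff]
  refine forall_congr' fun j => ?_
  rw [floorSite, Int.floor_eq_iff, le_div_iff₀ hh, div_lt_iff₀ hh, Set.mem_Ico, mul_comm,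
    add_mul, one_mul, mul_comm h]

theorem norm_latticePoint_floorSite_sub_le {h : ℝ} (hh : 0 < h) (y : E d) :
    ‖latticePoint h (floorSite h y) - y‖ ≤ Real.sqrt d * h := by
  have h1 : ∀ j, ‖(latticePoint h (floorSite h y) - y) j‖ ^ 2 ≤ h ^ 2 := by
    intro j
    have h2 := (floorSite_eq_iff hh y _).1 rfl j
    rw [Set.mem_Ico] at h2
    rw [Real.norm_eq_abs, sq_abs]
    change (h * (floorSite h y j : ℝ) - y j) ^ 2 ≤ h ^ 2
    nlinarith
  rw [EuclideanSpace.norm_eq]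
  refine (Real.sqrt_le_sqrt (Finset.sum_le_sum fun j _ => h1 j)).trans ?_
  rw [Finset.sum_const, Finset.card_univ, Fintype.card_fin, nsmul_eq_mul,
    Real.sqrt_mul (Nat.cast_nonneg _), Real.sqrt_sq hh.le]

theorem tendsto_latticePoint_floorSite (y : E d) :
    Tendsto (fun h => latticePoint h (floorSite h y)) (𝓝[>] 0) (𝓝 y) := by
  rw [tendsto_iff_norm_sub_tendsto_zero]
  have h1 : Tendsto (fun h : ℝ => Real.sqrt d * h) (𝓝[>] 0) (𝓝 0) := by
    have : Tendsto (fun h : ℝ => Real.sqrt d * h) (𝓝 0) (𝓝 (Real.sqrt d * 0)) :=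
      tendsto_id.const_mul _
    rw [mul_zero] at this
    exact this.mono_left nhdsWithin_le_nhds
  refine squeeze_zero' (Eventually.of_forall fun _ => norm_nonneg _) ?_ h1
  filter_upwards [self_mem_nhdsWithin] with h hh
  exact norm_latticePoint_floorSite_sub_le hh y

theorem volume_floorSite_eq {h : ℝ} (hh : 0 < h) (n : Site d) :
    volume {y : E d | floorSite h y = n} = ENNReal.ofReal (h ^ d) := by
  have h1 : {y : E d | floorSite h y = n} =
      WithLp.ofLp ⁻¹' (Set.univ.pi fun j => Set.Ico (h * n j) (h * n j + h)) := by
    ext y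
    simp [floorSite_eq_iff hh, Set.mem_pi]
  rw [h1, (PiLp.volume_preserving_ofLp (Fin d)).measure_preimage
    (MeasurableSet.univ_pi fun j => measurableSet_Ico).nullMeasurableSet, volume_pi_pi]
  simp only [Real.volume_Ico, add_sub_cancel_left, Finset.prod_const, Finset.card_univ,
    Fintype.card_fin]
  rw [ENNReal.ofReal_pow hh.le]

theorem measurable_floorSite_pi {Q : Type*} (h : ℝ) :
    Measurable fun (y : Q → E d) k => floorSite h (y k) :=
  measurable_pi_iff.2 fun k => (measurable_floorSite h).comp (measurable_pi_apply k)

theorem map_floorSite_real_singleton {h : ℝ} (hh : 0 < h) (z : P → Site d) :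
    (Measure.map (fun (y : P → E d) k => floorSite h (y k)) volume).real {z} =
      h ^ (Fintype.card P * d) := by
  rw [Measure.real, Measure.map_apply (measurable_floorSite_pi h) (measurableSet_singleton z)]
  have h1 : (fun (y : P → E d) k => floorSite h (y k)) ⁻¹' {z} =
      Set.univ.pi fun k => {y : E d | floorSite h y = z k} := by
    ext y
    simp [funext_iff, Set.mem_pi]
  rw [h1, volume_pi_pi]
  simp only [volume_floorSite_eq hh, Finset.prod_const, Finset.card_univ]
  rw [← ENNReal.ofReal_pow (by positivity), ENNReal.toReal_ofReal (by positivity), ← pow_mul,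
    mul_comm]

/-- Lattice sums converge to integrals. -/
theorem tendsto_lattice_sum (a : ℝ → (P → Site d) → ℂ) (φ : (P → E d) → ℂ) (C R : ℝ)
    (hC : ∀ᶠ h in 𝓝[>] (0 : ℝ), ∀ z, ‖a h z‖ ≤ C)
    (hR : ∀ᶠ h in 𝓝[>] (0 : ℝ), ∀ z, a h z ≠ 0 → ∀ k, ‖latticePoint h (z k)‖ ≤ R)
    (hlim : ∀ᵐ y : P → E d,
      Tendsto (fun h => a h (fun k => floorSite h (y k))) (𝓝[>] 0) (𝓝 (φ y))) :
    Tendsto (fun h : ℝ => ((h ^ (Fintype.card P * d) : ℝ) : ℂ) * ∑' z, a h z) (𝓝[>] 0)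
      (𝓝 (∫ y, φ y)) := by
  -- A point is within √d h of its lattice point, hence within √d once h ≤ 1; the maximum with 0
  -- makes the radius usable for the norm on the product.
  set R' := max (R + Real.sqrt d) 0 with hR'
  let bound : (P → E d) → ℝ := Set.indicator (Metric.closedBall 0 R') fun _ => C
  have hbint : Integrable bound := by
    rw [integrable_indicator_iff measurableSet_closedBall]
    exact integrableOn_const (measure_closedBall_lt_top).ne
  have hmeas : ∀ h, Measurable fun y : P → E d => a h (fun k => floorSite h (y k)) := fun h =>
    (Measurable.of_discrete (f := a h)).comp (measurable_floorSite_pi h)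
  have hle : ∀ᶠ h in 𝓝[>] (0 : ℝ), ∀ y : P → E d,
      ‖a h (fun k => floorSite h (y k))‖ ≤ bound y := by
    filter_upwards [hC, hR, Ioc_mem_nhdsGT (zero_lt_one (α := ℝ))] with h h1 h2 h3 y
    by_cases hy : y ∈ Metric.closedBall (0 : P → E d) R'
    · simp only [bound, Set.indicator_of_mem hy]
      exact h1 _
    · simp only [bound, Set.indicator_of_notMem hy, norm_le_zero_iff]
      by_contra hne
      apply hy
      rw [mem_closedBall_zero_iff, pi_norm_le_iff_of_nonneg (le_max_right _ _)]
      intro k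
      have h4 := h2 _ hne k
      have h5 := norm_latticePoint_floorSite_sub_le h3.1 (y k)
      have h6 : ‖y k‖ ≤ ‖latticePoint h (floorSite h (y k))‖ +
          ‖latticePoint h (floorSite h (y k)) - y k‖ := by
        rw [← norm_neg (latticePoint h (floorSite h (y k)) - y k), neg_sub]
        simpa using norm_add_le (latticePoint h (floorSite h (y k)))
          (y k - latticePoint h (floorSite h (y k)))
      have h7 : Real.sqrt d * h ≤ Real.sqrt d :=
        mul_le_of_le_one_right (Real.sqrt_nonneg _) h3.2
      exact (by linarith : ‖y k‖ ≤ R + Real.sqrt d).trans (le_max_left _ _)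
  have hmain := tendsto_integral_filter_of_dominated_convergence bound
    (Eventually.of_forall fun h => (hmeas h).aestronglyMeasurable)
    (hle.mono fun h hh => Eventually.of_forall hh) hbint hlim
  refine hmain.congr' ?_
  filter_upwards [hle, self_mem_nhdsWithin] with h h1 (h2 : 0 < h)
  have hint : Integrable (fun y : P → E d => a h (fun k => floorSite h (y k))) :=
    hbint.mono' (hmeas h).aestronglyMeasurable (Eventually.of_forall h1)
  have hF := (measurable_floorSite_pi (Q := P) (d := d) h).aemeasurable (μ := volume)
  have hg : AEStronglyMeasurable (a h)
      (Measure.map (fun (y : P → E d) k => floorSite h (y k)) volume) :=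
    (Measurable.of_discrete (f := a h)).aestronglyMeasurable
  -- The integral of the step function is an integral against the image of Lebesgue measure under
  -- `floorSite`, which gives every tuple of sites the mass of its cell.
  rw [← integral_map hF hg, integral_countable ((integrable_map_measure hg hF).2 hint)]
  simp only [map_floorSite_real_singleton h2, Complex.real_smul, tsum_mul_left]

end Riemann


section ListProd

variable {R : Type*} [Ring R] {P : Type*} [DecidableEq P]

theorem prod_map_mul_sub_mul_prod_map {o : List P} (ho : o.Nodup) (F : P → R) (z : R) :
    (o.map F).prod * z - z * (o.map F).prod =
      ∑ k ∈ o.toFinset, (o.map (Function.update F k (F k * z - z * F k))).prod := by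
  have h := mul_prod_map_sub_prod_map_mul ho F z
  rw [← neg_sub, h, ← Finset.sum_neg_distrib]
  refine Finset.sum_congr rfl fun k hk => ?_
  obtain ⟨a, b, hab⟩ := exists_prod_map_update ho F (List.mem_toFinset.1 hk)
  rw [hab, hab]
  noncomm_ring

end ListProd

/-! ### The commutator of an interaction term with a spin -/

/-- The order of the factors of a normal-ordered monomial. -/
def slots {p : ℕ} (q : Fin p → Fin 3) : List (Fin p) :=
  (List.finRange 3).flatMap fun j => (List.finRange p).filter fun k => q k = j

theorem mem_slots {p : ℕ} (q : Fin p → Fin 3) (k : Fin p) : k ∈ slots q := by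
  simp [slots]

theorem nodup_slots {p : ℕ} (q : Fin p → Fin 3) : (slots q).Nodup := by
  rw [slots, List.nodup_flatMap]
  refine ⟨fun j _ => (List.nodup_finRange p).filter _, ?_⟩
  refine (List.nodup_finRange 3).imp fun {a b} hab => ?_
  intro k h1 h2
  simp only [List.mem_filter, List.mem_finRange, true_and, decide_eq_true_eq] at h1 h2
  exact hab (h1.symm.trans h2)

theorem normalOrdered_eq {d N p : ℕ} (h : ℝ) (i : Fin p → Fin 3) (x : Fin p → Site d) :
    (normalOrdered h i x : quasiLocalAlgebra d N) =
      ((slots i).map fun k => spin h (i k) (x k)).prod := by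
  rw [normalOrdered, slots, List.map_flatMap, List.flatMap, List.prod_flatten, List.map_map]
  refine congrArg List.prod (List.map_congr_left fun j _ => ?_)
  refine congrArg List.prod (List.map_congr_left fun k hk => ?_)
  rw [← of_decide_eq_true (List.mem_filter.1 hk).2]

theorem sum_pi_coe {ι M : Type*} [Fintype ι] [DecidableEq ι] [AddCommMonoid M] {α : Type*}
    (Λ : Finset α) (g : (ι → α) → M) :
    ∑ x : ι → Λ, g (fun k => x k) = ∑ y ∈ Fintype.piFinset fun _ : ι => Λ, g y := by
  refine Finset.sum_bij' (fun x _ k => (x k : α))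
    (fun y hy k => ⟨y k, Fintype.mem_piFinset.1 hy k⟩) ?_ ?_ ?_ ?_ ?_
  · exact fun x _ => Fintype.mem_piFinset.2 fun k => (x k).2
  · exact fun _ _ => Finset.mem_univ _
  · exact fun _ _ => rfl
  · exact fun _ _ => rfl
  · exact fun _ _ => rfl

theorem sum_piFinset_of_zero_eq {n : ℕ} {α M : Type*} [DecidableEq α] [AddCommMonoid M]
    (Λ : Finset α) (s : α) (G : (Fin (n + 1) → α) → M) :
    ∑ y ∈ Fintype.piFinset (fun _ : Fin (n + 1) => Λ), (if y 0 = s then G y else 0) =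
      ∑ y ∈ Fintype.piFinset (fun _ : Fin n => Λ),
        if s ∈ Λ then G (Fin.cons s y : Fin (n + 1) → α) else 0 := by
  by_cases hs : s ∈ Λ
  · rw [← Finset.sum_filter]
    simp only [hs, if_true]
    refine Finset.sum_bij' (fun y _ => Fin.tail y)
      (fun y _ => (Fin.cons s y : Fin (n + 1) → α)) ?_ ?_ ?_ ?_ ?_
    · intro y hy
      rw [Finset.mem_filter, Fintype.mem_piFinset] at hy
      exact Fintype.mem_piFinset.2 fun k => hy.1 k.succ
    · intro y hy
      rw [Fintype.mem_piFinset] at hy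
      rw [Finset.mem_filter, Fintype.mem_piFinset]
      exact ⟨fun k => Fin.cases hs hy k, rfl⟩
    · intro y hy
      obtain rfl := (Finset.mem_filter.1 hy).2
      exact Fin.cons_self_tail y
    · exact fun y _ => Fin.tail_cons _ _
    · intro y hy
      obtain rfl := (Finset.mem_filter.1 hy).2
      rw [Fin.cons_self_tail y]
  · simp only [hs, if_false, Finset.sum_const_zero]
    refine Finset.sum_eq_zero fun y hy => if_neg fun h => hs ?_
    exact h ▸ Fintype.mem_piFinset.1 hy 0

/-- The order of the factors of `:Ŝ(V^(n)):` after its `l`-th factor has been moved to the label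
`0` by a transposition. -/
def block {n : ℕ} (l : Fin (n + 1)) (q : Fin (n + 1) → Fin 3) : List (Fin (n + 1)) :=
  (slots (q ∘ Equiv.swap 0 l)).map (Equiv.swap 0 l)

theorem mem_block {n : ℕ} (l : Fin (n + 1)) (q : Fin (n + 1) → Fin 3) (k : Fin (n + 1)) :
    k ∈ block l q :=
  List.mem_map.2 ⟨Equiv.swap 0 l k, mem_slots _ _, Equiv.swap_apply_self 0 l k⟩

theorem nodup_block {n : ℕ} (l : Fin (n + 1)) (q : Fin (n + 1) → Fin 3) : (block l q).Nodup :=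
  (nodup_slots _).map (Equiv.swap 0 l).injective


/-! The commutator is computed in any algebra with the commutation relations of the spins. -/

/-- The transposition renames the distinguished factor `l` to `0`; the list is renamed along with
it, so the actual order of the operators is unchanged. -/
theorem prod_slots_swap {A α : Type*} [Monoid A] {S : Fin 3 → α → A} {n : ℕ}
    (l : Fin (n + 1)) (q : Fin (n + 1) → Fin 3)
    (y : Fin (n + 1) → α) (z : A) :
    ((slots (q ∘ Equiv.swap 0 l)).map (Function.update
      (fun k => S ((q ∘ Equiv.swap 0 l) k) ((y ∘ Equiv.swap 0 l) k)) l z)).prod =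
      ((block l q).map (Function.update (fun k => S (q k) (y k)) 0 z)).prod := by
  rw [block, List.map_map]
  refine congrArg List.prod (List.map_congr_left fun k _ => ?_)
  simp only [Function.comp_apply]
  by_cases hk : k = l
  · subst hk
    rw [Equiv.swap_apply_right, Function.update_self, Function.update_self]
  · have : Equiv.swap 0 l k ≠ 0 := fun h => hk (by
      rw [← Equiv.swap_apply_self 0 l k, h, Equiv.swap_apply_left])
    rw [Function.update_of_ne hk, Function.update_of_ne this]

theorem sum_swap {α : Type*} {n : ℕ} (l : Fin (n + 1)) (Λ : Finset α) {M : Type*}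
    [AddCommMonoid M]
    (G : (Fin (n + 1) → Fin 3) → (Fin (n + 1) → α) → M) :
    ∑ q, ∑ y ∈ Fintype.piFinset (fun _ : Fin (n + 1) => Λ),
      G (q ∘ Equiv.swap 0 l) (y ∘ Equiv.swap 0 l) =
    ∑ q, ∑ y ∈ Fintype.piFinset (fun _ : Fin (n + 1) => Λ), G q y := by
  have hinv : ∀ y : Fin (n + 1) → α, (y ∘ Equiv.swap 0 l) ∘ Equiv.swap 0 l = y := fun y => by
    funext k
    simp
  have hinv' : ∀ q : Fin (n + 1) → Fin 3, (q ∘ Equiv.swap 0 l) ∘ Equiv.swap 0 l = q := fun q => by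
    funext k
    simp
  refine Finset.sum_bij' (fun q _ => q ∘ Equiv.swap 0 l) (fun q _ => q ∘ Equiv.swap 0 l)
    (fun _ _ => Finset.mem_univ _) (fun _ _ => Finset.mem_univ _) (fun q _ => hinv' q)
    (fun q _ => hinv' q) fun q _ => ?_
  have hmem : ∀ y ∈ Fintype.piFinset (fun _ : Fin (n + 1) => Λ),
      y ∘ Equiv.swap 0 l ∈ Fintype.piFinset (fun _ : Fin (n + 1) => Λ) := fun y hy =>
    Fintype.mem_piFinset.2 fun k => Fintype.mem_piFinset.1 hy _
  refine Finset.sum_bij' (fun y _ => y ∘ Equiv.swap 0 l) (fun y _ => y ∘ Equiv.swap 0 l)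
    hmem hmem (fun y _ => hinv y) (fun y _ => hinv y) fun y _ => rfl

section AbstractSpin

variable {A : Type*} [Ring A] [Algebra ℂ A] {α : Type*} [DecidableEq α] {S : Fin 3 → α → A} {κ : ℂ}

theorem prod_slots_commutator
    (hS : ∀ i j x y, S i x * S j y - S j y * S i x =
      if x = y then κ • ∑ m, epsT i j m • S m y else 0)
    {n : ℕ} (q : Fin (n + 1) → Fin 3) (y : Fin (n + 1) → α) (i : Fin 3) (s : α) :
    ((slots q).map fun k => S (q k) (y k)).prod * S i s -
        S i s * ((slots q).map fun k => S (q k) (y k)).prod =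
      ∑ l, ∑ m, if y l = s then (κ * epsT (q l) i m) • ((slots q).map
        (Function.update (fun k => S (q k) (y k)) l (S m s))).prod else 0 := by
  rw [prod_map_mul_sub_mul_prod_map (nodup_slots q)]
  have : (slots q).toFinset = Finset.univ :=
    Finset.eq_univ_of_forall fun k => List.mem_toFinset.2 (mem_slots q k)
  rw [this]
  refine Finset.sum_congr rfl fun l _ => ?_
  obtain ⟨a, b, hab⟩ := exists_prod_map_update (nodup_slots q)
    (fun k => S (q k) (y k)) (mem_slots q l)
  simp only [hab]
  rw [hS]
  by_cases hl : y l = s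
  · simp only [hl, if_true, mul_smul_comm, smul_mul_assoc, Finset.mul_sum, Finset.sum_mul,
      Finset.smul_sum, mul_smul]
  · simp only [if_neg hl, mul_zero, zero_mul, Finset.sum_const_zero]

/-- Each of the n + 1 spins of the interaction can meet the spin at `s`. Symmetry of the kernel
allows that spin to be called the first one, so `s` always enters as the first argument. The sum
over `l` stays because the position of the replaced factor in the product still depends on it. -/
theorem interaction_commutator
    (hS : ∀ i j x y, S i x * S j y - S j y * S i x =
      if x = y then κ • ∑ m, epsT i j m • S m y else 0)
    {n : ℕ} (Λ : Finset α) (g : (Fin (n + 1) → Fin 3) → (Fin (n + 1) → α) → ℂ)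
    (hg : ∀ (σ : Equiv.Perm (Fin (n + 1))) q y, g (q ∘ σ) (y ∘ σ) = g q y) (i : Fin 3) (s : α) :
    (∑ q, ∑ y ∈ Fintype.piFinset (fun _ : Fin (n + 1) => Λ),
        g q y • ((slots q).map fun k => S (q k) (y k)).prod) * S i s -
      S i s * (∑ q, ∑ y ∈ Fintype.piFinset (fun _ : Fin (n + 1) => Λ),
        g q y • ((slots q).map fun k => S (q k) (y k)).prod) =
      κ • ∑ l : Fin (n + 1), ∑ q : Fin (n + 1) → Fin 3,
        ∑ m : Fin 3, ∑ y ∈ Fintype.piFinset (fun _ : Fin n => Λ),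
          if s ∈ Λ then (epsT (q 0) i m * g q (Fin.cons s y : Fin (n + 1) → α)) •
            ((block l q).map (Fin.cons (S m s) fun r => S (q r.succ) (y r))).prod
          else 0 := by
  have h1 : (∑ q, ∑ y ∈ Fintype.piFinset (fun _ : Fin (n + 1) => Λ),
        g q y • ((slots q).map fun k => S (q k) (y k)).prod) * S i s -
      S i s * (∑ q, ∑ y ∈ Fintype.piFinset (fun _ : Fin (n + 1) => Λ),
        g q y • ((slots q).map fun k => S (q k) (y k)).prod) =
      ∑ q, ∑ y ∈ Fintype.piFinset (fun _ : Fin (n + 1) => Λ), ∑ l,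
        ∑ m, if y l = s then (g q y * (κ * epsT (q l) i m)) • ((slots q).map
          (Function.update (fun k => S (q k) (y k)) l (S m s))).prod else 0 := by
    simp only [Finset.sum_mul, Finset.mul_sum, ← Finset.sum_sub_distrib, smul_mul_assoc,
      mul_smul_comm, ← smul_sub, prod_slots_commutator hS, Finset.smul_sum, smul_ite, smul_zero,
      smul_smul]
  rw [h1]
  have h2 : ∀ q : Fin (n + 1) → Fin 3, ∑ y ∈ Fintype.piFinset (fun _ : Fin (n + 1) => Λ), ∑ l,
        ∑ m, (if y l = s then (g q y * (κ * epsT (q l) i m)) • ((slots q).map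
          (Function.update (fun k => S (q k) (y k)) l (S m s))).prod else 0) =
      ∑ l, ∑ y ∈ Fintype.piFinset (fun _ : Fin (n + 1) => Λ),
        ∑ m, (if y l = s then (g q y * (κ * epsT (q l) i m)) • ((slots q).map
          (Function.update (fun k => S (q k) (y k)) l (S m s))).prod else 0) :=
    fun q => Finset.sum_comm
  simp only [h2]
  rw [Finset.sum_comm, Finset.smul_sum]
  refine Finset.sum_congr rfl fun l _ => ?_
  -- Indices and sites are permuted together here; `hg` then removes the permutation from the
  -- kernel, and `prod_slots_swap` removes it from the product.
  rw [← sum_swap l, Finset.smul_sum]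
  refine Finset.sum_congr rfl fun q _ => ?_
  rw [Finset.sum_comm, Finset.smul_sum]
  refine Finset.sum_congr rfl fun m _ => ?_
  simp only [hg, prod_slots_swap]
  simp only [Function.comp_apply, Equiv.swap_apply_right]
  rw [sum_piFinset_of_zero_eq Λ s (fun y => (g q y * (κ * epsT (q 0) i m)) • ((block l q).map
          (Function.update (fun k => S (q k) (y k)) 0 (S m s))).prod), Finset.smul_sum]
  refine Finset.sum_congr rfl fun y _ => ?_
  rw [smul_ite, smul_zero, smul_smul]
  refine if_congr Iff.rfl ?_ rfl
  congr 1
  · ring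
  · refine congrArg List.prod (List.map_congr_left fun k _ => ?_)
    refine Fin.cases ?_ (fun r => ?_) k
    · simp
    · rw [Function.update_of_ne (Fin.succ_ne_zero r)]
      simp

end AbstractSpin

theorem smearedSpinOn_eq {d N p : ℕ} (h : ℝ) (Λ : Finset (Site d)) (f : Kernel d p) :
    (smearedSpinOn h Λ f : quasiLocalAlgebra d N) =
      ∑ q, ∑ y ∈ Fintype.piFinset (fun _ : Fin p => Λ),
        f q (fun k => latticePoint h (y k)) • ((slots q).map fun k => spin h (q k) (y k)).prod := by
  simp only [← normalOrdered_eq]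
  exact Finset.sum_congr rfl fun q _ => sum_pi_coe Λ
    fun y => f q (fun k => latticePoint h (y k)) • (normalOrdered h q y : quasiLocalAlgebra d N)


/-! ### The commutator with ordered monomials -/

/-- The order list `o`, with the entry `k` replaced by a block of entries. -/
def insertBlock {P : Type*} [DecidableEq P] {n : ℕ} (o : List P) (k : P) (L : List (Fin (n + 1))) :
    List (P ⊕ Fin n) :=
  o.flatMap fun k' => if k' = k then
    L.map (Fin.cons (Sum.inl k) Sum.inr : Fin (n + 1) → P ⊕ Fin n) else [Sum.inl k']

theorem cons_inl_inr_injective {P : Type*} {n : ℕ} (k : P) :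
    Function.Injective (Fin.cons (Sum.inl k) Sum.inr : Fin (n + 1) → P ⊕ Fin n) :=
  Fin.cons_injective_iff.2 ⟨by simp, Sum.inr_injective⟩

theorem mem_insertBlock {P : Type*} [DecidableEq P] {n : ℕ} {o : List P} (k : P)
    {L : List (Fin (n + 1))} (ho : ∀ k, k ∈ o) (hL : ∀ j, j ∈ L) (z : P ⊕ Fin n) :
    z ∈ insertBlock o k L := by
  rw [insertBlock, List.mem_flatMap]
  rcases z with k' | r
  · refine ⟨k', ho k', ?_⟩
    by_cases hk : k' = k
    · subst hk
      rw [if_pos rfl]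
      exact List.mem_map.2 ⟨0, hL 0, rfl⟩
    · simp [hk]
  · refine ⟨k, ho k, ?_⟩
    rw [if_pos rfl]
    exact List.mem_map.2 ⟨r.succ, hL _, rfl⟩

theorem nodup_insertBlock {P : Type*} [DecidableEq P] {n : ℕ} {o : List P} (k : P)
    {L : List (Fin (n + 1))} (ho : o.Nodup) (hL : L.Nodup) : (insertBlock o k L).Nodup := by
  rw [insertBlock, List.nodup_flatMap]
  refine ⟨fun k' _ => ?_, ho.imp fun {a b} hab => ?_⟩
  · split_ifs
    · exact hL.map (cons_inl_inr_injective k)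
    · exact List.nodup_singleton _
  · intro z h1 h2
    have key : ∀ a : P, z ∈ (if a = k then
        L.map (Fin.cons (Sum.inl k) Sum.inr : Fin (n + 1) → P ⊕ Fin n) else [Sum.inl a]) →
        (z = Sum.inl a) ∨ (a = k ∧ ∃ r, z = Sum.inr r) := by
      intro a ha
      split_ifs at ha with h
      · obtain ⟨j, -, rfl⟩ := List.mem_map.1 ha
        refine Fin.cases ?_ (fun r => ?_) j
        · exact Or.inl (by rw [h]; rfl)
        · exact Or.inr ⟨h, r, rfl⟩
      · exact Or.inl (List.mem_singleton.1 ha)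
    rcases key a h1 with h1 | ⟨h1, r, hr⟩ <;> rcases key b h2 with h2 | ⟨h2, r', hr'⟩
    · exact hab (Sum.inl_injective (h1.symm.trans h2))
    · rw [h1] at hr'; cases hr'
    · rw [h2] at hr; cases hr
    · exact hab (h1.trans h2.symm)

theorem prod_map_insertBlock {A P : Type*} [Monoid A] [DecidableEq P] {n : ℕ} (o : List P) (k : P)
    (L : List (Fin (n + 1))) (F : P ⊕ Fin n → A) :
    ((insertBlock o k L).map F).prod =
      (o.map (Function.update (fun k' => F (Sum.inl k')) k
        (L.map (Fin.cons (F (Sum.inl k)) fun r => F (Sum.inr r))).prod)).prod := by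
  rw [insertBlock, List.map_flatMap, List.flatMap, List.prod_flatten, List.map_map]
  refine congrArg List.prod (List.map_congr_left fun k' _ => ?_)
  simp only [Function.comp_apply]
  by_cases hk : k' = k
  · subst hk
    rw [if_pos rfl, Function.update_self, List.map_map]
    refine congrArg List.prod (List.map_congr_left fun j _ => ?_)
    refine Fin.cases ?_ (fun r => ?_) j <;> simp
  · rw [if_neg hk, Function.update_of_ne hk]
    simp

/-- The Leibniz rule over the factors of the monomial: the factor `k` is replaced, in place, by the
block coming from its commutator with the interaction. Since nothing is reordered, no correction
terms of higher order in κ appear. -/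
theorem interaction_commutator_prod {A : Type*} [Ring A] [Algebra ℂ A] {α : Type*} [DecidableEq α]
    {S : Fin 3 → α → A} {κ : ℂ}
    (hS : ∀ i j x y, S i x * S j y - S j y * S i x =
      if x = y then κ • ∑ m, epsT i j m • S m y else 0)
    {n : ℕ} (Λ : Finset α) (g : (Fin (n + 1) → Fin 3) → (Fin (n + 1) → α) → ℂ)
    (hg : ∀ (σ : Equiv.Perm (Fin (n + 1))) q y, g (q ∘ σ) (y ∘ σ) = g q y)
    {P : Type*} [Fintype P] [DecidableEq P] {o : List P} (ho : o.Nodup) (ho' : ∀ k, k ∈ o)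
    (idx : P → Fin 3) (x : P → α) :
    (∑ q, ∑ y ∈ Fintype.piFinset (fun _ : Fin (n + 1) => Λ),
        g q y • ((slots q).map fun k => S (q k) (y k)).prod) *
          (o.map fun k => S (idx k) (x k)).prod -
      (o.map fun k => S (idx k) (x k)).prod *
        (∑ q, ∑ y ∈ Fintype.piFinset (fun _ : Fin (n + 1) => Λ),
          g q y • ((slots q).map fun k => S (q k) (y k)).prod) =
      κ • ∑ k, ∑ l : Fin (n + 1), ∑ q : Fin (n + 1) → Fin 3,
        ∑ m : Fin 3, ∑ y ∈ Fintype.piFinset (fun _ : Fin n => Λ),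
          if x k ∈ Λ then
            (epsT (q 0) (idx k) m * g q (Fin.cons (x k) y : Fin (n + 1) → α)) •
              ((insertBlock o k (block l q)).map fun z =>
                S (Sum.elim (Function.update idx k m) (fun r => q r.succ) z)
                  (Sum.elim x y z)).prod
          else 0 := by
  rw [mul_prod_map_sub_prod_map_mul ho]
  have : o.toFinset = Finset.univ :=
    Finset.eq_univ_of_forall fun k => List.mem_toFinset.2 (ho' k)
  rw [this, Finset.smul_sum]
  refine Finset.sum_congr rfl fun k _ => ?_
  rw [interaction_commutator hS Λ g hg]
  obtain ⟨a, b, hab⟩ := exists_prod_map_update ho (fun k => S (idx k) (x k)) (ho' k)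
  have hchild : ∀ (l : Fin (n + 1)) (q : Fin (n + 1) → Fin 3) (m : Fin 3) (y : Fin n → α),
      ((insertBlock o k (block l q)).map fun z =>
        S (Sum.elim (Function.update idx k m) (fun r => q r.succ) z) (Sum.elim x y z)).prod =
      a * ((block l q).map (Fin.cons (S m (x k)) fun r => S (q r.succ) (y r))).prod * b := by
    intro l q m y
    rw [prod_map_insertBlock, ← hab]
    refine congrArg List.prod (List.map_congr_left fun k' _ => ?_)
    by_cases hk : k' = k
    · subst hk
      simp
    · simp [Function.update_of_ne hk]
  rw [hab]
  simp only [hchild, mul_smul_comm, smul_mul_assoc, Finset.mul_sum, Finset.sum_mul, mul_ite,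
    ite_mul, mul_zero, zero_mul]

/-! ### Observables -/

/-- A smeared ordered monomial in the spins: the finite type `P` labels the arguments, `ord` is the
order of the factors, `idx` their indices, and `ker` the smearing function. -/
structure Obs (d : ℕ) where
  P : Type
  fintypeP : Fintype P
  decEqP : DecidableEq P
  ord : List P
  nodup : ord.Nodup
  mem_ord : ∀ k, k ∈ ord
  idx : P → Fin 3
  ker : (P → E d) → ℂ
  continuous : Continuous ker
  compactSupport : HasCompactSupport ker

attribute [instance] Obs.fintypeP Obs.decEqP

namespace Obs

variable {d N : ℕ} {V : (n : ℕ) → Kernel d (n + 1)}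

/-- The number of arguments. -/
def deg (f : Obs d) : ℕ := Fintype.card f.P

theorem length_ord (f : Obs d) : f.ord.length = f.deg := by
  have h1 : f.ord.toFinset = Finset.univ :=
    Finset.eq_univ_of_forall fun k => List.mem_toFinset.2 (f.mem_ord k)
  rw [deg, ← Finset.card_univ, ← h1, List.toFinset_card_of_nodup f.nodup]

theorem exists_norm_le (f : Obs d) : ∃ R : ℝ, 0 ≤ R ∧ ∀ x, f.ker x ≠ 0 → ∀ k, ‖x k‖ ≤ R := by
  obtain ⟨R, hR⟩ := f.compactSupport.isCompact.isBounded.subset_closedBall 0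
  refine ⟨max R 0, le_max_right _ _, fun x hx k => ?_⟩
  have h1 := hR (subset_tsupport _ hx)
  rw [mem_closedBall_zero_iff] at h1
  exact (norm_le_pi_norm x k).trans (h1.trans (le_max_left _ _))

theorem exists_ker_le (f : Obs d) : ∃ C : ℝ, 0 ≤ C ∧ ∀ x, ‖f.ker x‖ ≤ C := by
  obtain ⟨C, hC⟩ := f.compactSupport.exists_bound_of_continuous f.continuous
  exact ⟨C, (norm_nonneg _).trans (hC 0), hC⟩

/-- The labels of the observables that appear in the commutator with `V^(n+1)`. -/
abbrev Idx (f : Obs d) (n : ℕ) : Type := f.P × Fin (n + 1) × (Fin (n + 1) → Fin 3) × Fin 3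

/-- The observables that appear in the commutator with `V^(n+1)`. -/
noncomputable def child (hV : IsPotential V) (f : Obs d) (n : ℕ) (b : f.Idx n) : Obs d where
  P := f.P ⊕ Fin n
  fintypeP := inferInstance
  decEqP := inferInstance
  ord := insertBlock f.ord b.1 (block b.2.1 b.2.2.1)
  nodup := nodup_insertBlock _ f.nodup (nodup_block _ _)
  mem_ord := mem_insertBlock _ f.mem_ord (mem_block _ _)
  idx := Sum.elim (Function.update f.idx b.1 b.2.2.2) fun r => b.2.2.1 r.succ
  -- Of the prefactor i s h^{-d} and the h^d/s of the commutator only the imaginary unit remains, so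
  -- the kernel is free of h.
  ker x := Complex.I * epsT (b.2.2.1 0) (f.idx b.1) b.2.2.2 * (f.ker (fun k => x (Sum.inl k)) *
    V n b.2.2.1 (Fin.cons (x (Sum.inl b.1)) fun r => x (Sum.inr r)))
  continuous := by
    have h1 : Continuous fun x : f.P ⊕ Fin n → E d =>
        (Fin.cons (x (Sum.inl b.1)) fun r => x (Sum.inr r) : Fin (n + 1) → E d) := by
      refine continuous_pi fun j => ?_
      refine Fin.cases ?_ (fun r => ?_) j
      · simpa using continuous_apply _
      · simpa using continuous_apply _
    have h2 := f.continuous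
    have h3 := (hV.smearing n).continuous b.2.2.1
    exact continuous_const.mul ((h2.comp (by fun_prop)).mul (h3.comp h1))
  compactSupport := by
    obtain ⟨R, hR0, hR⟩ := f.exists_norm_le
    obtain ⟨r, hr0, hr⟩ := hV.finiteRange
    -- Each new argument lies within the range `r n` of the old argument `b.1`, which itself has
    -- norm at most `R`.
    refine HasCompactSupport.intro (isCompact_closedBall 0 (R + r n)) fun x hx => ?_
    by_contra hne
    apply hx
    have h1 : f.ker (fun k => x (Sum.inl k)) ≠ 0 := fun h => hne (by rw [h]; simp)
    have h2 : V n b.2.2.1 (Fin.cons (x (Sum.inl b.1)) fun r => x (Sum.inr r)) ≠ 0 :=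
      fun h => hne (by rw [h]; simp)
    have h3 : ∀ j l : Fin (n + 1), ‖(Fin.cons (x (Sum.inl b.1)) fun r => x (Sum.inr r) :
        Fin (n + 1) → E d) j - (Fin.cons (x (Sum.inl b.1)) fun r => x (Sum.inr r) :
        Fin (n + 1) → E d) l‖ ≤ r n := by
      intro j l
      by_contra hjl
      exact h2 (hr n _ ⟨j, l, not_le.1 hjl⟩ _)
    have hr0' := hr0 n
    rw [mem_closedBall_zero_iff, pi_norm_le_iff_of_nonneg (by linarith)]
    rintro (k | s)
    · have := hR _ h1 k
      linarith
    · have h4 := hR _ h1 b.1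
      have h5 := h3 s.succ 0
      rw [Fin.cons_succ, Fin.cons_zero] at h5
      have h6 := norm_add_le (x (Sum.inr s) - x (Sum.inl b.1)) (x (Sum.inl b.1))
      rw [sub_add_cancel] at h6
      linarith

theorem deg_child (hV : IsPotential V) (f : Obs d) (n : ℕ) (b : f.Idx n) :
    (f.child hV n b).deg = f.deg + n := by
  change Fintype.card (f.P ⊕ Fin n) = _
  rw [Fintype.card_sum, Fintype.card_fin, deg]

/-! ### Lattice sums -/

theorem finite_norm_latticePoint_le {h : ℝ} (hh : 0 < h) (R : ℝ) :
    {s : Site d | ‖latticePoint h s‖ ≤ R}.Finite := by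
  refine (Fintype.piFinset fun _ : Fin d => Finset.Icc (-⌈R / h⌉) ⌈R / h⌉).finite_toSet.subset ?_
  intro s hs
  rw [Finset.mem_coe, Fintype.mem_piFinset]
  intro j
  have h1 : ‖latticePoint h s j‖ ≤ R := (PiLp.norm_apply_le _ j).trans hs
  change ‖h * (s j : ℝ)‖ ≤ R at h1
  rw [Real.norm_eq_abs, abs_mul, abs_of_pos hh, mul_comm, ← le_div_iff₀ hh] at h1
  have h2 : |(s j : ℝ)| ≤ (⌈R / h⌉ : ℤ) := h1.trans (Int.le_ceil _)
  rw [Finset.mem_Icc, ← abs_le]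
  exact_mod_cast h2

theorem exists_sites (f : Obs d) {h : ℝ} (hh : 0 < h) : ∃ F : Finset (Site d),
    ∀ x : f.P → Site d, f.ker (fun k => latticePoint h (x k)) ≠ 0 → ∀ k, x k ∈ F := by
  obtain ⟨R, -, hR⟩ := f.exists_norm_le
  refine ⟨(finite_norm_latticePoint_le hh R).toFinset, fun x hx k => ?_⟩
  rw [Set.Finite.mem_toFinset]
  exact hR _ hx k

/-- One term of the smeared monomial. -/
noncomputable def term (N : ℕ) (h : ℝ) (f : Obs d) (x : f.P → Site d) : quasiLocalAlgebra d N :=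
  f.ker (fun k => latticePoint h (x k)) • (f.ord.map fun k => spin h (f.idx k) (x k)).prod

/-- The smeared monomial as an operator. -/
noncomputable def quant (N : ℕ) (h : ℝ) (f : Obs d) : quasiLocalAlgebra d N :=
  ∑' x : f.P → Site d, f.term N h x

/-- A bound for the norm of the smeared monomial. -/
noncomputable def latNorm (h : ℝ) (f : Obs d) : ℝ :=
  (Real.sqrt 2 * h ^ d) ^ f.deg * ∑' x : f.P → Site d, ‖f.ker fun k => latticePoint h (x k)‖

theorem notMem_piFinset {h : ℝ} {f : Obs d} {F : Finset (Site d)}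
    (hF : ∀ x : f.P → Site d, f.ker (fun k => latticePoint h (x k)) ≠ 0 → ∀ k, x k ∈ F)
    (x : f.P → Site d) (hx : x ∉ Fintype.piFinset fun _ : f.P => F) :
    f.ker (fun k => latticePoint h (x k)) = 0 := by
  by_contra hne
  exact hx (Fintype.mem_piFinset.2 (hF x hne))

theorem quant_eq_sum {h : ℝ} {f : Obs d} {F : Finset (Site d)}
    (hF : ∀ x : f.P → Site d, f.ker (fun k => latticePoint h (x k)) ≠ 0 → ∀ k, x k ∈ F) :
    f.quant N h = ∑ x ∈ Fintype.piFinset fun _ : f.P => F, f.term N h x :=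
  tsum_eq_sum fun x hx => by rw [term, notMem_piFinset hF x hx, zero_smul]

theorem latNorm_eq_sum {h : ℝ} {f : Obs d} {F : Finset (Site d)}
    (hF : ∀ x : f.P → Site d, f.ker (fun k => latticePoint h (x k)) ≠ 0 → ∀ k, x k ∈ F) :
    f.latNorm h = (Real.sqrt 2 * h ^ d) ^ f.deg *
      ∑ x ∈ Fintype.piFinset fun _ : f.P => F, ‖f.ker fun k => latticePoint h (x k)‖ := by
  rw [latNorm, tsum_eq_sum fun x hx => by rw [notMem_piFinset hF x hx, norm_zero]]

theorem latNorm_nonneg {h : ℝ} (hh : 0 ≤ h) (f : Obs d) : 0 ≤ f.latNorm h :=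
  mul_nonneg (by positivity) (tsum_nonneg fun _ => norm_nonneg _)

theorem norm_term_le (hN : 0 < N) {h : ℝ} (hh : 0 ≤ h) (f : Obs d) (x : f.P → Site d) :
    ‖f.term N h x‖ ≤ (Real.sqrt 2 * h ^ d) ^ f.deg * ‖f.ker fun k => latticePoint h (x k)‖ := by
  rw [term, norm_smul, mul_comm]
  refine mul_le_mul_of_nonneg_right ?_ (norm_nonneg _)
  rw [← f.length_ord]
  have : ∀ o : List f.P, ‖((o.map fun k => (spin h (f.idx k) (x k) : quasiLocalAlgebra d N))).prod‖ ≤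
      (Real.sqrt 2 * h ^ d) ^ o.length := by
    intro o
    induction o with
    | nil =>
      rw [List.map_nil, List.prod_nil, List.length_nil, pow_zero]
      exact ContinuousLinearMap.norm_id_le
    | cons k o ih =>
      rw [List.map_cons, List.prod_cons, List.length_cons, pow_succ']
      exact (norm_mul_le _ _).trans
        (mul_le_mul (norm_spin_le hN hh _ _) ih (norm_nonneg _) (by positivity))
  exact this _

theorem norm_quant_le (hN : 0 < N) {h : ℝ} (hh : 0 < h) (f : Obs d) :
    ‖f.quant N h‖ ≤ f.latNorm h := by
  obtain ⟨F, hF⟩ := f.exists_sites hh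
  rw [quant_eq_sum hF, latNorm_eq_sum hF, Finset.mul_sum]
  exact norm_sum_le_of_le _ fun x _ => f.norm_term_le hN hh.le x

end Obs


/-! ### Uniform bounds on the interaction and the growth constants -/

/-- A form of the bound `‖V‖^(h) ≤ C` in terms of finite sums. -/
def PotentialBound {d : ℕ} (V : (n : ℕ) → Kernel d (n + 1)) (C h : ℝ) : Prop :=
  ∀ (n : ℕ) (s : Site d) (F : Finset (Fin n → Site d)),
    ((n : ℝ) + 1) * ∑ q, h ^ (n * d) *
      ∑ y ∈ F, ‖V n q fun j => latticePoint h ((Fin.cons s y : Fin (n + 1) → Site d) j)‖ ≤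
    C * Real.exp (-((n : ℝ) + 1))

/-- Each summand of ‖V‖^(h) is below any number above the limsup, uniformly for small h; its weight
e^(n+1), moved to the other side, becomes the exponential decay in n. -/
theorem exists_potentialBound {d : ℕ} {V : (n : ℕ) → Kernel d (n + 1)} (hV : IsPotential V) :
    ∃ C : ℝ, 0 ≤ C ∧ ∀ᶠ h in 𝓝[>] (0 : ℝ), PotentialBound V C h := by
  obtain ⟨C, hC1, hC2⟩ := exists_between hV.norm_lt_top
  refine ⟨C.toReal, ENNReal.toReal_nonneg, ?_⟩
  filter_upwards [eventually_lt_of_limsup_lt hC1, self_mem_nhdsWithin] with h h1 (h2 : 0 < h)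
  intro n s F
  have h3 : ENNReal.ofReal (((n : ℝ) + 1) * Real.exp ((n : ℝ) + 1)) *
      ∑ q, ENNReal.ofReal (h ^ (n * d)) * ∑ y ∈ F,
        ‖V n q fun j => latticePoint h ((Fin.cons s y : Fin (n + 1) → Site d) j)‖ₑ ≤ C := by
    refine le_trans ?_ ((ENNReal.le_tsum n).trans h1.le)
    refine mul_le_mul_right ?_ _
    refine le_trans (Finset.sum_le_sum fun q _ => ?_) (le_iSup (fun k : Site d =>
      ∑ i : Fin (n + 1) → Fin 3, ENNReal.ofReal (h ^ (n * d)) * ∑' y : Fin n → Site d,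
        ‖V n i (fun j => latticePoint h ((Fin.cons k y : Fin (n + 1) → Site d) j))‖ₑ) s)
    exact mul_le_mul_right (ENNReal.sum_le_tsum F) _
  have h4 : ENNReal.ofReal (((n : ℝ) + 1) * Real.exp ((n : ℝ) + 1)) *
      ∑ q, ENNReal.ofReal (h ^ (n * d)) * ∑ y ∈ F,
        ‖V n q fun j => latticePoint h ((Fin.cons s y : Fin (n + 1) → Site d) j)‖ₑ =
      ENNReal.ofReal (((n : ℝ) + 1) * Real.exp ((n : ℝ) + 1) *
        ∑ q, h ^ (n * d) * ∑ y ∈ F,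
          ‖V n q fun j => latticePoint h ((Fin.cons s y : Fin (n + 1) → Site d) j)‖) := by
    rw [ENNReal.ofReal_mul (p := ((n : ℝ) + 1) * Real.exp ((n : ℝ) + 1)) (by positivity),
      ENNReal.ofReal_sum_of_nonneg fun q _ => by positivity]
    congr 1
    refine Finset.sum_congr rfl fun q _ => ?_
    rw [ENNReal.ofReal_mul (by positivity), ENNReal.ofReal_sum_of_nonneg fun y _ => norm_nonneg _]
    simp only [ofReal_norm]
  rw [h4, ENNReal.ofReal_le_iff_le_toReal hC2.ne] at h3
  rw [Real.exp_neg, ← div_eq_mul_inv, le_div_iff₀ (Real.exp_pos _)]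
  linarith

theorem latticePoint_cons {d n : ℕ} (h : ℝ) (s : Site d) (y : Fin n → Site d) :
    (fun j => latticePoint h ((Fin.cons s y : Fin (n + 1) → Site d) j)) =
      Fin.cons (latticePoint h s) fun r => latticePoint h (y r) := by
  funext j
  refine Fin.cases ?_ (fun r => ?_) j <;> simp

/-- The growth constants of the hierarchy. -/
noncomputable def growth (C : ℝ) (n : ℕ) : ℝ :=
  Real.sqrt 2 ^ n * (C * Real.exp (-((n : ℝ) + 1)))

theorem growth_nonneg {C : ℝ} (hC : 0 ≤ C) (n : ℕ) : 0 ≤ growth C n := by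
  unfold growth
  positivity

/-- The ratio of the geometric series is √2 e^{-1} e^{1/2}: √2 from the norm of a new spin, e^{-1}
from the weight in the norm of V, and e^{1/2} from the rate used in the hierarchy. It is below 1
because 2 < e. -/
theorem summable_growth (C : ℝ) : Summable fun n => growth C n * Real.exp (1 / 2 * n) := by
  have h1 : Real.sqrt 2 < Real.exp (1 / 2) := by
    rw [← Real.sqrt_sq (Real.exp_pos (1 / 2)).le]
    refine Real.sqrt_lt_sqrt (by norm_num) ?_
    rw [sq, ← Real.exp_add]
    norm_num
    linarith [Real.exp_one_gt_d9]
  have h2 : Real.sqrt 2 * Real.exp (-(1 / 2)) < 1 := by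
    rw [Real.exp_neg, ← div_eq_mul_inv, div_lt_one (Real.exp_pos _)]
    exact h1
  have h3 := (summable_geometric_of_lt_one (by positivity) h2).mul_left (C * Real.exp (-1))
  refine h3.congr fun n => ?_
  rw [growth, mul_pow, ← Real.exp_nat_mul]
  have : Real.exp (-((n : ℝ) + 1)) * Real.exp (1 / 2 * n) =
      Real.exp (-1) * Real.exp (n * -(1 / 2)) := by
    rw [← Real.exp_add, ← Real.exp_add]
    congr 1
    ring
  calc _ = Real.sqrt 2 ^ n * C * (Real.exp (-1) * Real.exp (n * -(1 / 2))) := by ring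
    _ = _ := by rw [← this]; ring

theorem sum_piFinset_sumElim {P Q α M : Type*} [Fintype P] [Fintype Q] [DecidableEq P]
    [DecidableEq Q] [AddCommMonoid M] (F : Finset α) (g : (P ⊕ Q → α) → M) :
    ∑ z ∈ Fintype.piFinset (fun _ : P ⊕ Q => F), g z =
      ∑ x ∈ Fintype.piFinset (fun _ : P => F), ∑ y ∈ Fintype.piFinset (fun _ : Q => F),
        g (Sum.elim x y) := by
  rw [← Finset.sum_product']
  refine Finset.sum_bij' (fun z _ => (fun k => z (Sum.inl k), fun k => z (Sum.inr k)))
    (fun w _ => Sum.elim w.1 w.2) ?_ ?_ ?_ ?_ ?_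
  · intro z hz
    rw [Fintype.mem_piFinset] at hz
    exact Finset.mem_product.2 ⟨Fintype.mem_piFinset.2 fun k => hz _,
      Fintype.mem_piFinset.2 fun k => hz _⟩
  · intro w hw
    rw [Finset.mem_product, Fintype.mem_piFinset, Fintype.mem_piFinset] at hw
    rw [Fintype.mem_piFinset]
    rintro (k | k)
    · exact hw.1 k
    · exact hw.2 k
  · intro z _
    funext k
    rcases k with k | k <;> rfl
  · intro w _
    rfl
  · intro z _
    congr 1
    funext k
    rcases k with k | k <;> rfl

/-! ### Commutators of observables with the interaction -/

namespace Obs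

variable {d N : ℕ} {V : (n : ℕ) → Kernel d (n + 1)}

theorem norm_child_ker (hV : IsPotential V) (f : Obs d) (n : ℕ) (b : f.Idx n) (h : ℝ)
    (x : f.P → Site d) (y : Fin n → Site d) :
    ‖(f.child hV n b).ker fun z => latticePoint h ((Sum.elim x y : f.P ⊕ Fin n → Site d) z)‖ =
      ‖epsT (b.2.2.1 0) (f.idx b.1) b.2.2.2‖ * (‖f.ker fun k => latticePoint h (x k)‖ *
        ‖V n b.2.2.1 fun j => latticePoint h
          ((Fin.cons (x b.1) y : Fin (n + 1) → Site d) j)‖) := by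
  simp only [child, norm_mul, Complex.norm_I, one_mul, Sum.elim_inl, Sum.elim_inr,
    latticePoint_cons]

/-- The choices are counted as follows. The contracted spin `k` gives `f.deg`; the spin `l` of the
interaction gives n + 1, which is the weight in the norm of V; the index `m` gives at most 1. The
sum over `y` is taken at fixed first point `x k`, where the supremum in the norm applies, and the
`n` additional spins supply √2^n h^(nd). -/
theorem sum_child_le (hV : IsPotential V) {C h : ℝ} (hC : PotentialBound V C h)
    (hh : 0 < h) (f : Obs d) (n : ℕ) (F : Finset (Site d))
    (hF : ∀ x : f.P → Site d, f.ker (fun k => latticePoint h (x k)) ≠ 0 → ∀ k, x k ∈ F)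
    (Y : Finset (Fin n → Site d)) :
    ∑ b : f.Idx n, ∑ x ∈ Fintype.piFinset fun _ : f.P => F, ∑ y ∈ Y,
      (Real.sqrt 2 * h ^ d) ^ (f.deg + n) * ‖(f.child hV n b).ker fun z =>
        latticePoint h ((Sum.elim x y : f.P ⊕ Fin n → Site d) z)‖ ≤
      f.deg * growth C n * f.latNorm h := by
  set X := Fintype.piFinset fun _ : f.P => F with hX
  set c := Real.sqrt 2 * h ^ d with hc
  have hc0 : 0 ≤ c := by positivity
  simp only [norm_child_ker]
  set a : (f.P → Site d) → ℝ := fun x => ‖f.ker fun k => latticePoint h (x k)‖ with ha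
  set w : (Fin (n + 1) → Fin 3) → Site d → (Fin n → Site d) → ℝ := fun q s y =>
    ‖V n q fun j => latticePoint h ((Fin.cons s y : Fin (n + 1) → Site d) j)‖ with hw
  have h1 : ∀ (k : f.P) (l : Fin (n + 1)) (q : Fin (n + 1) → Fin 3),
      ∑ m : Fin 3, ∑ x ∈ X, ∑ y ∈ Y, c ^ (f.deg + n) *
        (‖epsT (q 0) (f.idx k) m‖ * (a x * w q (x k) y)) ≤
      ∑ x ∈ X, c ^ (f.deg + n) * a x * ∑ y ∈ Y, w q (x k) y := by
    intro k l q
    have e : ∀ m, ∑ x ∈ X, ∑ y ∈ Y, c ^ (f.deg + n) *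
        (‖epsT (q 0) (f.idx k) m‖ * (a x * w q (x k) y)) =
        ‖epsT (q 0) (f.idx k) m‖ * ∑ x ∈ X, c ^ (f.deg + n) * a x * ∑ y ∈ Y, w q (x k) y := by
      intro m
      simp only [Finset.mul_sum]
      exact Finset.sum_congr rfl fun x _ => Finset.sum_congr rfl fun y _ => by ring
    simp only [e, ← Finset.sum_mul]
    refine mul_le_of_le_one_left (Finset.sum_nonneg fun x _ => ?_) (sum_norm_epsT_le _ _)
    exact mul_nonneg (mul_nonneg (pow_nonneg hc0 _) (norm_nonneg _))
      (Finset.sum_nonneg fun y _ => norm_nonneg _)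
  have h2 : ∀ k : f.P, ∑ l : Fin (n + 1), ∑ q : Fin (n + 1) → Fin 3,
      ∑ x ∈ X, c ^ (f.deg + n) * a x * ∑ y ∈ Y, w q (x k) y ≤ growth C n * f.latNorm h := by
    intro k
    rw [Finset.sum_const, Finset.card_univ, Fintype.card_fin, nsmul_eq_mul, Finset.sum_comm,
      latNorm_eq_sum hF, ← hX, ← hc, Finset.mul_sum, Finset.mul_sum, Finset.mul_sum]
    refine Finset.sum_le_sum fun x _ => ?_
    rw [← Finset.mul_sum]
    have h3 := hC n (x k) Y
    have h4 : c ^ n = Real.sqrt 2 ^ n * h ^ (n * d) := by rw [hc, mul_pow, ← pow_mul, mul_comm n d]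
    calc ((n + 1 : ℕ) : ℝ) * (c ^ (f.deg + n) * a x * ∑ q, ∑ y ∈ Y, w q (x k) y)
        = c ^ f.deg * a x * Real.sqrt 2 ^ n *
          (((n : ℝ) + 1) * ∑ q, h ^ (n * d) * ∑ y ∈ Y, w q (x k) y) := by
          rw [← Finset.mul_sum, pow_add, h4]
          push_cast
          ring
      _ ≤ c ^ f.deg * a x * Real.sqrt 2 ^ n * (C * Real.exp (-((n : ℝ) + 1))) := by
          refine mul_le_mul_of_nonneg_left h3 ?_
          exact mul_nonneg (mul_nonneg (pow_nonneg hc0 _) (norm_nonneg _)) (by positivity)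
      _ = _ := by
          rw [growth]
          ring
  calc _ = ∑ k : f.P, ∑ l : Fin (n + 1), ∑ q : Fin (n + 1) → Fin 3, ∑ m : Fin 3,
        ∑ x ∈ X, ∑ y ∈ Y, c ^ (f.deg + n) *
          (‖epsT (q 0) (f.idx k) m‖ * (a x * w q (x k) y)) := by
        simp only [Fintype.sum_prod_type]
        rfl
    _ ≤ ∑ k : f.P, growth C n * f.latNorm h := by
        refine Finset.sum_le_sum fun k _ => le_trans ?_ (h2 k)
        exact Finset.sum_le_sum fun l _ => Finset.sum_le_sum fun q _ => h1 k l q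
    _ = _ := by
        rw [Finset.sum_const, Finset.card_univ, nsmul_eq_mul, deg, mul_assoc]

theorem sum_latNorm_child_le (hV : IsPotential V) {C h : ℝ} (hC : PotentialBound V C h)
    (hh : 0 < h) (f : Obs d) (n : ℕ) :
    ∑ b : f.Idx n, (f.child hV n b).latNorm h ≤ f.deg * growth C n * f.latNorm h := by
  obtain ⟨F, hF⟩ := f.exists_sites hh
  choose G hG using fun b : f.Idx n => (f.child hV n b).exists_sites hh
  set F' := F ∪ Finset.univ.biUnion G with hF'
  have h1 : ∀ x : f.P → Site d, f.ker (fun k => latticePoint h (x k)) ≠ 0 → ∀ k, x k ∈ F' :=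
    fun x hx k => Finset.mem_union_left _ (hF x hx k)
  refine le_trans (le_of_eq ?_) (f.sum_child_le hV hC hh n F' h1
    (Fintype.piFinset fun _ : Fin n => F'))
  refine Finset.sum_congr rfl fun b _ => ?_
  rw [latNorm_eq_sum (F := F') fun x hx k => Finset.mem_union_right _
    (Finset.mem_biUnion.2 ⟨b, Finset.mem_univ _, hG b x hx k⟩), deg_child, Finset.mul_sum]
  exact sum_piFinset_sumElim F' fun z => (Real.sqrt 2 * h ^ d) ^ (f.deg + n) *
    ‖(f.child hV n b).ker fun k => latticePoint h (z k)‖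

/-- The commutator `i s h^{-d} [:Ŝ_Λ(V^(n+1)):, a]`. -/
noncomputable def ad (V : (n : ℕ) → Kernel d (n + 1)) (h : ℝ) (Λ : Finset (Site d)) (n : ℕ)
    (a : quasiLocalAlgebra d N) : quasiLocalAlgebra d N :=
  (Complex.I * (((N : ℝ) / 2 * (h ^ d)⁻¹ : ℝ) : ℂ)) •
    (smearedSpinOn h Λ (V n) * a - a * smearedSpinOn h Λ (V n))

theorem ad_quant (hN : 0 < N) (hV : IsPotential V) {h : ℝ} (hh : 0 < h) (Λ : Finset (Site d))
    (n : ℕ) (f : Obs d) (F : Finset (Site d))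
    (hF : ∀ x : f.P → Site d, f.ker (fun k => latticePoint h (x k)) ≠ 0 → ∀ k, x k ∈ F) :
    ad V h Λ n (f.quant N h) = ∑ b : f.Idx n, ∑ x ∈ Fintype.piFinset fun _ : f.P => F,
      ∑ y ∈ Fintype.piFinset fun _ : Fin n => Λ,
        if x b.1 ∈ Λ then (f.child hV n b).term N h (Sum.elim x y) else 0 := by
  have hN' : (N : ℂ) ≠ 0 := by exact_mod_cast hN.ne'
  have hh' : (h : ℂ) ≠ 0 := by exact_mod_cast hh.ne'
  set κ : ℂ := ((h ^ d / ((N : ℝ) / 2) : ℝ) : ℂ) with hκ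
  -- The scaling is chosen for this cancellation: the generator's s h^{-d} against the commutator's
  -- h^d/s.
  have hcκ : Complex.I * (((N : ℝ) / 2 * (h ^ d)⁻¹ : ℝ) : ℂ) * κ = Complex.I := by
    rw [hκ]
    push_cast
    field_simp
  rw [ad, quant_eq_sum hF, Finset.mul_sum, Finset.sum_mul, ← Finset.sum_sub_distrib,
    Finset.sum_comm, Finset.smul_sum]
  refine Finset.sum_congr rfl fun x _ => ?_
  rw [term, mul_smul_comm, smul_mul_assoc, ← smul_sub, smearedSpinOn_eq]
  have key := interaction_commutator_prod (spin_commutator (N := N) (d := d) h) Λ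
    (fun q y => V n q (fun k => latticePoint h (y k)))
    (fun σ q y => (hV.smearing n).symmetric σ q (fun k => latticePoint h (y k)))
    f.nodup f.mem_ord f.idx x
  rw [key, smul_smul, ← hκ, smul_smul, mul_right_comm, hcκ]
  simp only [Fintype.sum_prod_type, Finset.smul_sum, smul_ite, smul_zero]
  refine Finset.sum_congr rfl fun k _ => Finset.sum_congr rfl fun l _ =>
    Finset.sum_congr rfl fun q _ => Finset.sum_congr rfl fun m _ =>
    Finset.sum_congr rfl fun y _ => ?_
  refine if_congr Iff.rfl ?_ rfl
  simp only [term, child, Sum.elim_inl, Sum.elim_inr, latticePoint_cons, smul_smul]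
  congr 1
  ring

theorem norm_ad_quant_le (hN : 0 < N) (hV : IsPotential V) {C h : ℝ} (hC : PotentialBound V C h)
    (hh : 0 < h) (Λ : Finset (Site d)) (n : ℕ) (f : Obs d) :
    ‖ad V h Λ n (f.quant N h)‖ ≤ f.deg * growth C n * f.latNorm h := by
  obtain ⟨F, hF⟩ := f.exists_sites hh
  rw [ad_quant hN hV hh Λ n f F hF]
  refine le_trans ?_ (f.sum_child_le hV hC hh n F hF (Fintype.piFinset fun _ : Fin n => Λ))
  refine norm_sum_le_of_le _ fun b _ => norm_sum_le_of_le _ fun x _ =>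
    norm_sum_le_of_le _ fun y _ => ?_
  have h1 := (f.child hV n b).norm_term_le hN hh.le (Sum.elim x y)
  rw [deg_child] at h1
  split_ifs
  · exact h1
  · rw [norm_zero]
    exact (norm_nonneg _).trans h1

/-- By finite range the children have compact support, and Λ only has to contain the sites that `f`
and these children see. That set depends on `n`, as the range may grow with `n`; this is why the
hierarchy lemma asks for the identity only at each fixed `n`. -/
theorem eventually_ad_quant (hN : 0 < N) (hV : IsPotential V) {h : ℝ} (hh : 0 < h) (n : ℕ)
    (f : Obs d) : ∀ᶠ Λ : Finset (Site d) in atTop,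
      ad V h Λ n (f.quant N h) = ∑ b : f.Idx n, (f.child hV n b).quant N h := by
  obtain ⟨F, hF⟩ := f.exists_sites hh
  choose G hG using fun b : f.Idx n => (f.child hV n b).exists_sites hh
  filter_upwards [eventually_ge_atTop (F ∪ Finset.univ.biUnion G)] with Λ hΛ
  have h1 : ∀ x : f.P → Site d, f.ker (fun k => latticePoint h (x k)) ≠ 0 → ∀ k, x k ∈ Λ :=
    fun x hx k => hΛ (Finset.mem_union_left _ (hF x hx k))
  rw [ad_quant hN hV hh Λ n f Λ h1]
  refine Finset.sum_congr rfl fun b _ => ?_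
  rw [quant_eq_sum (F := Λ) fun x hx k => hΛ (Finset.mem_union_right _
    (Finset.mem_biUnion.2 ⟨b, Finset.mem_univ _, hG b x hx k⟩))]
  refine Eq.trans ?_ (sum_piFinset_sumElim Λ fun z => (f.child hV n b).term N h z).symm
  refine Finset.sum_congr rfl fun x hx => Finset.sum_congr rfl fun y _ => ?_
  rw [if_pos (Fintype.mem_piFinset.1 hx b.1)]

end Obs


/-! ### One-parameter groups of inner automorphisms -/

section Automorphism

variable {A : Type*} [NormedRing A] [NormedAlgebra ℂ A] [StarRing A] [CStarRing A]
  [StarModule ℂ A] [CompleteSpace A]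

theorem exp_real_smul_mem_unitary {Z : A} (hZ : star Z = -Z) (t : ℝ) :
    NormedSpace.exp ((t : ℂ) • Z) ∈ unitary A := by
  let _ : NormedAlgebra ℚ A := NormedAlgebra.restrictScalars ℚ ℂ A
  have h1 : star (NormedSpace.exp ((t : ℂ) • Z)) = NormedSpace.exp (-((t : ℂ) • Z)) := by
    rw [NormedSpace.star_exp, star_smul, hZ, Complex.star_def, Complex.conj_ofReal, smul_neg]
  rw [Unitary.mem_iff, h1]
  constructor
  · rw [← NormedSpace.exp_add_of_commute (Commute.refl _).neg_left, neg_add_cancel,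
      NormedSpace.exp_zero]
  · rw [← NormedSpace.exp_add_of_commute (Commute.refl _).neg_right, add_neg_cancel,
      NormedSpace.exp_zero]

theorem norm_star_exp_mul_mul_exp {Z : A} (hZ : star Z = -Z) (t : ℝ) (a : A) :
    ‖star (NormedSpace.exp ((t : ℂ) • Z)) * a * NormedSpace.exp ((t : ℂ) • Z)‖ = ‖a‖ := by
  have hU := exp_real_smul_mem_unitary hZ t
  rw [CStarRing.norm_mul_mem_unitary _ hU, CStarRing.norm_mem_unitary_mul _ (Unitary.star_mem hU)]

theorem hasDerivAt_star_exp_mul_mul_exp {Z : A} (hZ : star Z = -Z) (t : ℝ) (a : A) :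
    HasDerivAt (fun t : ℝ => star (NormedSpace.exp ((t : ℂ) • Z)) * a *
        NormedSpace.exp ((t : ℂ) • Z))
      (star (NormedSpace.exp ((t : ℂ) • Z)) * (a * Z - Z * a) *
        NormedSpace.exp ((t : ℂ) • Z)) t := by
  let _ : NormedAlgebra ℚ A := NormedAlgebra.restrictScalars ℚ ℂ A
  have h1 : HasDerivAt (fun t : ℝ => NormedSpace.exp ((t : ℂ) • Z))
      (NormedSpace.exp ((t : ℂ) • Z) * Z) t := by
    have h0 := (hasDerivAt_exp_smul_const (𝕂 := ℂ) Z (t : ℂ)).scomp t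
      (hasDerivAt_id t).ofReal_comp
    rw [Complex.ofReal_one, one_smul] at h0
    exact h0
  have h2 := h1.star
  have h3 : NormedSpace.exp ((t : ℂ) • Z) * Z = Z * NormedSpace.exp ((t : ℂ) • Z) :=
    (((Commute.refl Z).smul_right (t : ℂ)).exp_right).eq.symm
  refine ((h2.mul_const a).mul h1).congr_deriv ?_
  rw [star_mul, hZ, h3]
  have h4 : -Z * star (NormedSpace.exp ((t : ℂ) • Z)) =
      star (NormedSpace.exp ((t : ℂ) • Z)) * -Z := by
    have := congrArg star h3
    rw [star_mul, star_mul, hZ] at this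
    exact this
  rw [h4]
  noncomm_ring

end Automorphism

/-! ### The Hamiltonian -/

section Hamiltonian

variable {d N : ℕ} {V : (n : ℕ) → Kernel d (n + 1)}

instance : CompleteSpace (quasiLocalAlgebra d N) :=
  (StarSubalgebra.isClosed_topologicalClosure _).completeSpace_coe

/-- Taking adjoints reverses the order of the three groups and exchanges + with -, and the two
effects cancel. The reversal inside a group is harmless because spins with the same index commute.
-/
theorem star_normalOrdered {p : ℕ} (h : ℝ) (i : Fin p → Fin 3) (x : Fin p → Site d) :
    star (normalOrdered h i x : quasiLocalAlgebra d N) =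
      normalOrdered h (fun k => (i k).rev) x := by
  have hblock : ∀ j : Fin 3,
      star ((((List.finRange p).filter fun k => i k = j).map fun k =>
        (spin h j (x k) : quasiLocalAlgebra d N)).prod) =
      (((List.finRange p).filter fun k => (i k).rev = j.rev).map fun k => spin h j.rev (x k)).prod := by
    intro j
    have e1 : (fun k => decide ((i k).rev = j.rev)) = fun k => decide (i k = j) := by
      funext k
      simp only [Fin.rev_inj]
    have e2 : ∀ o : List (Fin p), star ((o.map fun k =>
        (spin h j (x k) : quasiLocalAlgebra d N)).prod) =
        ((o.map fun k => (spin h j.rev (x k) : quasiLocalAlgebra d N)).reverse).prod := by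
      intro o
      induction o with
      | nil => simp
      | cons k o ih =>
        rw [List.map_cons, List.prod_cons, star_mul, ih, star_spin, List.map_cons,
          List.reverse_cons, List.prod_append, List.prod_singleton]
    rw [e1, e2]
    refine (List.reverse_perm _).prod_eq' ?_
    rw [List.pairwise_reverse, List.pairwise_map]
    exact List.pairwise_of_forall fun k k' => spin_mul_comm_same h _ _ _
  have e3 : List.finRange 3 = [0, 1, 2] := rfl
  have h0 := hblock 0
  have h1 := hblock 1
  have h2 := hblock 2
  simp only [normalOrdered, e3, List.map_cons, List.map_nil, List.prod_cons, List.prod_nil, mul_one,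
    star_mul, h0, h1, h2]
  exact mul_assoc _ _ _

theorem star_smearedSpinOn (hV : IsPotential V) (h : ℝ) (Λ : Finset (Site d)) (n : ℕ) :
    star (smearedSpinOn h Λ (V n) : quasiLocalAlgebra d N) = smearedSpinOn h Λ (V n) := by
  have h1 : Function.Involutive fun (i : Fin (n + 1) → Fin 3) k => (i k).rev := fun i => by
    funext k
    exact Fin.rev_rev _
  rw [smearedSpinOn, star_sum, ← Equiv.sum_comp h1.toPerm]
  refine Finset.sum_congr rfl fun i _ => ?_
  rw [star_sum]
  refine Finset.sum_congr rfl fun x _ => ?_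
  rw [star_smul, star_normalOrdered, Complex.star_def, hV.real]
  simp only [Function.Involutive.coe_toPerm, Fin.rev_rev]

/-- The sum over the first site is bounded crudely by the number of sites; the other sums are
controlled by the norm of V. The dependence on Λ does no harm, since the estimate serves only
convergence at fixed Λ. -/
theorem norm_smearedSpinOn_le (hN : 0 < N) {C h : ℝ} (hC : PotentialBound V C h) (hh : 0 < h)
    (Λ : Finset (Site d)) (n : ℕ) :
    ‖(smearedSpinOn h Λ (V n) : quasiLocalAlgebra d N)‖ ≤
      (Λ.card * (Real.sqrt 2 * h ^ d)) * growth C n := by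
  set c := Real.sqrt 2 * h ^ d with hc
  have hc0 : 0 ≤ c := by positivity
  have hprod : ∀ (q : Fin (n + 1) → Fin 3) (y : Fin (n + 1) → Site d),
      ‖((slots q).map fun k => (spin h (q k) (y k) : quasiLocalAlgebra d N)).prod‖ ≤
        c ^ (n + 1) := by
    intro q y
    have hlen : (slots q).length = n + 1 := by
      have h1 : (slots q).toFinset = Finset.univ :=
        Finset.eq_univ_of_forall fun k => List.mem_toFinset.2 (mem_slots q k)
      rw [← List.toFinset_card_of_nodup (nodup_slots q), h1, Finset.card_univ, Fintype.card_fin]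
    have : ∀ o : List (Fin (n + 1)),
        ‖(o.map fun k => (spin h (q k) (y k) : quasiLocalAlgebra d N)).prod‖ ≤ c ^ o.length := by
      intro o
      induction o with
      | nil =>
        rw [List.map_nil, List.prod_nil, List.length_nil, pow_zero]
        exact ContinuousLinearMap.norm_id_le
      | cons k o ih =>
        rw [List.map_cons, List.prod_cons, List.length_cons, pow_succ']
        exact (norm_mul_le _ _).trans
          (mul_le_mul (norm_spin_le hN hh.le _ _) ih (norm_nonneg _) hc0)
    have h2 := this (slots q)
    rwa [hlen] at h2
  set w : (Fin (n + 1) → Fin 3) → (Fin (n + 1) → Site d) → ℝ := fun q y =>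
    ‖V n q fun j => latticePoint h (y j)‖ with hw
  rw [smearedSpinOn_eq]
  calc _ ≤ ∑ q, ∑ y ∈ Fintype.piFinset (fun _ : Fin (n + 1) => Λ), w q y * c ^ (n + 1) := by
        refine norm_sum_le_of_le _ fun q _ => norm_sum_le_of_le _ fun y _ => ?_
        rw [norm_smul]
        exact mul_le_mul_of_nonneg_left (hprod q y) (norm_nonneg _)
    _ = ∑ q, ∑ s ∈ Λ, ∑ y ∈ Fintype.piFinset (fun _ : Fin n => Λ),
          w q (Fin.cons s y : Fin (n + 1) → Site d) * c ^ (n + 1) := by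
        refine Finset.sum_congr rfl fun q _ => ?_
        have e1 : ∀ s ∈ Λ, ∑ y ∈ Fintype.piFinset (fun _ : Fin n => Λ),
            w q (Fin.cons s y : Fin (n + 1) → Site d) * c ^ (n + 1) =
            ∑ y ∈ Fintype.piFinset (fun _ : Fin (n + 1) => Λ),
              if y 0 = s then w q y * c ^ (n + 1) else 0 := by
          intro s hs
          rw [sum_piFinset_of_zero_eq Λ s fun y => w q y * c ^ (n + 1)]
          simp only [hs, if_true]
        rw [Finset.sum_congr rfl e1, Finset.sum_comm]
        refine Finset.sum_congr rfl fun y hy => ?_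
        rw [Finset.sum_ite_eq, if_pos (Fintype.mem_piFinset.1 hy 0)]
    _ = ∑ s ∈ Λ, c * Real.sqrt 2 ^ n * ∑ q, h ^ (n * d) *
          ∑ y ∈ Fintype.piFinset (fun _ : Fin n => Λ),
            w q (Fin.cons s y : Fin (n + 1) → Site d) := by
        rw [Finset.sum_comm]
        refine Finset.sum_congr rfl fun s _ => ?_
        rw [Finset.mul_sum]
        refine Finset.sum_congr rfl fun q _ => ?_
        rw [← Finset.sum_mul, pow_succ, hc, mul_pow, ← pow_mul, mul_comm d n]
        ring
    _ ≤ ∑ s ∈ Λ, c * Real.sqrt 2 ^ n * (C * Real.exp (-((n : ℝ) + 1))) := by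
        refine Finset.sum_le_sum fun s _ => mul_le_mul_of_nonneg_left ?_ (by positivity)
        refine le_trans ?_ (hC n s (Fintype.piFinset fun _ : Fin n => Λ))
        refine le_mul_of_one_le_left ?_ (by linarith [(Nat.cast_nonneg n : (0 : ℝ) ≤ n)])
        exact Finset.sum_nonneg fun q _ => mul_nonneg (by positivity)
          (Finset.sum_nonneg fun y _ => norm_nonneg _)
    _ = _ := by
        rw [Finset.sum_const, nsmul_eq_mul, growth]
        ring

theorem summable_growth' {C : ℝ} (hC : 0 ≤ C) : Summable (growth C) :=
  Summable.of_nonneg_of_le (growth_nonneg hC)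
    (fun n => le_mul_of_one_le_right (growth_nonneg hC n) (Real.one_le_exp (by positivity)))
    (summable_growth C)

theorem summable_smearedSpinOn (hN : 0 < N) {C h : ℝ} (hC : PotentialBound V C h) (hC0 : 0 ≤ C)
    (hh : 0 < h) (Λ : Finset (Site d)) :
    Summable fun n => (smearedSpinOn h Λ (V n) : quasiLocalAlgebra d N) :=
  Summable.of_norm_bounded ((summable_growth' hC0).mul_left _)
    fun n => norm_smearedSpinOn_le hN hC hh Λ n

theorem star_hamiltonian (hV : IsPotential V) (h : ℝ) (Λ : Finset (Site d)) :
    star (hamiltonian h V Λ : quasiLocalAlgebra d N) = hamiltonian h V Λ := by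
  rw [hamiltonian, tsum_star]
  exact tsum_congr fun n => star_smearedSpinOn hV h Λ n

/-- The generator `-i s h^{-d} Ĥ_Λ` of the propagator. -/
noncomputable def generator (N : ℕ) (h : ℝ) (V : (n : ℕ) → Kernel d (n + 1))
    (Λ : Finset (Site d)) : quasiLocalAlgebra d N :=
  -((Complex.I * (((N : ℝ) / 2 * (h ^ d)⁻¹ : ℝ) : ℂ)) • hamiltonian h V Λ)

theorem star_generator (hV : IsPotential V) (h : ℝ) (Λ : Finset (Site d)) :
    star (generator N h V Λ) = -generator N h V Λ := by
  rw [generator, star_neg, star_smul, star_hamiltonian hV, star_mul', Complex.star_def,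
    Complex.conj_I, Complex.conj_ofReal, neg_mul, neg_smul]

theorem propagator_eq (h : ℝ) (Λ : Finset (Site d)) (t : ℝ) :
    (propagator h V Λ t : quasiLocalAlgebra d N) =
      NormedSpace.exp ((t : ℂ) • generator N h V Λ) := by
  rw [propagator, generator, smul_neg, smul_smul, neg_smul]
  push_cast
  congr 3
  ring

theorem norm_localDynamics (hV : IsPotential V) (h : ℝ) (Λ : Finset (Site d)) (t : ℝ)
    (a : quasiLocalAlgebra d N) : ‖localDynamics h V Λ t a‖ = ‖a‖ := by
  rw [localDynamics, propagator_eq]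
  exact norm_star_exp_mul_mul_exp (star_generator hV h Λ) t a

theorem localDynamics_zero (h : ℝ) (Λ : Finset (Site d))
    (a : quasiLocalAlgebra d N) : localDynamics h V Λ 0 a = a := by
  rw [localDynamics, propagator_eq]
  simp

theorem summable_ad (hN : 0 < N) {C h : ℝ} (hC : PotentialBound V C h) (hC0 : 0 ≤ C) (hh : 0 < h)
    (Λ : Finset (Site d)) (a : quasiLocalAlgebra d N) :
    Summable fun n => Obs.ad V h Λ n a := by
  have h1 := summable_smearedSpinOn hN hC hC0 hh Λ
  exact ((h1.mul_right a).sub (h1.mul_left a)).const_smul _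

/-- The Heisenberg equation, with the commutator expanded by the order of the interaction: this
expansion is the series of the `D` in the hierarchy lemma. -/
theorem hasDerivAt_localDynamics (hN : 0 < N) (hV : IsPotential V) {C h : ℝ}
    (hC : PotentialBound V C h) (hC0 : 0 ≤ C) (hh : 0 < h) (Λ : Finset (Site d)) (t : ℝ)
    (a : quasiLocalAlgebra d N) :
    HasDerivAt (fun t => localDynamics h V Λ t a)
      (∑' n, localDynamics h V Λ t (Obs.ad V h Λ n a)) t := by
  have h0 := summable_smearedSpinOn hN hC hC0 hh Λ
  have h1 : a * generator N h V Λ - generator N h V Λ * a = ∑' n, Obs.ad V h Λ n a := by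
    simp only [Obs.ad]
    rw [Summable.tsum_const_smul _ ((h0.mul_right a).sub (h0.mul_left a)),
      (h0.mul_right a).tsum_sub (h0.mul_left a), h0.tsum_mul_right, h0.tsum_mul_left, generator,
      hamiltonian, mul_neg, neg_mul, mul_smul_comm, smul_mul_assoc, smul_sub]
    abel
  have h2 := summable_ad hN hC hC0 hh Λ a
  have h3 := hasDerivAt_star_exp_mul_mul_exp (star_generator (N := N) hV h Λ) t a
  rw [h1] at h3
  simp only [localDynamics, propagator_eq]
  rw [(h2.mul_left _).tsum_mul_right, h2.tsum_mul_left]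
  exact h3

theorem localDynamics_sum {ι : Type*} (s : Finset ι) (h : ℝ) (Λ : Finset (Site d)) (t : ℝ)
    (a : ι → quasiLocalAlgebra d N) :
    localDynamics h V Λ t (∑ b ∈ s, a b) = ∑ b ∈ s, localDynamics h V Λ t (a b) := by
  simp only [localDynamics, Finset.mul_sum, Finset.sum_mul]

end Hamiltonian


/-! ### Existence of the infinite-volume dynamics -/

section Dynamics

variable {d N : ℕ} {V : (n : ℕ) → Kernel d (n + 1)}

theorem norm_localDynamics_ad_le (hN : 0 < N) (hV : IsPotential V) {C h : ℝ}
    (hC : PotentialBound V C h) (hh : 0 < h) (Λ : Finset (Site d)) (t : ℝ) (n : ℕ) (f : Obs d) :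
    ‖localDynamics h V Λ t (Obs.ad V h Λ n (f.quant N h))‖ ≤
      f.deg * growth C n * f.latNorm h := by
  rw [norm_localDynamics hV]
  exact f.norm_ad_quant_le hN hV hC hh Λ n

theorem summable_localDynamics_ad (hN : 0 < N) (hV : IsPotential V) {C h : ℝ}
    (hC : PotentialBound V C h) (hC0 : 0 ≤ C) (hh : 0 < h) (Λ : Finset (Site d)) (t : ℝ)
    (f : Obs d) :
    Summable fun n => localDynamics h V Λ t (Obs.ad V h Λ n (f.quant N h)) :=
  Summable.of_norm_bounded (((summable_growth' hC0).mul_left _).mul_right _)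
    fun n => norm_localDynamics_ad_le hN hV hC hh Λ t n f

/-- The difference of the dynamics of two volumes vanishes at time zero and obeys the hierarchy with
the same children as soon as both volumes are large, since `Obs.child` does not refer to Λ. The
hierarchy lemma along pairs of volumes is then the Cauchy property. -/
theorem cauchy_localDynamics (hN : 0 < N) (hV : IsPotential V) {C h : ℝ}
    (hC : PotentialBound V C h) (hC0 : 0 ≤ C) (hh : 0 < h) (t : ℝ) (f : Obs d) :
    Cauchy (map (fun Λ : Finset (Site d) => localDynamics h V Λ t (f.quant N h)) atTop) := by
  rw [cauchy_map_iff]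
  refine ⟨inferInstance, ?_⟩
  have key := hierarchy_tendsto_zero (O := Obs d) (X := quasiLocalAlgebra d N)
    (atTop ×ˢ atTop : Filter (Finset (Site d) × Finset (Site d)))
    Obs.deg Obs.Idx (fun f n b => f.child hV n b) (fun f n b => f.deg_child hV n b)
    (fun a t f => localDynamics h V a.1 t (f.quant N h) - localDynamics h V a.2 t (f.quant N h))
    (fun a t f n => localDynamics h V a.1 t (Obs.ad V h a.1 n (f.quant N h)) -
      localDynamics h V a.2 t (Obs.ad V h a.2 n (f.quant N h)))
    (fun _ f => 2 * f.latNorm h) (growth C) (1 / 2) (by norm_num) (growth_nonneg hC0)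
    (summable_growth C)
    (Eventually.of_forall fun _ f => mul_nonneg zero_le_two (f.latNorm_nonneg hh.le))
    (Eventually.of_forall fun a f t => by
      refine (norm_sub_le _ _).trans ?_
      rw [norm_localDynamics hV, norm_localDynamics hV]
      linarith [f.norm_quant_le hN hh])
    (Eventually.of_forall fun a f n => by
      rw [← Finset.mul_sum]
      linarith [f.sum_latNorm_child_le hV hC hh n])
    (Eventually.of_forall fun a f n t => by
      refine (norm_sub_le _ _).trans ?_
      linarith [norm_localDynamics_ad_le hN hV hC hh a.1 t n f,
        norm_localDynamics_ad_le hN hV hC hh a.2 t n f])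
    (Eventually.of_forall fun a f t => by
      rw [(summable_localDynamics_ad hN hV hC hC0 hh a.1 t f).tsum_sub
        (summable_localDynamics_ad hN hV hC hC0 hh a.2 t f)]
      exact (hasDerivAt_localDynamics hN hV hC hC0 hh a.1 t _).sub
        (hasDerivAt_localDynamics hN hV hC hC0 hh a.2 t _))
    (fun f n => by
      have h1 := f.eventually_ad_quant hN hV hh n
      filter_upwards [h1.prod_mk h1] with a ha t
      rw [ha.1, ha.2, localDynamics_sum, localDynamics_sum, Finset.sum_sub_distrib])
    (fun f => ⟨_, Eventually.of_forall fun _ => le_rfl⟩)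
    (fun f => by simp only [localDynamics_zero, sub_self, tendsto_const_nhds])
  rw [Metric.uniformity_basis_dist_le.tendsto_right_iff]
  intro ε hε
  filter_upwards [key |t| f ε hε] with a ha
  have h1 := ha t le_rfl
  rw [← dist_eq_norm] at h1
  exact h1

theorem tendsto_localDynamics (hN : 0 < N) (hV : IsPotential V) {C h : ℝ}
    (hC : PotentialBound V C h) (hC0 : 0 ≤ C) (hh : 0 < h) (t : ℝ) (f : Obs d) :
    ∃ y, Tendsto (fun Λ : Finset (Site d) => localDynamics h V Λ t (f.quant N h)) atTop (𝓝 y) :=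
  cauchy_iff_exists_le_nhds.1 (cauchy_localDynamics hN hV hC hC0 hh t f)

end Dynamics


/-! ### Classical values of the observables -/

theorem norm_coord_le (i : Fin 3) (v : E 3) : ‖coord i v‖ ≤ ‖v‖ := by
  have hv : ‖v‖ ^ 2 = v 0 ^ 2 + v 1 ^ 2 + v 2 ^ 2 := by
    rw [EuclideanSpace.norm_sq_eq, Fin.sum_univ_three]
    simp
  have h2 : Real.sqrt 2 * Real.sqrt 2 = 2 := Real.mul_self_sqrt (by norm_num)
  have key : ∀ z : ℂ, Complex.normSq z = v 0 * v 0 + v 1 * v 1 →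
      ‖z / (Real.sqrt 2 : ℂ)‖ ≤ ‖v‖ := by
    intro z hz
    refine le_of_sq_le_sq ?_ (norm_nonneg _)
    rw [hv, ← Complex.normSq_eq_norm_sq, map_div₀, Complex.normSq_ofReal, hz, h2]
    nlinarith [sq_nonneg (v 0), sq_nonneg (v 1), sq_nonneg (v 2)]
  fin_cases i
  · refine key _ ?_
    rw [Complex.normSq_apply]
    simp
  · refine le_of_sq_le_sq ?_ (norm_nonneg _)
    change ‖((v 2 : ℝ) : ℂ)‖ ^ 2 ≤ _
    rw [hv, Complex.norm_real, Real.norm_eq_abs, sq_abs]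
    nlinarith [sq_nonneg (v 0), sq_nonneg (v 1)]
  · refine key _ ?_
    rw [Complex.normSq_apply]
    simp

theorem coord_add (i : Fin 3) (v w : E 3) : coord i (v + w) = coord i v + coord i w := by
  fin_cases i <;> simp [coord] <;> ring

theorem coord_smul (i : Fin 3) (c : ℝ) (v : E 3) : coord i (c • v) = c * coord i v := by
  fin_cases i <;> simp [coord] <;> ring

theorem continuous_coord (i : Fin 3) : Continuous (coord i) := by
  let L : E 3 →ₗ[ℝ] ℂ :=
    { toFun := coord i
      map_add' := coord_add i
      map_smul' := fun c v => by rw [coord_smul, RingHom.id_apply, Complex.real_smul] }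
  exact L.continuous_of_finiteDimensional

/-! ### Null sets in products of Euclidean space -/

section Pi

variable {P : Type} [Fintype P] {d : ℕ}

theorem ae_pi_of_ae {p : E d → Prop} (hp : ∀ᵐ y : E d, p y) :
    ∀ᵐ x : P → E d, ∀ k, p (x k) :=
  ae_all_iff.2 fun k =>
    (Measure.quasiMeasurePreserving_eval (fun _ : P => (volume : Measure (E d))) k).ae hp

/-- For `d > 0` each diagonal, where two given arguments agree, is a proper linear subspace and
hence null. -/
theorem ae_injective (hd : 0 < d) : ∀ᵐ x : P → E d, Function.Injective x := by
  classical
  have h1 : ∀ k l : P, k ≠ l → ∀ᵐ x : P → E d, x k ≠ x l := by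
    intro k l hkl
    let S : Submodule ℝ (P → E d) := LinearMap.ker
      ((LinearMap.proj k : (P → E d) →ₗ[ℝ] E d) - (LinearMap.proj l : (P → E d) →ₗ[ℝ] E d))
    have hS : S ≠ ⊤ := by
      intro h
      let v : E d := WithLp.toLp 2 fun _ => 1
      have h2 : (Pi.single k v : P → E d) ∈ S := by rw [h]; trivial
      rw [LinearMap.mem_ker, LinearMap.sub_apply, LinearMap.proj_apply, LinearMap.proj_apply,
        Pi.single_eq_same, Pi.single_eq_of_ne (Ne.symm hkl), sub_zero] at h2
      have h3 := congrArg (fun w : E d => w ⟨0, hd⟩) h2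
      simp [v] at h3
    have h4 := Measure.addHaar_submodule (volume : Measure (P → E d)) S hS
    rw [ae_iff]
    refine measure_mono_null (fun x hx => ?_) h4
    have : x k = x l := not_not.1 hx
    simp [S, this]
  have h2 : ∀ᵐ x : P → E d, ∀ k l : P, k ≠ l → x k ≠ x l :=
    ae_all_iff.2 fun k => ae_all_iff.2 fun l => by
      by_cases hkl : k = l
      · exact Eventually.of_forall fun x h => absurd hkl h
      · filter_upwards [h1 k l hkl] with x hx _ using hx
  filter_upwards [h2] with x hx k l hkl
  by_contra hne
  exact hx k l hne hkl

end Pi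

/-! ### Classical values as continuum limits -/

namespace Obs

variable {d N : ℕ} {V : (n : ℕ) → Kernel d (n + 1)}

/-- The value of the smeared monomial at the classical spin configuration `m`. -/
noncomputable def val (m : E d → E 3) (f : Obs d) : ℂ :=
  ∫ x : f.P → E d, f.ker x * ∏ k, coord (f.idx k) (m (x k))

/-- A bound for the classical value of the smeared monomial. -/
noncomputable def clNorm (f : Obs d) : ℝ := Real.sqrt 2 ^ f.deg * ∫ x : f.P → E d, ‖f.ker x‖

theorem clNorm_nonneg (f : Obs d) : 0 ≤ f.clNorm :=
  mul_nonneg (by positivity) (integral_nonneg fun _ => norm_nonneg _)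

theorem integrable_ker (f : Obs d) : Integrable f.ker :=
  f.continuous.integrable_of_hasCompactSupport f.compactSupport

theorem val_congr {m m' : E d → E 3} (h : m =ᵐ[volume] m') (f : Obs d) : f.val m = f.val m' := by
  refine integral_congr_ae ?_
  filter_upwards [ae_pi_of_ae (P := f.P) h] with x hx
  simp only [hx]

theorem tendsto_pi_latticePoint {P : Type} (y : P → E d) :
    Tendsto (fun (h : ℝ) (k : P) => latticePoint h (floorSite h (y k))) (𝓝[>] 0) (𝓝 y) :=
  tendsto_pi_nhds.2 fun k => tendsto_latticePoint_floorSite (y k)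

theorem tendsto_latNorm (f : Obs d) : Tendsto (fun h => f.latNorm h) (𝓝[>] 0) (𝓝 f.clNorm) := by
  obtain ⟨C, hC0, hC⟩ := f.exists_ker_le
  obtain ⟨R, hR0, hR⟩ := f.exists_norm_le
  have h0 : ∀ y : f.P → E d, Tendsto
      (fun h : ℝ => ((‖f.ker fun k => latticePoint h (floorSite h (y k))‖ : ℝ) : ℂ)) (𝓝[>] 0)
      (𝓝 ((‖f.ker y‖ : ℝ) : ℂ)) := fun y =>
    (((Complex.continuous_ofReal.comp f.continuous.norm).tendsto y).comp
      (tendsto_pi_latticePoint y) :)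
  have h1 : Tendsto (fun h : ℝ => ((h ^ (Fintype.card f.P * d) : ℝ) : ℂ) *
      ∑' z : f.P → Site d, ((‖f.ker fun k => latticePoint h (z k)‖ : ℝ) : ℂ)) (𝓝[>] 0)
      (𝓝 (∫ y, ((‖f.ker y‖ : ℝ) : ℂ))) := by
    refine tendsto_lattice_sum (P := f.P)
      (fun h (z : f.P → Site d) => ((‖f.ker fun k => latticePoint h (z k)‖ : ℝ) : ℂ))
      (fun y => ((‖f.ker y‖ : ℝ) : ℂ)) C R ?_ ?_ ?_
    · refine Eventually.of_forall fun h z => ?_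
      rw [Complex.norm_real, norm_norm]
      exact hC fun k => latticePoint h (z k)
    · refine Eventually.of_forall fun h z hz => hR (fun k => latticePoint h (z k)) fun h2 => hz ?_
      rw [h2, norm_zero, Complex.ofReal_zero]
    · exact Eventually.of_forall h0
  have h3 : ∀ h : ℝ, ((h ^ (Fintype.card f.P * d) : ℝ) : ℂ) *
      ∑' z : f.P → Site d, ((‖f.ker fun k => latticePoint h (z k)‖ : ℝ) : ℂ) =
      ((h ^ (Fintype.card f.P * d) *
        ∑' z : f.P → Site d, ‖f.ker fun k => latticePoint h (z k)‖ : ℝ) : ℂ) := by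
    intro h
    rw [Complex.ofReal_mul, Complex.ofReal_tsum]
  simp only [h3, integral_complex_ofReal] at h1
  have h2 := ((Complex.continuous_re.tendsto _).comp h1).const_mul (Real.sqrt 2 ^ f.deg)
  rw [Complex.ofReal_re] at h2
  refine h2.congr fun h => ?_
  simp only [Function.comp_apply, Complex.ofReal_re]
  rw [latNorm, mul_pow, ← pow_mul, mul_assoc, deg, mul_comm d]

/-- The lattice estimate passes to the limit h → 0. For this `clNorm` carries the factor √2^deg of
`latNorm`, although classical spins would do without it. -/
theorem sum_clNorm_child_le (f : Obs d) (hV : IsPotential V) {C : ℝ}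
    (hC : ∀ᶠ h in 𝓝[>] (0 : ℝ), PotentialBound V C h) (n : ℕ) :
    ∑ b, (f.child hV n b).clNorm ≤ f.deg * growth C n * f.clNorm := by
  refine le_of_tendsto_of_tendsto (tendsto_finsetSum _ fun b _ => (f.child hV n b).tendsto_latNorm)
    (f.tendsto_latNorm.const_mul _) ?_
  filter_upwards [hC, self_mem_nhdsWithin] with h h1 (h2 : 0 < h)
  exact f.sum_latNorm_child_le hV h1 h2 n

/-- Product states evaluate the smeared monomials classically in the continuum limit. -/
theorem tendsto_productState_quant (hd : 0 < d) (hN : 0 < N) (M₀ : E d → E 3)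
    (hM₀ : ∀ x, ‖M₀ x‖ = 1) (hdisc : (volume : Measure (E d)) {x | ¬ ContinuousAt M₀ x} = 0)
    (f : Obs d) :
    Tendsto (fun h => productState h M₀ (f.quant N h)) (𝓝[>] 0) (𝓝 (f.val M₀)) := by
  obtain ⟨C, hC0, hC⟩ := f.exists_ker_le
  obtain ⟨R, hR0, hR⟩ := f.exists_norm_le
  -- The factor h^(-deg·d) turns each term into a density with respect to cell volume; it is bounded
  -- because every rescaled spin has norm of order h^d.
  have h1 := tendsto_lattice_sum
    (fun h (z : f.P → Site d) =>
      ((h ^ (f.deg * d) : ℝ) : ℂ)⁻¹ * productState h M₀ (f.term N h z))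
    (fun y => f.ker y * ∏ k, coord (f.idx k) (M₀ (y k))) (Real.sqrt 2 ^ f.deg * C) R ?_ ?_ ?_
  · refine h1.congr' ?_
    filter_upwards [self_mem_nhdsWithin] with h (hh : 0 < h)
    obtain ⟨F, hF⟩ := f.exists_sites hh
    rw [tsum_mul_left, ← mul_assoc, deg, mul_inv_cancel₀ (by
      rw [Complex.ofReal_ne_zero]; positivity), one_mul, quant_eq_sum hF, map_sum,
      tsum_eq_sum fun x hx => by rw [term, notMem_piFinset hF x hx, zero_smul, map_zero]]
  · filter_upwards [self_mem_nhdsWithin] with h (hh : 0 < h) z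
    have h2 := (norm_productState_le h M₀ (f.term N h z)).trans (f.norm_term_le hN hh.le z)
    have h3 : (0 : ℝ) < h ^ (f.deg * d) := by positivity
    rw [norm_mul, norm_inv, Complex.norm_real, Real.norm_of_nonneg h3.le, inv_mul_le_iff₀ h3]
    refine h2.trans ?_
    rw [mul_pow, ← pow_mul, mul_comm d]
    have h4 := mul_le_mul_of_nonneg_left (hC fun k => latticePoint h (z k))
      (by positivity : 0 ≤ Real.sqrt 2 ^ f.deg * h ^ (f.deg * d))
    linarith
  · refine Eventually.of_forall fun h z hz =>
      hR (fun k => latticePoint h (z k)) fun h0 => hz ?_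
    rw [term, h0, zero_smul, map_zero, mul_zero]
  · have hae : ∀ᵐ x : E d, ContinuousAt M₀ x := hdisc
    -- Almost every tuple has distinct entries at which `M₀` is continuous. Distinct points lie in
    -- distinct cells once h is small, so the sites differ, the state factorizes, and the order
    -- `f.ord` plays no role.
    filter_upwards [ae_injective (P := f.P) hd, ae_pi_of_ae (P := f.P) hae] with y hy1 hy2
    have h2 : ∀ᶠ h in 𝓝[>] (0 : ℝ), ∀ k l, k ≠ l → floorSite h (y k) ≠ floorSite h (y l) := by
      refine eventually_all.2 fun k => eventually_all.2 fun l => ?_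
      by_cases hkl : k = l
      · exact Eventually.of_forall fun h h' => absurd hkl h'
      · have h3 := (tendsto_latticePoint_floorSite (y k)).prodMk_nhds
          (tendsto_latticePoint_floorSite (y l))
        filter_upwards [h3.eventually (isOpen_ne_fun continuous_fst continuous_snd |>.mem_nhds
          (fun h => hkl (hy1 h) : y k ≠ y l))] with h h3 _ h4
        exact h3 (by rw [h4])
    have h3 : Tendsto (fun h : ℝ => f.ker (fun k => latticePoint h (floorSite h (y k))) *
        ∏ k, coord (f.idx k) (M₀ (latticePoint h (floorSite h (y k))))) (𝓝[>] 0)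
        (𝓝 (f.ker y * ∏ k, coord (f.idx k) (M₀ (y k)))) := by
      refine ((f.continuous.tendsto y).comp (tendsto_pi_latticePoint y)).mul ?_
      refine tendsto_finsetProd _ fun k _ => ?_
      exact ((continuous_coord _).tendsto _).comp
        ((hy2 k).tendsto.comp (tendsto_latticePoint_floorSite (y k)))
    refine h3.congr' ?_
    filter_upwards [h2, self_mem_nhdsWithin] with h h4 (hh : 0 < h)
    have h5 : (f.ord.map fun k => floorSite h (y k)).Nodup :=
      f.nodup.map fun k l hkl => by
        by_contra hne
        exact h4 k l hne hkl
    have h6 : ∀ g : f.P → ℂ, (f.ord.map g).prod = ∏ k, g k := by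
      intro g
      have h7 : f.ord.toFinset = Finset.univ :=
        Finset.eq_univ_of_forall fun k => List.mem_toFinset.2 (f.mem_ord k)
      rw [← h7, List.prod_toFinset _ f.nodup]
    rw [term, map_smul, productState_prod_spin h M₀ f.idx _ h5
      (fun y i => coherentVector_expectation (hM₀ y) i) hN, h6, Finset.prod_mul_distrib,
      Finset.prod_const, Finset.card_univ, smul_eq_mul, deg]
    have h8 : ((h ^ (Fintype.card f.P * d) : ℝ) : ℂ) ≠ 0 := by
      rw [Complex.ofReal_ne_zero]; positivity
    have h9 : ((h ^ d : ℝ) : ℂ) ^ Fintype.card f.P = ((h ^ (Fintype.card f.P * d) : ℝ) : ℂ) := by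
      rw [← Complex.ofReal_pow, ← pow_mul, mul_comm d]
    rw [h9]
    field_simp

end Obs


/-! ### Differentiation of the classical values -/

/-- Bounded measurable spin configurations. -/
abbrev Field (d : ℕ) : Type := Lp (E 3) ∞ (volume : Measure (E d))

theorem Field.ae_norm_le {d : ℕ} (g : Field d) : ∀ᵐ x : E d, ‖g x‖ ≤ ‖g‖ := by
  filter_upwards [ae_le_eLpNormEssSup (f := (g : E d → E 3)) (μ := volume)] with x hx
  have h1 : eLpNormEssSup g volume = ENNReal.ofReal ‖g‖ := by
    rw [← eLpNorm_exponent_top, Lp.norm_def, ENNReal.ofReal_toReal (Lp.eLpNorm_ne_top g)]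
  rw [h1, ← ofReal_norm] at hx
  exact (ENNReal.ofReal_le_ofReal_iff (norm_nonneg _)).1 hx

section Multilinear

variable {P : Type} [Fintype P] {d : ℕ}

theorem ae_norm_prod_coord_le (idx : P → Fin 3) (g : P → Field d) :
    ∀ᵐ x : P → E d, ‖∏ k, coord (idx k) (g k (x k))‖ ≤ ∏ k, ‖g k‖ := by
  have h1 : ∀ᵐ x : P → E d, ∀ k, ‖g k (x k)‖ ≤ ‖g k‖ := ae_all_iff.2 fun k =>
    (Measure.quasiMeasurePreserving_eval (fun _ : P => (volume : Measure (E d))) k).ae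
      (g k).ae_norm_le
  filter_upwards [h1] with x hx
  rw [norm_prod]
  exact Finset.prod_le_prod (fun k _ => norm_nonneg _) fun k _ => (norm_coord_le _ _).trans (hx k)

theorem aestronglyMeasurable_prod_coord (idx : P → Fin 3) (g : P → Field d) :
    AEStronglyMeasurable (fun x : P → E d => ∏ k, coord (idx k) (g k (x k))) := by
  refine Finset.aestronglyMeasurable_fun_prod _ fun k _ => ?_
  exact ((continuous_coord (idx k)).comp_stronglyMeasurable
    ((Lp.stronglyMeasurable (g k)).comp_measurable (measurable_pi_apply k))).aestronglyMeasurable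

theorem integrable_ker_mul_prod {ker : (P → E d) → ℂ} (hker : Integrable ker)
    (idx : P → Fin 3) (g : P → Field d) :
    Integrable fun x : P → E d => ker x * ∏ k, coord (idx k) (g k (x k)) :=
  hker.mul_bdd (aestronglyMeasurable_prod_coord idx g) (ae_norm_prod_coord_le idx g)

theorem prod_update {ι α β : Type*} [Fintype ι] [DecidableEq ι] [CommMonoid β] (F : ι → α → β)
    (g : ι → α) (i : ι) (v : α) :
    ∏ k, F k (Function.update g i v k) = F i v * ∏ k ∈ Finset.univ.erase i, F k (g k) := by
  rw [← Finset.mul_prod_erase _ _ (Finset.mem_univ i), Function.update_self]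
  congr 1
  exact Finset.prod_congr rfl fun k hk => by rw [Function.update_of_ne (Finset.ne_of_mem_erase hk)]

/-- The multilinear form on `L^∞` that is given by an integrable kernel. -/
noncomputable def kernelForm (idx : P → Fin 3) (ker : (P → E d) → ℂ) (hker : Integrable ker) :
    ContinuousMultilinearMap ℝ (fun _ : P => Field d) ℂ :=
  MultilinearMap.mkContinuous
    { toFun := fun g => ∫ x : P → E d, ker x * ∏ k, coord (idx k) (g k (x k))
      map_update_add' := by
        intro _ g i v w
        rw [← integral_add (integrable_ker_mul_prod hker _ _) (integrable_ker_mul_prod hker _ _)]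
        refine integral_congr_ae ?_
        have h1 := (Measure.quasiMeasurePreserving_eval
          (fun _ : P => (volume : Measure (E d))) i).ae (Lp.coeFn_add v w)
        filter_upwards [h1] with x hx
        rw [prod_update (fun k (u : Field d) => coord (idx k) (u (x k))),
          prod_update (fun k (u : Field d) => coord (idx k) (u (x k))),
          prod_update (fun k (u : Field d) => coord (idx k) (u (x k)))]
        have h2 : (v + w : Field d) (x i) = v (x i) + w (x i) := hx
        rw [h2, coord_add]
        ring
      map_update_smul' := by
        intro _ g i c v
        rw [← integral_smul]
        refine integral_congr_ae ?_
        have h1 := (Measure.quasiMeasurePreserving_eval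
          (fun _ : P => (volume : Measure (E d))) i).ae (Lp.coeFn_smul c v)
        filter_upwards [h1] with x hx
        rw [prod_update (fun k (u : Field d) => coord (idx k) (u (x k))),
          prod_update (fun k (u : Field d) => coord (idx k) (u (x k)))]
        have h2 : (c • v : Field d) (x i) = c • v (x i) := hx
        rw [h2, coord_smul, Complex.real_smul]
        ring }
    (∫ x, ‖ker x‖) (by
      intro g
      change ‖∫ x : P → E d, ker x * ∏ k, coord (idx k) (g k (x k))‖ ≤ _
      rw [← integral_mul_const]
      refine norm_integral_le_of_norm_le (hker.norm.mul_const _) ?_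
      filter_upwards [ae_norm_prod_coord_le idx g] with x hx
      rw [norm_mul]
      exact mul_le_mul_of_nonneg_left hx (norm_nonneg _))

theorem kernelForm_apply (idx : P → Fin 3) (ker : (P → E d) → ℂ) (hker : Integrable ker)
    (g : P → Field d) :
    kernelForm idx ker hker g = ∫ x : P → E d, ker x * ∏ k, coord (idx k) (g k (x k)) := rfl

/-- The integral is a bounded multilinear form on L^∞ evaluated at the diagonal curve (m, …, m), and
the chain rule gives one term for each argument. -/
theorem hasDerivAt_integral_prod [DecidableEq P] (idx : P → Fin 3) {ker : (P → E d) → ℂ}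
    (hker : Integrable ker) {m : ℝ → Field d} {m' : Field d} {t : ℝ} (hm : HasDerivAt m m' t) :
    HasDerivAt (fun τ => ∫ x : P → E d, ker x * ∏ k, coord (idx k) (m τ (x k)))
      (∑ i, ∫ x : P → E d, ker x * (coord (idx i) (m' (x i)) *
        ∏ k ∈ Finset.univ.erase i, coord (idx k) (m t (x k)))) t := by
  have h1 : HasDerivAt (fun τ => (fun _ : P => m τ)) (fun _ : P => m') t :=
    hasDerivAt_pi.2 fun _ => hm
  have h2 := ((kernelForm idx ker hker).hasFDerivAt (x := fun _ : P => m t)).comp_hasDerivAt t h1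
  rw [ContinuousMultilinearMap.linearDeriv_apply] at h2
  refine HasDerivAt.congr_deriv h2 (Finset.sum_congr rfl fun i _ => ?_)
  rw [kernelForm_apply]
  refine integral_congr_ae (Eventually.of_forall fun x => ?_)
  change ker x * _ = ker x * _
  rw [prod_update (fun k (u : Field d) => coord (idx k) (u (x k)))]

end Multilinear


/-! ### The equation of motion of the classical values -/

namespace Obs

variable {d : ℕ} {V : (n : ℕ) → Kernel d (n + 1)}

/-- The integrand of the classical value. -/
noncomputable def integrand (m : E d → E 3) (f : Obs d) (x : f.P → E d) : ℂ :=
  f.ker x * ∏ k, coord (f.idx k) (m (x k))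

theorem integrable_integrand (f : Obs d) (m : Field d) : Integrable (f.integrand m) :=
  integrable_ker_mul_prod f.integrable_ker f.idx fun _ => m

theorem integral_norm_integrand_le (f : Obs d) {m : Field d} (hm : ‖m‖ ≤ 1) :
    ∫ x, ‖f.integrand m x‖ ≤ f.clNorm := by
  have h1 : ∫ x, ‖f.integrand m x‖ ≤ ∫ x, ‖f.ker x‖ := by
    refine integral_mono_ae (f.integrable_integrand m).norm f.integrable_ker.norm ?_
    filter_upwards [ae_norm_prod_coord_le f.idx fun _ => m] with x hx
    change ‖f.ker x * _‖ ≤ ‖f.ker x‖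
    rw [norm_mul]
    refine mul_le_of_le_one_right (norm_nonneg _) (hx.trans ?_)
    exact Finset.prod_le_one (fun _ _ => norm_nonneg _) fun _ _ => hm
  refine h1.trans (le_mul_of_one_le_left (integral_nonneg fun _ => norm_nonneg _) ?_)
  exact one_le_pow₀ (Real.one_le_sqrt.2 one_le_two)

theorem norm_val_le (f : Obs d) {m : Field d} (hm : ‖m‖ ≤ 1) : ‖f.val m‖ ≤ f.clNorm :=
  (norm_integral_le_integral_norm _).trans (f.integral_norm_integrand_le hm)

/-- The integrand of a child, integrated over the new arguments. -/
noncomputable def marginal (hV : IsPotential V) (f : Obs d) (m : E d → E 3) (n : ℕ)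
    (b : f.Idx n) (x : f.P → E d) : ℂ :=
  ∫ y : Fin n → E d, (f.child hV n b).integrand m (Sum.elim x y)

theorem integrable_integrand_sumElim (hV : IsPotential V) (f : Obs d) (m : Field d) (n : ℕ)
    (b : f.Idx n) :
    Integrable (fun z : (f.P → E d) × (Fin n → E d) =>
      (f.child hV n b).integrand m (Sum.elim z.1 z.2)) (volume.prod volume) := by
  have h1 := volume_measurePreserving_sumPiEquivProdPi_symm (fun _ : f.P ⊕ Fin n => E d)
  have h2 := (h1.integrable_comp_emb (MeasurableEquiv.measurableEmbedding _)).2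
    ((f.child hV n b).integrable_integrand m)
  refine h2.congr (Eventually.of_forall fun z => ?_)
  change (f.child hV n b).integrand m _ = (f.child hV n b).integrand m _
  congr 1

theorem integral_integrand_sumElim (hV : IsPotential V) (f : Obs d) (n : ℕ)
    (b : f.Idx n) {A : Type} [NormedAddCommGroup A] [NormedSpace ℝ A]
    (Φ : ((f.child hV n b).P → E d) → A) :
    ∫ z : (f.P → E d) × (Fin n → E d), Φ (Sum.elim z.1 z.2) ∂(volume.prod volume) =
      ∫ x, Φ x := by
  have h1 := volume_measurePreserving_sumPiEquivProdPi_symm (fun _ : f.P ⊕ Fin n => E d)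
  refine Eq.trans (integral_congr_ae (Eventually.of_forall fun z => ?_)) (h1.integral_comp' Φ)
  change Φ _ = Φ _
  congr 1

theorem integrable_marginal (hV : IsPotential V) (f : Obs d) (m : Field d) (n : ℕ)
    (b : f.Idx n) : Integrable (f.marginal hV m n b) :=
  (f.integrable_integrand_sumElim hV m n b).integral_prod_left

theorem integral_marginal (hV : IsPotential V) (f : Obs d) (m : Field d) (n : ℕ)
    (b : f.Idx n) : ∫ x, f.marginal hV m n b x = (f.child hV n b).val m :=
  (integral_prod _ (f.integrable_integrand_sumElim hV m n b)).symm.trans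
    (f.integral_integrand_sumElim hV n b ((f.child hV n b).integrand m))

theorem integral_norm_marginal_le (hV : IsPotential V) (f : Obs d) {m : Field d} (hm : ‖m‖ ≤ 1)
    (n : ℕ) (b : f.Idx n) : ∫ x, ‖f.marginal hV m n b x‖ ≤ (f.child hV n b).clNorm := by
  refine le_trans ?_ ((f.child hV n b).integral_norm_integrand_le hm)
  rw [← f.integral_integrand_sumElim hV n b fun x => ‖(f.child hV n b).integrand m x‖]
  have h1 := f.integrable_integrand_sumElim hV m n b
  rw [integral_prod _ h1.norm]
  exact integral_mono (f.integrable_marginal hV m n b).norm h1.norm.integral_prod_left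
    fun x => norm_integral_le_integral_norm _

/-- Separating the argument `b.1` from the others leaves precisely an integral of `llField` at the
point `x b.1`; the replaced index is the index j of that field. -/
theorem marginal_eq (hV : IsPotential V) (f : Obs d) (m : E d → E 3) (n : ℕ)
    (b : f.Idx n) (x : f.P → E d) :
    f.marginal hV m n b x =
      (f.ker x * Complex.I * ∏ k ∈ Finset.univ.erase b.1, coord (f.idx k) (m (x k))) *
      ∫ y : Fin n → E d, V n b.2.2.1 (Fin.cons (x b.1) y : Fin (n + 1) → E d) *
        epsT (b.2.2.1 0) (f.idx b.1) b.2.2.2 * coord b.2.2.2 (m (x b.1)) *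
        ∏ r : Fin n, coord (b.2.2.1 r.succ) (m (y r)) := by
  rw [marginal, ← integral_const_mul]
  refine integral_congr_ae (Eventually.of_forall fun y => ?_)
  change (Complex.I * epsT (b.2.2.1 0) (f.idx b.1) b.2.2.2 * (f.ker x *
    V n b.2.2.1 (Fin.cons (x b.1) y))) * ∏ s : f.P ⊕ Fin n,
      coord (Sum.elim (Function.update f.idx b.1 b.2.2.2) (fun r => b.2.2.1 r.succ) s)
        (m (Sum.elim x y s)) = _
  rw [Fintype.prod_sum_type]
  simp only [Sum.elim_inl, Sum.elim_inr]
  rw [prod_update (fun k i => coord i (m (x k)))]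
  ring

/-- The Landau-Lifshitz field in terms of the children of an observable. -/
theorem hasSum_val_child (hV : IsPotential V) {C : ℝ} (hC0 : 0 ≤ C)
    (hC : ∀ᶠ h in 𝓝[>] (0 : ℝ), PotentialBound V C h) (f : Obs d) {m : Field d} (hm : ‖m‖ ≤ 1)
    (k : f.P) :
    HasSum (fun n => ∑ c : Fin (n + 1) × (Fin (n + 1) → Fin 3) × Fin 3,
        (f.child hV n (k, c)).val m)
      (∫ x : f.P → E d, f.ker x * (llField V m (f.idx k) (x k) *
        ∏ l ∈ Finset.univ.erase k, coord (f.idx l) (m (x l)))) := by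
  have h1 : ∀ n, Integrable fun x => ∑ c : Fin (n + 1) × (Fin (n + 1) → Fin 3) × Fin 3,
      f.marginal hV m n (k, c) x := fun n =>
    integrable_finsetSum _ fun c _ => f.integrable_marginal hV m n (k, c)
  have h2 : Summable fun n => ∫ x, ‖∑ c : Fin (n + 1) × (Fin (n + 1) → Fin 3) × Fin 3,
      f.marginal hV m n (k, c) x‖ := by
    -- Summability, needed to exchange the series over n with the integral, comes from the growth
    -- bound for all children, of which those with the given `k` are a part.
    refine Summable.of_nonneg_of_le (fun n => integral_nonneg fun _ => norm_nonneg _)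
      (fun n => ?_) (((summable_growth' hC0).mul_left (f.deg : ℝ)).mul_right f.clNorm)
    refine le_trans ?_ (f.sum_clNorm_child_le hV hC n)
    rw [Fintype.sum_prod_type]
    refine le_trans ?_ (Finset.single_le_sum
      (f := fun k : f.P => ∑ c : Fin (n + 1) × (Fin (n + 1) → Fin 3) × Fin 3,
        (f.child hV n (k, c)).clNorm)
      (fun k _ => Finset.sum_nonneg fun c _ => clNorm_nonneg _) (Finset.mem_univ k))
    have h3 : ∀ c, Integrable fun x => ‖f.marginal hV m n (k, c) x‖ := fun c =>
      (f.integrable_marginal hV m n (k, c)).norm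
    refine (integral_mono (h1 n).norm (integrable_finsetSum _ fun c _ => h3 c)
      fun x => norm_sum_le _ _).trans ?_
    rw [integral_finsetSum _ fun c _ => h3 c]
    exact Finset.sum_le_sum fun c _ => f.integral_norm_marginal_le hV hm n (k, c)
  have h4 := hasSum_integral_of_summable_integral_norm h1 h2
  simp only [integral_finsetSum _ fun c _ => f.integrable_marginal hV m _ (k, c),
    integral_marginal] at h4
  convert! h4 using 1
  refine integral_congr_ae (Eventually.of_forall fun x => ?_)
  have h5 : ∀ n : ℕ, ∑ c : Fin (n + 1) × (Fin (n + 1) → Fin 3) × Fin 3,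
      f.marginal hV m n (k, c) x =
      (f.ker x * Complex.I * ∏ l ∈ Finset.univ.erase k, coord (f.idx l) (m (x l))) *
        (((n : ℂ) + 1) * ∑ q : Fin (n + 1) → Fin 3, ∑ j : Fin 3,
          ∫ y : Fin n → E d, V n q (Fin.cons (x k) y : Fin (n + 1) → E d) *
            epsT (q 0) (f.idx k) j * coord j (m (x k)) *
            ∏ r : Fin n, coord (q r.succ) (m (y r))) := by
    intro n
    simp only [marginal_eq]
    -- Classical values do not see the order of the factors, so the summand is independent of `l`;
    -- that sum is the factor n + 1 in the equation.
    rw [← Finset.mul_sum, Fintype.sum_prod_type]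
    simp only [Fintype.sum_prod_type, Finset.sum_const, Finset.card_univ, Fintype.card_fin,
      nsmul_eq_mul]
    push_cast
    rfl
  change _ = ∑' n, _
  simp only [h5]
  rw [tsum_mul_left, llField]
  ring

/-- The equation of motion of the classical values. -/
theorem hasDerivAt_val (hV : IsPotential V) {C : ℝ} (hC0 : 0 ≤ C)
    (hC : ∀ᶠ h in 𝓝[>] (0 : ℝ), PotentialBound V C h) {M₀ : E d → E 3} {M : ℝ → PhaseSpace d}
    (hM : IsLLSolution V M₀ M) (f : Obs d) (t : ℝ) :
    HasDerivAt (fun τ => f.val (M τ : Field d))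
      (∑' n, ∑ b, (f.child hV n b).val (M t : Field d)) t := by
  obtain ⟨-, M', -, hM'⟩ := hM
  have hm : ‖(M t : Field d)‖ ≤ 1 := mem_closedBall_zero_iff.1 (M t).2
  have h1 := hasDerivAt_integral_prod f.idx f.integrable_ker (hM' t).1
  refine h1.congr_deriv ?_
  have h2 := hasSum_sum fun (k : f.P) (_ : k ∈ Finset.univ) =>
    f.hasSum_val_child hV hC0 hC hm k
  simp only [Fintype.sum_prod_type] at h2 ⊢
  rw [h2.tsum_eq]
  refine Finset.sum_congr rfl fun k _ => integral_congr_ae ?_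
  filter_upwards [ae_pi_of_ae (P := f.P) (hM' t).2] with x hx
  rw [hx k (f.idx k)]

end Obs


/-! ### Convergence of the quantum dynamics to the classical dynamics -/

theorem hasDerivAt_clm_tsum {A : Type*} [NormedAddCommGroup A] [NormedSpace ℂ A] [NormedSpace ℝ A]
    [IsScalarTower ℝ ℂ A] (ρ : A →L[ℂ] ℂ) {F : ℝ → A} {G : ℕ → A} {t : ℝ} (hG : Summable G)
    (hF : HasDerivAt F (∑' n, G n) t) : HasDerivAt (fun t => ρ (F t)) (∑' n, ρ (G n)) t := by
  have h1 := (ρ.restrictScalars ℝ).hasFDerivAt.comp_hasDerivAt t hF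
  refine HasDerivAt.congr_deriv h1 ?_
  exact ρ.map_tsum hG

section Limit

variable {d N : ℕ} {V : (n : ℕ) → Kernel d (n + 1)}

theorem norm_sum_val_child_le (hV : IsPotential V) {C : ℝ}
    (hC : ∀ᶠ h in 𝓝[>] (0 : ℝ), PotentialBound V C h) (f : Obs d) {m : Field d} (hm : ‖m‖ ≤ 1)
    (n : ℕ) : ‖∑ b, (f.child hV n b).val m‖ ≤ f.deg * growth C n * f.clNorm :=
  (norm_sum_le_of_le _ fun b _ => (f.child hV n b).norm_val_le hm).trans
    (f.sum_clNorm_child_le hV hC n)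

/-- Expectations in finite volume, compared with the classical values. -/
theorem eventually_finite_volume (hd : 0 < d) (hN : 0 < N) (hV : IsPotential V)
    {M₀ : E d → E 3} (hM₀ : ∀ x, ‖M₀ x‖ = 1)
    (hdisc : (volume : Measure (E d)) {x | ¬ ContinuousAt M₀ x} = 0)
    {M : ℝ → PhaseSpace d} (hM : IsLLSolution V M₀ M) (T : ℝ) (f : Obs d) {ε : ℝ} (hε : 0 < ε) :
    ∀ᶠ h in 𝓝[>] (0 : ℝ), ∀ᶠ Λ : Finset (Site d) in atTop, ∀ t, |t| ≤ T →
      ‖productState h M₀ (localDynamics h V Λ t (f.quant N h)) - f.val (M t : Field d)‖ ≤ ε := by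
  obtain ⟨C, hC0, hC⟩ := exists_potentialBound hV
  have hm : ∀ t, ‖(M t : Field d)‖ ≤ 1 := fun t => mem_closedBall_zero_iff.1 (M t).2
  have hgood : ∀ᶠ h in 𝓝[>] (0 : ℝ), 0 < h ∧ PotentialBound V C h :=
    (eventually_mem_nhdsWithin).and hC
  -- The filter is iterated: h is taken small first, and then Λ large depending on h. Estimates that
  -- hold for every Λ lift to it immediately.
  have lift : ∀ {p : ℝ × Finset (Site d) → Prop},
      (∀ h, 0 < h → PotentialBound V C h → ∀ Λ, p (h, Λ)) →
      ∀ᶠ a in (𝓝[>] (0 : ℝ)).curry atTop, p a := fun hp =>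
    eventually_curry_iff.2 (hgood.mono fun h h1 => Eventually.of_forall (hp h h1.1 h1.2))
  have hsum : ∀ (f : Obs d) t, Summable fun n => ∑ b, (f.child hV n b).val (M t : Field d) :=
    fun f t => Summable.of_norm_bounded (((summable_growth' hC0).mul_left _).mul_right _)
      fun n => norm_sum_val_child_le hV hC f (hm t) n
  have key := hierarchy_tendsto_zero (O := Obs d) (X := ℂ)
    ((𝓝[>] (0 : ℝ)).curry (atTop : Filter (Finset (Site d))))
    Obs.deg Obs.Idx (fun f n b => f.child hV n b) (fun f n b => f.deg_child hV n b)
    (fun a t f => productState a.1 M₀ (localDynamics a.1 V a.2 t (f.quant N a.1)) -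
      f.val (M t : Field d))
    (fun a t f n =>
      productState a.1 M₀ (localDynamics a.1 V a.2 t (Obs.ad V a.1 a.2 n (f.quant N a.1))) -
        ∑ b, (f.child hV n b).val (M t : Field d))
    (fun a f => f.latNorm a.1 + f.clNorm) (growth C) (1 / 2) (by norm_num) (growth_nonneg hC0)
    (summable_growth C)
    (lift fun h h1 h2 Λ f => add_nonneg (f.latNorm_nonneg h1.le) f.clNorm_nonneg)
    (lift fun h h1 h2 Λ f t => by
      refine (norm_sub_le _ _).trans (add_le_add ?_ (f.norm_val_le (hm t)))
      refine (norm_productState_le _ _ _).trans ?_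
      rw [norm_localDynamics hV]
      exact f.norm_quant_le hN h1)
    (lift fun h h1 h2 Λ f n => by
      rw [Finset.sum_add_distrib]
      linarith [f.sum_latNorm_child_le hV h2 h1 n, f.sum_clNorm_child_le hV hC n])
    (lift fun h h1 h2 Λ f n t => by
      refine (norm_sub_le _ _).trans ?_
      have h3 := (norm_productState_le h M₀ _).trans
        (norm_localDynamics_ad_le hN hV h2 h1 Λ t n f)
      linarith [norm_sum_val_child_le hV hC f (hm t) n])
    (lift fun h h1 h2 Λ f t => by
      have h3 := summable_localDynamics_ad hN hV h2 hC0 h1 Λ t f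
      have h4 := hasDerivAt_clm_tsum (productState (d := d) (N := N) h M₀) h3
        (hasDerivAt_localDynamics hN hV h2 hC0 h1 Λ t (f.quant N h))
      rw [((productState (N := N) h M₀).summable h3).tsum_sub (hsum f t)]
      exact h4.sub (f.hasDerivAt_val hV hC0 hC hM t))
    -- The commutator becomes the sum of the children only beyond a volume that depends on h, and
    -- for this the iterated filter is needed.
    (fun f n => eventually_curry_iff.2 (hgood.mono fun h h1 => by
      filter_upwards [f.eventually_ad_quant hN hV h1.1 n] with Λ hΛ t
      rw [hΛ, localDynamics_sum, map_sum, Finset.sum_sub_distrib]))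
    -- Since `latNorm` converges to `clNorm`, it is eventually at most `clNorm + 1`.
    (fun f => ⟨(f.clNorm + 1) + f.clNorm, by
      refine eventually_curry_iff.2 ?_
      filter_upwards [f.tendsto_latNorm.eventually (ge_mem_nhds (lt_add_one _))] with h h1
      exact Eventually.of_forall fun Λ => add_le_add_left h1 _⟩)
    (fun f => by
      simp only [localDynamics_zero]
      -- At time zero neither dynamics acts. The classical value is an integral, so the agreement of
      -- `M 0` with `M₀` almost everywhere suffices.
      have h1 := (f.tendsto_productState_quant hd hN M₀ hM₀ hdisc).sub_const
        (f.val (M 0 : Field d))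
      rw [Obs.val_congr hM.1, sub_self] at h1
      rw [Obs.val_congr hM.1]
      refine h1.comp (f := Prod.fst) ?_
      refine tendsto_def.2 fun s hs => ?_
      exact eventually_curry_iff.2 (Filter.mem_of_superset hs fun h hh =>
        Eventually.of_forall fun _ => hh))
  exact eventually_curry_iff.1 (key T f ε hε)

/-- Convergence of the infinite-volume dynamics for sums of smeared monomials. -/
theorem tendsto_dynamics_sum (hN : 0 < N) (hV : IsPotential V) {C h : ℝ}
    (hC : PotentialBound V C h) (hC0 : 0 ≤ C) (hh : 0 < h) {ι : Type*} (s : Finset ι)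
    (f : ι → Obs d) (t : ℝ) :
    Tendsto (fun Λ : Finset (Site d) => localDynamics h V Λ t (∑ i ∈ s, (f i).quant N h)) atTop
      (𝓝 (dynamics h V t (∑ i ∈ s, (f i).quant N h))) := by
  choose y hy using fun i => tendsto_localDynamics hN hV hC hC0 hh t (f i)
  have h1 : Tendsto (fun Λ : Finset (Site d) => localDynamics h V Λ t (∑ i ∈ s, (f i).quant N h))
      atTop (𝓝 (∑ i ∈ s, y i)) := by
    simp only [localDynamics_sum]
    exact tendsto_finsetSum _ fun i _ => hy i
  exact tendsto_nhds_limUnder ⟨_, h1⟩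

/-- The finite-volume estimate is uniform in `t`, and as a non-strict inequality it survives Λ → ∞
at each `t` separately; the infinite-volume limit need not be uniform in time. -/
theorem tendstoUniformlyOn_productState (hd : 0 < d) (hN : 0 < N) (hV : IsPotential V)
    {M₀ : E d → E 3} (hM₀ : ∀ x, ‖M₀ x‖ = 1)
    (hdisc : (volume : Measure (E d)) {x | ¬ ContinuousAt M₀ x} = 0)
    {M : ℝ → PhaseSpace d} (hM : IsLLSolution V M₀ M) {ι : Type*} (s : Finset ι)
    (f : ι → Obs d) {K : Set ℝ} (hK : IsCompact K) :
    TendstoUniformlyOn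
      (fun (h : ℝ) (t : ℝ) => productState h M₀ (dynamics h V t (∑ i ∈ s, (f i).quant N h)))
      (fun t => ∑ i ∈ s, (f i).val (M t : Field d)) (𝓝[>] 0) K := by
  obtain ⟨C, hC0, hC⟩ := exists_potentialBound hV
  obtain ⟨T, hT⟩ := hK.isBounded.exists_norm_le
  rw [Metric.tendstoUniformlyOn_iff]
  intro ε hε
  have hδ : 0 < ε / (2 * ((s.card : ℝ) + 1)) := by positivity
  have h1 : ∀ᶠ h in 𝓝[>] (0 : ℝ), ∀ i ∈ s, ∀ᶠ Λ : Finset (Site d) in atTop, ∀ t, |t| ≤ T →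
      ‖productState h M₀ (localDynamics h V Λ t ((f i).quant N h)) -
        (f i).val (M t : Field d)‖ ≤ ε / (2 * ((s.card : ℝ) + 1)) :=
    (Finset.eventually_all s).2 fun i _ =>
      eventually_finite_volume hd hN hV hM₀ hdisc hM T (f i) hδ
  filter_upwards [h1, hC, self_mem_nhdsWithin] with h h2 h3 (h4 : 0 < h) t ht
  have h5 := ((productState (N := N) h M₀).continuous.tendsto _).comp
    (tendsto_dynamics_sum hN hV h3 hC0 h4 s f t)
  have h6 := (h5.sub_const (∑ i ∈ s, (f i).val (M t : Field d))).norm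
  have h7 : ‖productState h M₀ (dynamics h V t (∑ i ∈ s, (f i).quant N h)) -
      ∑ i ∈ s, (f i).val (M t : Field d)‖ ≤ s.card * (ε / (2 * ((s.card : ℝ) + 1))) := by
    refine le_of_tendsto h6 ?_
    filter_upwards [(Finset.eventually_all s).2 h2] with Λ hΛ
    simp only [Function.comp_apply]
    rw [localDynamics_sum, map_sum, ← Finset.sum_sub_distrib, ← nsmul_eq_mul]
    exact (norm_sum_le _ _).trans (Finset.sum_le_card_nsmul _ _ _ fun i hi => hΛ i hi t (hT t ht))
  rw [dist_comm, dist_eq_norm]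
  refine h7.trans_lt ?_
  rw [mul_div_assoc', div_lt_iff₀ (by positivity)]
  nlinarith

end Limit


/-! ### Existence of quantizations -/

section Smearing

variable {d : ℕ}

/-- The classical value of a family of kernels with arguments labelled by a finite type. -/
noncomputable def fieldValue {P : Type} [Fintype P] [DecidableEq P] (m : E d → E 3)
    (F : (P → Fin 3) → (P → E d) → ℂ) : ℂ :=
  ∑ i : P → Fin 3, ∫ x : P → E d, F i x * ∏ k, coord (i k) (m (x k))

theorem integral_comp_equiv {P P' : Type} [Fintype P] [Fintype P'] (e : P ≃ P')
    (G : (P → E d) → ℂ) : ∫ x : P' → E d, G (x ∘ e) = ∫ x, G x :=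
  (volume_preserving_arrowCongr' e.symm (MeasurableEquiv.refl (E d))
    (MeasurePreserving.id volume)).integral_comp' G

theorem fieldValue_comp_equiv {P P' : Type} [Fintype P] [Fintype P'] [DecidableEq P]
    [DecidableEq P'] (e : P ≃ P') (m : E d → E 3) (F : (P → Fin 3) → (P → E d) → ℂ) :
    fieldValue m (fun (i : P' → Fin 3) x => F (i ∘ e) (x ∘ e)) = fieldValue m F := by
  rw [fieldValue, fieldValue, ← (e.symm.arrowCongr (Equiv.refl (Fin 3))).sum_comp]
  refine Finset.sum_congr rfl fun i _ => ?_
  rw [← integral_comp_equiv e]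
  refine integral_congr_ae (Eventually.of_forall fun x => ?_)
  change F (i ∘ e) (x ∘ e) * _ = F (i ∘ e) (x ∘ e) * ∏ k, coord (i (e k)) (m (x (e k)))
  rw [e.prod_comp (fun k => coord (i k) (m (x k)))]

/-- Fubini: a function on the disjoint union of two index sets is a pair of functions. -/
theorem fieldValue_mul {P Q : Type} [Fintype P] [Fintype Q] [DecidableEq P] [DecidableEq Q]
    (m : E d → E 3) (F : (P → Fin 3) → (P → E d) → ℂ) (G : (Q → Fin 3) → (Q → E d) → ℂ) :
    fieldValue m F * fieldValue m G =
      fieldValue m (fun (i : P ⊕ Q → Fin 3) x => F (i ∘ Sum.inl) (x ∘ Sum.inl) *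
        G (i ∘ Sum.inr) (x ∘ Sum.inr)) := by
  rw [fieldValue, fieldValue, fieldValue, Finset.sum_mul_sum, ← Fintype.sum_prod_type',
    ← (Equiv.sumArrowEquivProdArrow P Q (Fin 3)).sum_comp]
  refine Finset.sum_congr rfl fun i _ => ?_
  rw [← integral_prod_mul, ← Measure.volume_eq_prod,
    ← (volume_measurePreserving_sumPiEquivProdPi (fun _ : P ⊕ Q => E d)).integral_comp']
  refine integral_congr_ae (Eventually.of_forall fun x => ?_)
  simp only [Fintype.prod_sum_type]
  exact mul_mul_mul_comm _ _ _ _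

theorem smearedField_eq {p : ℕ} (f : Kernel d p) (M : PhaseSpace d) :
    smearedField f M = fieldValue (M : Field d) f := rfl

theorem fieldValue_sum {P : Type} [Fintype P] [DecidableEq P] {ι : Type*} (s : Finset ι)
    (m : Field d) (F : ι → (P → Fin 3) → (P → E d) → ℂ) (hF : ∀ a i, Integrable (F a i)) :
    fieldValue m (fun i x => ∑ a ∈ s, F a i x) = ∑ a ∈ s, fieldValue m (F a) := by
  simp only [fieldValue]
  rw [Finset.sum_comm]
  refine Finset.sum_congr rfl fun i _ => ?_
  rw [← integral_finsetSum _ fun a _ => integrable_ker_mul_prod (hF a i) i fun _ => m]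
  simp only [Finset.sum_mul]

theorem fieldValue_smul {P : Type} [Fintype P] [DecidableEq P] (c : ℂ)
    (m : E d → E 3) (F : (P → Fin 3) → (P → E d) → ℂ) :
    fieldValue m (fun i x => c * F i x) = c * fieldValue m F := by
  simp only [fieldValue, Finset.mul_sum, mul_assoc, integral_const_mul]

theorem IsCompactSmearing.integrable {p : ℕ} {f : Kernel d p} (hf : IsCompactSmearing f)
    (i : Fin p → Fin 3) : Integrable (f i) :=
  (hf.continuous i).integrable_of_hasCompactSupport (hf.compactSupport i)

theorem IsCompactSmearing.exists_radius {p : ℕ} {f : Kernel d p} (hf : IsCompactSmearing f) :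
    ∃ R : ℝ, ∀ i x, R < ‖x‖ → f i x = 0 := by
  have h1 : ∀ i, ∃ R : ℝ, ∀ x, R < ‖x‖ → f i x = 0 := by
    intro i
    obtain ⟨R, hR⟩ := (hf.compactSupport i).isCompact.isBounded.subset_closedBall 0
    refine ⟨R, fun x hx => ?_⟩
    by_contra hne
    have h2 := hR (subset_tsupport _ hne)
    rw [mem_closedBall_zero_iff] at h2
    linarith
  choose R hR using h1
  obtain ⟨B, hB⟩ := (Set.finite_range R).bddAbove
  exact ⟨B, fun i x hx => hR i x ((hB ⟨i, rfl⟩).trans_lt hx)⟩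

theorem hasCompactSupport_of_radius {P : Type} [Fintype P] {F : (P → E d) → ℂ} {R : ℝ}
    (hF : ∀ x, R < ‖x‖ → F x = 0) : HasCompactSupport F :=
  HasCompactSupport.intro (isCompact_closedBall 0 R) fun x hx => hF x (by
    rwa [mem_closedBall_zero_iff, not_le] at hx)

/-- The tensor product of two kernels. -/
def tensorKernel {p q : ℕ} (f : Kernel d p) (g : Kernel d q) : Kernel d (p + q) := fun i x =>
  f ((i ∘ finSumFinEquiv) ∘ Sum.inl) ((x ∘ finSumFinEquiv) ∘ Sum.inl) *
    g ((i ∘ finSumFinEquiv) ∘ Sum.inr) ((x ∘ finSumFinEquiv) ∘ Sum.inr)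

/-- The symmetrization of a kernel. -/
noncomputable def symmKernel {p : ℕ} (f : Kernel d p) : Kernel d p := fun i x =>
  ((p.factorial : ℂ))⁻¹ * ∑ σ : Equiv.Perm (Fin p), f (i ∘ σ) (x ∘ σ)

theorem isCompactSmearing_symmKernel {p : ℕ} {f : Kernel d p} (hf : ∀ i, Continuous (f i))
    (hR : ∃ R : ℝ, ∀ i x, R < ‖x‖ → f i x = 0) : IsCompactSmearing (symmKernel f) where
  continuous i := by
    refine continuous_const.mul (continuous_finsetSum _ fun σ _ => (hf (i ∘ σ)).comp ?_)
    exact continuous_pi fun k => continuous_apply (σ k)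
  symmetric τ i x := by
    simp only [symmKernel]
    rw [← Equiv.sum_comp (Equiv.mulLeft τ) (fun σ : Equiv.Perm (Fin p) => f (i ∘ σ) (x ∘ σ))]
    rfl
  compactSupport i := by
    obtain ⟨R, hR⟩ := hR
    refine hasCompactSupport_of_radius (R := max R 0) fun x hx => ?_
    simp only [symmKernel]
    rw [Finset.sum_eq_zero fun σ _ => ?_, mul_zero]
    refine hR _ _ ?_
    by_contra hle
    refine hx.not_ge ?_
    rw [pi_norm_le_iff_of_nonneg (le_max_right _ _)]
    intro k
    have h1 := norm_le_pi_norm (x ∘ σ) (σ.symm k)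
    rw [Function.comp_apply, σ.apply_symm_apply] at h1
    exact (h1.trans (not_lt.1 hle)).trans (le_max_left _ _)

/-- Classical spins commute, so permuting indices and arguments of the kernel together leaves the
integral unchanged, and so does averaging over permutations. -/
theorem smearedField_symmKernel {p : ℕ} {f : Kernel d p} (hf : ∀ i, Integrable (f i)) :
    smearedField (symmKernel f) = smearedField f := by
  funext M
  rw [smearedField_eq, smearedField_eq]
  have h1 : ∀ (σ : Equiv.Perm (Fin p)) (i : Fin p → Fin 3),
      Integrable fun x : Fin p → E d => f (i ∘ σ) (x ∘ σ) := fun σ i =>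
    ((volume_preserving_arrowCongr' σ.symm (MeasurableEquiv.refl (E d))
      (MeasurePreserving.id volume)).integrable_comp_emb
        (MeasurableEquiv.measurableEmbedding _)).2 (hf (i ∘ σ))
  have h2 := fieldValue_sum Finset.univ (M : Field d)
    (fun (σ : Equiv.Perm (Fin p)) (i : Fin p → Fin 3) x => f (i ∘ σ) (x ∘ σ)) h1
  simp only [fieldValue_comp_equiv, Finset.sum_const, Finset.card_univ, Fintype.card_perm,
    Fintype.card_fin, nsmul_eq_mul] at h2
  have h3 : (p.factorial : ℂ) ≠ 0 := Nat.cast_ne_zero.2 p.factorial_ne_zero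
  refine (fieldValue_smul _ _ _).trans ?_
  rw [h2, inv_mul_cancel_left₀ h3]

/-- The product is the smeared field of the tensor product of the kernels, which has compact support
but is not symmetric; symmetrization repairs this at no cost. -/
theorem exists_smearedField_mul {p q : ℕ} {f : Kernel d p} {g : Kernel d q}
    (hf : IsCompactSmearing f) (hg : IsCompactSmearing g) :
    ∃ k : Kernel d (p + q), IsCompactSmearing k ∧
      smearedField f * smearedField g = smearedField k := by
  have hc : ∀ i, Continuous (tensorKernel f g i) := by
    intro i
    refine ((hf.continuous _).comp ?_).mul ((hg.continuous _).comp ?_) <;>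
    exact continuous_pi fun k => continuous_apply _
  have hR : ∃ R : ℝ, ∀ i x, R < ‖x‖ → tensorKernel f g i x = 0 := by
    obtain ⟨R, hR⟩ := hf.exists_radius
    obtain ⟨S, hS⟩ := hg.exists_radius
    refine ⟨max (max R S) 0, fun i x hx => ?_⟩
    by_contra hne
    refine hx.not_ge ?_
    have h1 : ‖(x ∘ finSumFinEquiv) ∘ Sum.inl‖ ≤ R := not_lt.1 fun h =>
      hne (by rw [tensorKernel, hR _ _ h, zero_mul])
    have h2 : ‖(x ∘ finSumFinEquiv) ∘ Sum.inr‖ ≤ S := not_lt.1 fun h =>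
      hne (by rw [tensorKernel, hS _ _ h, mul_zero])
    rw [pi_norm_le_iff_of_nonneg (le_max_right _ _)]
    intro k
    obtain ⟨s, rfl⟩ := finSumFinEquiv.surjective k
    rcases s with s | s
    · exact ((norm_le_pi_norm ((x ∘ finSumFinEquiv) ∘ Sum.inl) s).trans h1).trans
        ((le_max_left _ _).trans (le_max_left _ _))
    · exact ((norm_le_pi_norm ((x ∘ finSumFinEquiv) ∘ Sum.inr) s).trans h2).trans
        ((le_max_right _ _).trans (le_max_left _ _))
  refine ⟨symmKernel (tensorKernel f g), isCompactSmearing_symmKernel hc hR, ?_⟩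
  obtain ⟨R, hR⟩ := hR
  rw [smearedField_symmKernel fun i =>
    (hc i).integrable_of_hasCompactSupport (hasCompactSupport_of_radius (hR i))]
  funext M
  rw [Pi.mul_apply, smearedField_eq, smearedField_eq, smearedField_eq, fieldValue_mul]
  exact (fieldValue_comp_equiv finSumFinEquiv _ _).symm

theorem isCompactSmearing_zero (p : ℕ) : IsCompactSmearing (0 : Kernel d p) where
  continuous _ := continuous_const
  symmetric _ _ _ := rfl
  compactSupport _ := HasCompactSupport.zero

theorem smearedField_zero (p : ℕ) : smearedField (0 : Kernel d p) = 0 := by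
  funext M
  simp [smearedField]

theorem IsCompactSmearing.add {p : ℕ} {f g : Kernel d p} (hf : IsCompactSmearing f)
    (hg : IsCompactSmearing g) : IsCompactSmearing (f + g) where
  continuous i := (hf.continuous i).add (hg.continuous i)
  symmetric σ i x := congrArg₂ (· + ·) (hf.symmetric σ i x) (hg.symmetric σ i x)
  compactSupport i := (hf.compactSupport i).add (hg.compactSupport i)

theorem IsCompactSmearing.smul {p : ℕ} {f : Kernel d p} (hf : IsCompactSmearing f) (c : ℂ) :
    IsCompactSmearing (c • f) where
  continuous i := (hf.continuous i).const_smul c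
  symmetric σ i x := congrArg (c • ·) (hf.symmetric σ i x)
  compactSupport i := (hf.compactSupport i).smul_left (f := fun _ => c)

theorem smearedField_add {p : ℕ} {f g : Kernel d p} (hf : IsCompactSmearing f)
    (hg : IsCompactSmearing g) : smearedField (f + g) = smearedField f + smearedField g := by
  funext M
  have h1 := fieldValue_sum (Finset.univ : Finset (Fin 2)) (M : Field d)
    (fun a => ![f, g] a)
    (fun a i => by fin_cases a <;> [exact hf.integrable i; exact hg.integrable i])
  simp only [Fin.sum_univ_two] at h1
  exact h1

theorem smearedField_smul {p : ℕ} (f : Kernel d p) (c : ℂ) :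
    smearedField (c • f) = c • smearedField f := by
  funext M
  exact fieldValue_smul c _ f

theorem exists_smearedField_one : ∃ f : Kernel d 0, IsCompactSmearing f ∧ smearedField f = 1 := by
  refine ⟨fun _ _ => 1, ⟨⟨fun _ => continuous_const, fun _ _ _ => rfl⟩, fun _ => ?_⟩, ?_⟩
  · exact hasCompactSupport_of_radius (R := 0) fun x hx => by
      rw [Subsingleton.elim x 0, norm_zero] at hx
      exact absurd hx (lt_irrefl _)
  · funext M
    simp [smearedField, integral_unique, measureReal_def, volume_pi]

/-- The elements of the polynomial algebra are sums of smeared fields. -/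
theorem exists_kernels {A : PhaseSpace d → ℂ} (hA : A ∈ polyAlgebra d) :
    ∃ (P : ℕ) (f : (p : ℕ) → Kernel d p), (∀ p, IsCompactSmearing (f p)) ∧
      A = ∑ p ∈ Finset.range P, smearedField (f p) := by
  -- The smeared fields are closed under products and contain 1, so the algebra they generate is
  -- merely their linear span.
  let G : Submonoid (PhaseSpace d → ℂ) :=
    { carrier := {A | ∃ (p : ℕ) (f : Kernel d p), IsCompactSmearing f ∧ A = smearedField f}
      one_mem' := by
        obtain ⟨f, hf, h⟩ := exists_smearedField_one (d := d)
        exact ⟨0, f, hf, h.symm⟩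
      mul_mem' := by
        rintro _ _ ⟨p, f, hf, rfl⟩ ⟨q, g, hg, rfl⟩
        obtain ⟨k, hk, h⟩ := exists_smearedField_mul hf hg
        exact ⟨p + q, k, hk, h⟩ }
  have h1 : A ∈ Submodule.span ℂ (G : Set (PhaseSpace d → ℂ)) := by
    have h2 : A ∈ Subalgebra.toSubmodule (polyAlgebra d) := hA
    rw [polyAlgebra, Algebra.adjoin_eq_span] at h2
    refine Submodule.span_mono ?_ h2
    exact (Submonoid.closure_le (S := G)).2 subset_rfl
  -- Padding by zero kernels brings two sums to a common length before they are added degree by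
  -- degree.
  have hext : ∀ (P Q : ℕ) (f : (p : ℕ) → Kernel d p), P ≤ Q →
      ∑ p ∈ Finset.range Q, smearedField (if p < P then f p else 0) =
        ∑ p ∈ Finset.range P, smearedField (f p) := by
    intro P Q f hPQ
    rw [← Finset.sum_subset (Finset.range_mono hPQ) fun p _ hp => by
      rw [if_neg (by simpa using hp), smearedField_zero]]
    exact Finset.sum_congr rfl fun p hp => by rw [if_pos (Finset.mem_range.1 hp)]
  clear hA
  induction h1 using Submodule.span_induction with
  | mem A hA =>
    obtain ⟨p, f, hf, rfl⟩ := hA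
    refine ⟨p + 1, Function.update (fun _ => 0) p f, fun q => ?_, ?_⟩
    · by_cases hq : q = p
      · subst hq
        rwa [Function.update_self]
      · rw [Function.update_of_ne hq]
        exact isCompactSmearing_zero q
    · rw [Finset.sum_range_succ, Function.update_self, Finset.sum_eq_zero, zero_add]
      intro q hq
      rw [Function.update_of_ne (Finset.mem_range.1 hq).ne, smearedField_zero]
  | zero => exact ⟨0, fun _ => 0, isCompactSmearing_zero, by simp⟩
  | add A B _ _ hA hB =>
    obtain ⟨P, f, hf, rfl⟩ := hA
    obtain ⟨Q, g, hg, rfl⟩ := hB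
    have hf' : ∀ p, IsCompactSmearing (if p < P then f p else 0) := fun p => by
      split_ifs
      exacts [hf p, isCompactSmearing_zero p]
    have hg' : ∀ p, IsCompactSmearing (if p < Q then g p else 0) := fun p => by
      split_ifs
      exacts [hg p, isCompactSmearing_zero p]
    refine ⟨max P Q, fun p => (if p < P then f p else 0) + (if p < Q then g p else 0),
      fun p => (hf' p).add (hg' p), ?_⟩
    simp only [smearedField_add (hf' _) (hg' _), Finset.sum_add_distrib]
    rw [hext P _ f (le_max_left _ _), hext Q _ g (le_max_right _ _)]
  | smul c A _ hA =>
    obtain ⟨P, f, hf, rfl⟩ := hA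
    refine ⟨P, fun p => c • f p, fun p => (hf p).smul c, ?_⟩
    simp only [smearedField_smul, Finset.smul_sum]

/-- The components of a smearing function as observables. -/
def IsCompactSmearing.obs {p : ℕ} {f : Kernel d p} (hf : IsCompactSmearing f)
    (i : Fin p → Fin 3) : Obs d where
  P := Fin p
  fintypeP := inferInstance
  decEqP := inferInstance
  ord := slots i
  nodup := nodup_slots i
  mem_ord := mem_slots i
  idx := i
  ker := f i
  continuous := hf.continuous i
  compactSupport := hf.compactSupport i

theorem IsCompactSmearing.smearedSpin_eq {N p : ℕ} {f : Kernel d p} (hf : IsCompactSmearing f)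
    (h : ℝ) : (smearedSpin h f : quasiLocalAlgebra d N) = ∑ i, (hf.obs i).quant N h := by
  rw [smearedSpin]
  refine Finset.sum_congr rfl fun i _ => tsum_congr fun x => ?_
  rw [normalOrdered_eq]
  rfl

theorem IsCompactSmearing.smearedField_eq_sum {p : ℕ} {f : Kernel d p}
    (hf : IsCompactSmearing f) (M : PhaseSpace d) :
    smearedField f M = ∑ i, (hf.obs i).val (M : Field d) := rfl

end Smearing

end SpinLattice

/-! ### The classical limit of the infinite-volume dynamics -/

theorem mainTheorem6 {d N : ℕ} (hd : 0 < d) (hN : 0 < N)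
    (V : (n : ℕ) → Kernel d (n + 1)) (hV : IsPotential V)
    (M₀ : E d → E 3) (hM₀ : ∀ x, ‖M₀ x‖ = 1)
    (hdisc : (volume : Measure (E d)) {x | ¬ ContinuousAt M₀ x} = 0)
    (M : ℝ → PhaseSpace d) (hM : IsLLSolution V M₀ M)
    (A : PhaseSpace d → ℂ) (hA : A ∈ polyAlgebra d) :
    (∃ Q : ℝ → quasiLocalAlgebra d N, IsQuantization A Q) ∧
    ∀ Q : ℝ → quasiLocalAlgebra d N, IsQuantization A Q →
      (∀ᶠ h : ℝ in 𝓝[>] 0,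
        (∀ Λ : Finset (Site d),
          Summable fun n : ℕ => (smearedSpinOn h Λ (V n) : quasiLocalAlgebra d N)) ∧
        ∀ t : ℝ, Tendsto (fun Λ : Finset (Site d) => localDynamics h V Λ t (Q h)) atTop
          (𝓝 (dynamics h V t (Q h)))) ∧
      ∀ K : Set ℝ, IsCompact K →
        TendstoUniformlyOn (fun (h : ℝ) (t : ℝ) => productState h M₀ (dynamics h V t (Q h)))
          (fun t => A (M t)) (𝓝[>] 0) K := by
  refine ⟨?_, fun Q hQ => ?_⟩
  · obtain ⟨P, f, hf, h⟩ := exists_kernels hA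
    exact ⟨_, P, f, hf, h, fun h => rfl⟩
  · obtain ⟨P, f, hf, hAf, hQf⟩ := hQ
    -- An `Obs` carries a single tuple of indices, so each kernel is split into its components; the
    -- finite sum over these represents both `Q h` and `A` by the same observables.
    let s : Finset (Σ p : ℕ, (Fin p → Fin 3)) := (Finset.range P).sigma fun _ => Finset.univ
    let g : (Σ p : ℕ, (Fin p → Fin 3)) → Obs d := fun a => (hf a.1).obs a.2
    have hQ' : ∀ h, Q h = ∑ a ∈ s, (g a).quant N h := by
      intro h
      rw [hQf, Finset.sum_sigma]
      exact Finset.sum_congr rfl fun p _ => (hf p).smearedSpin_eq h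
    have hA' : ∀ t, A (M t) = ∑ a ∈ s, (g a).val (M t : Field d) := by
      intro t
      rw [hAf, Finset.sum_apply, Finset.sum_sigma]
      exact Finset.sum_congr rfl fun p _ => (hf p).smearedField_eq_sum (M t)
    simp only [hQ', hA']
    obtain ⟨C, hC0, hC⟩ := exists_potentialBound hV
    refine ⟨?_, fun K hK => tendstoUniformlyOn_productState hd hN hV hM₀ hdisc hM s g hK⟩
    filter_upwards [hC, self_mem_nhdsWithin] with h h1 (h2 : 0 < h)
    exact ⟨fun Λ => summable_smearedSpinOn hN h1 hC0 h2 Λ,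
      fun t => tendsto_dynamics_sum hN hV h1 hC0 h2 s g t⟩
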